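/- **Conventions.** Let $M$ be a smooth finite-dimensional manifold (Hausdorff, second countable, without boundary). Vector bundles over $M$ are real, smooth and of constant finite rank; $\Gamma V$ denotes the smooth sections of $V$, and $\wedge^{\mathrm{top}}V$ its top exterior power. A *Lie algebroid* over $M$ is a vector bundle $A\to M$ with an anchor $\rho_A:A\to TM$ and an $\mathbb R$-Lie bracket on $\Gamma A$ such that $[a,fb]=f[a,b]+(\rho_A(a)f)\,b$; it is *transitive* if $\rho_A$ is fibrewise surjective. $H^1(A)$ is the space of those $\alpha\in\Gamma(A^*)$ with $\rho_A(a)\langle\alpha,b\rangle-\rho_A(b)\langle\alpha,a\rangle-\langle\alpha,[a,b]\rangle=0$ for all $a,b\in\Gamma A$, modulo the sections $d_Af$, $\langle d_Af,a\rangle=\rho_A(a)f$, $f\in C^\infty(M)$. A *representation* $D$ of $A$ on a vector bundle $W$ assigns to $a\in\Gamma A$ an $\mathbb R$-linear operator $D_a$ on $\Gamma W$, $C^\infty(M)$-linearly in $a$, with $D_a(fw)=f\,D_aw+(\rho_A(a)f)\,w$ and $D_aD_b-D_bD_a=D_{[a,b]}$. **Characteristic and modular classes.** If $D$ is a representation of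 $A$ on an orientable line bundle $L$ and $\lambda\in\Gamma L$ vanishes nowhere, $\mathrm{char}\,D\in H^1(A)$ is the class of the section $\alpha_\lambda$ of $A^*$ given by $D_a\lambda=\langle\alpha_\lambda,a\rangle\lambda$; if $L$ is not orientable, $\mathrm{char}\,D$ is one-half of the characteristic class, so defined, of the representation $D\otimes D$ on $L\otimes L$. The modular class $\mathrm{Mod}\,A\in H^1(A)$ is $\mathrm{char}\,D^A$, where $D^A$ is the representation of $A$ on $\wedge^{\mathrm{top}}A\otimes\wedge^{\mathrm{top}}T^*M$ given by $$D^A_a(\omega\otimes\mu)=[a,\omega]\otimes\mu+\omega\otimes\mathcal L_{\rho_A(a)}\mu ,$$ with $[a,a_1\wedge\dots\wedge a_k]=\sum_j a_1\wedge\dots\wedge[a,a_j]\wedge\dots\wedge a_k$. $A$ is *unimodular* if $\mathrm{Mod}\,A=0$. A base-preserving morphism $\Phi:A\to B$ of Lie algebroids over $M$ is a vector bundle map over $\mathrm{id}_M$ that preserves anchors and brackets; $\Phi^*:H^1(B)\to H^1(A)$ is induced by $\alpha\mapsto\alpha\circ\Phi$, and $\mathrm{Mod}\,\Phi=\mathrm{Mod}\,A-\Phi^*(\mathrm{Mod}\,B)$.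 **Theorem 4.5.** Let $$0\longrightarrow C\xrightarrow{\ i\ }A\xrightarrow{\ \Phi\ }B\longrightarrow 0$$ be a Lie algebroid extension over $M$, that is, a fibrewise exact sequence of vector bundles whose maps $i,\Phi$ are base-preserving morphisms of Lie algebroids. Assume that $B$ is transitive and that $C$ (which necessarily has zero anchor) is unimodular. Let $r$ be the rank of $C$ and $K=\wedge^{\mathrm{top}}C=\wedge^rC$. Then: 1. the modular classes of $A$, $B$ and $C$ are well defined (they exist and do not depend on the choices made); 2. there is a unique representation $D^{A,K}$ of $A$ on $K$ such that $(\wedge^r i)(D^{A,K}_X\lambda)=[X,(\wedge^r i)\lambda]_A$ for all $X\in\Gamma A$ and all $\lambda=k_1\wedge\dots\wedge k_r$ with $k_j\in\Gamma C$; 3. there is a unique representation $D^{B,K}$ of $B$ on $K$ such that $D^{B,K}_{\Phi(X)}\lambda=D^{A,K}_X\lambda$ for all $X\in\Gamma A$, $\lambda\in\Gamma K$, and its characteristic class is well defined; 4. $$\mathrm{Mod}\,\Phi=\Phi^*(\mathrm{char}\,D^{B,K})\quad\text{in } H^1(A).$$ -/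

import Mathlib

open Bundle Module
open scoped Manifold ContDiff TensorProduct Topology

set_option linter.unusedSectionVars false

noncomputable section

namespace LieAlgd

/-! ### Line bundles from local frames -/

section LineBundles

variable {E : Type*} [NormedAddCommGroup E] [NormedSpace ℝ E]
  {M : Type*} [TopologicalSpace M] [ChartedSpace E M]

/-- Local frames of a family of real lines `L m`, `m ∈ M`, with continuous transition functions:
near each point `x`, on the open set `U x`, a basis vector `frame x m` of `L m` and the
corresponding coordinate `coord x m`. -/
structure LineFrames {M : Type*} [TopologicalSpace M]
    (L : M → Type*) [∀ m, AddCommGroup (L m)] [∀ m, Module ℝ (L m)] where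
  U : M → Set M
  isOpen_U : ∀ x, IsOpen (U x)
  mem_U : ∀ x, x ∈ U x
  frame : M → ∀ m, L m
  coord : M → ∀ m, L m →ₗ[ℝ] ℝ
  coord_frame : ∀ x, ∀ m ∈ U x, coord x m (frame x m) = 1
  coord_smul_frame : ∀ x, ∀ m ∈ U x, ∀ v : L m, coord x m v • frame x m = v
  continuousOn : ∀ x y, ContinuousOn (fun m => coord y m (frame x m)) (U x ∩ U y)

namespace LineFrames

variable {L : M → Type*} [∀ m, AddCommGroup (L m)] [∀ m, Module ℝ (L m)]
  (a : LineFrames L)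

/-- The trivialization over `U x` given by the frame. -/
def pretriv (x : M) : Pretrivialization ℝ (π ℝ L) where
  toFun p := (p.1, a.coord x p.1 p.2)
  invFun q := ⟨q.1, q.2 • a.frame x q.1⟩
  source := π ℝ L ⁻¹' a.U x
  target := a.U x ×ˢ Set.univ
  baseSet := a.U x
  map_source' p hp := by simpa using hp
  map_target' q hq := by simpa using hq
  left_inv' p hp := by
    obtain ⟨m, v⟩ := p
    simp only [TotalSpace.mk_inj]
    exact a.coord_smul_frame x m hp v
  right_inv' q hq := by
    obtain ⟨m, t⟩ := q
    have hm : m ∈ a.U x := hq.1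
    simp [a.coord_frame x m hm]
  open_target := (a.isOpen_U x).prod isOpen_univ
  open_baseSet := a.isOpen_U x
  source_eq := rfl
  target_eq := rfl
  proj_toFun _ _ := rfl

instance pretriv_isLinear (x : M) : (a.pretriv x).IsLinear ℝ where
  linear m _ := (a.coord x m).isLinear

lemma change_eq (x y : M) (m : M) (hm : m ∈ a.U x ∩ a.U y) (v : ℝ) :
    ((a.coord y m (a.frame x m)) • ContinuousLinearMap.id ℝ ℝ) v
      = (a.pretriv y ⟨m, (a.pretriv x).symm m v⟩).2 := by
  have h : (a.pretriv x).symm m v = v • a.frame x m := by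
    rw [Pretrivialization.symm_apply _ (show m ∈ (a.pretriv x).baseSet from hm.1)]
    rfl
  rw [h]
  change _ = a.coord y m (v • a.frame x m)
  simp [mul_comm]

variable [∀ m, TopologicalSpace (L m)] [∀ m, IsModuleTopology ℝ (L m)]

/-- The vector bundle with fibres `L m` and model fibre `ℝ`, trivialized by the given frames. -/
def prebundle : VectorPrebundle ℝ ℝ L where
  pretrivializationAtlas := Set.range a.pretriv
  pretrivialization_linear' := by
    rintro _ ⟨x, rfl⟩
    infer_instance
  pretrivializationAt := a.pretriv
  mem_base_pretrivializationAt := a.mem_U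
  pretrivialization_mem_atlas x := ⟨x, rfl⟩
  exists_coordChange := by
    rintro _ ⟨x, rfl⟩ _ ⟨y, rfl⟩
    exact ⟨fun m => a.coord y m (a.frame x m) • ContinuousLinearMap.id ℝ ℝ,
      (a.continuousOn x y).smul continuousOn_const, a.change_eq x y⟩
  totalSpaceMk_isInducing x := by
    let φ : L x ≃ₗ[ℝ] ℝ := LinearEquiv.ofLinearMap (a.coord x x)
      (LinearMap.toSpanSingleton ℝ (L x) (a.frame x x))
      (by ext; simp [a.coord_frame x x (a.mem_U x)])
      (by ext v; simp [a.coord_smul_frame x x (a.mem_U x)])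
    have : ContinuousAdd (L x) := IsModuleTopology.toContinuousAdd ℝ (L x)
    have h1 : Continuous φ := IsModuleTopology.continuous_of_linearMap φ.toLinearMap
    have h2 : Continuous φ.symm := IsModuleTopology.continuous_of_linearMap φ.symm.toLinearMap
    let ψ : L x ≃ₜ ℝ := ⟨φ.toEquiv, h1, h2⟩
    have : Topology.IsInducing fun v => (x, ψ v) := Topology.isInducing_const_prod.mpr ψ.isInducing
    exact this

lemma prebundle_isContMDiff (h : ∀ x y, ContMDiffOn 𝓘(ℝ, E) 𝓘(ℝ, ℝ) ∞
    (fun m => a.coord y m (a.frame x m)) (a.U x ∩ a.U y)) :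
    a.prebundle.IsContMDiff 𝓘(ℝ, E) ∞ where
  exists_contMDiffCoordChange := by
    rintro _ ⟨x, rfl⟩ _ ⟨y, rfl⟩
    exact ⟨fun m => a.coord y m (a.frame x m) • ContinuousLinearMap.id ℝ ℝ,
      (h x y).smul contMDiffOn_const, a.change_eq x y⟩

end LineFrames

/-! ### The top exterior power of a vector bundle -/

variable (F : Type*) [NormedAddCommGroup F] [NormedSpace ℝ F]
  (V : M → Type*) [∀ m, AddCommGroup (V m)] [∀ m, Module ℝ (V m)]

/-- The fibres of the top exterior power `∧^top V` of a vector bundle `V` with model fibre `F`. -/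
def TopPow (m : M) : Type _ := ⋀[ℝ]^(finrank ℝ F) (V m)

instance (m : M) : AddCommGroup (TopPow F V m) :=
  inferInstanceAs (AddCommGroup (⋀[ℝ]^(finrank ℝ F) (V m)))
instance (m : M) : Module ℝ (TopPow F V m) :=
  inferInstanceAs (Module ℝ (⋀[ℝ]^(finrank ℝ F) (V m)))
instance (m : M) : TopologicalSpace (TopPow F V m) := moduleTopology ℝ _
instance (m : M) : IsModuleTopology ℝ (TopPow F V m) := ⟨rfl⟩

variable {F V} in
/-- The element `v₁ ∧ … ∧ v_r` of the top exterior power. -/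
def wedge {m : M} (v : Fin (finrank ℝ F) → V m) : TopPow F V m :=
  exteriorPower.ιMulti ℝ (finrank ℝ F) v

lemma linearMapAt_symm_of_mem {G : Type*} [NormedAddCommGroup G] [NormedSpace ℝ G]
    {W : M → Type*} [∀ m, AddCommGroup (W m)] [∀ m, Module ℝ (W m)]
    [TopologicalSpace (TotalSpace G W)] [∀ m, TopologicalSpace (W m)] [FiberBundle G W]
    [VectorBundle ℝ G W] (e : Trivialization G (π G W)) [MemTrivializationAtlas e] {m : M}
    (hm : m ∈ e.baseSet) (v : G) : e.linearMapAt ℝ m (e.symm m v) = v := by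
  rw [e.coe_linearMapAt_of_mem hm]
  exact congrArg Prod.snd (e.apply_mk_symm hm v)

variable [FiniteDimensional ℝ F]
  [TopologicalSpace (TotalSpace F V)] [∀ m, TopologicalSpace (V m)] [FiberBundle F V]
  [VectorBundle ℝ F V]

/-- The local frame `e₁ ∧ … ∧ e_r`, for `e` the local frame of `V` given by its trivialization
at `x` and a basis of `F`. -/
def topFrame (x m : M) : TopPow F V m :=
  wedge fun j => (trivializationAt F V x).symm m (finBasis ℝ F j)

/-- The coordinate with respect to `topFrame`: the determinant in the trivialization of `V`. -/
def topCoord (x m : M) : TopPow F V m →ₗ[ℝ] ℝ :=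
  exteriorPower.alternatingMapLinearEquiv
    ((finBasis ℝ F).det.compLinearMap ((trivializationAt F V x).linearMapAt ℝ m))

lemma topCoord_wedge (x m : M) (v : Fin (finrank ℝ F) → V m) :
    topCoord F V x m (wedge v) =
      (finBasis ℝ F).det fun j => (trivializationAt F V x).linearMapAt ℝ m (v j) := by
  exact exteriorPower.alternatingMapLinearEquiv_apply_ιMulti _ _

lemma topCoord_frame (x m y : M) :
    topCoord F V y m (topFrame F V x m) = (finBasis ℝ F).det fun j =>
      (trivializationAt F V y).linearMapAt ℝ m ((trivializationAt F V x).symm m (finBasis ℝ F j)) :=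
  topCoord_wedge F V y m _

lemma topCoord_smul_frame (x m : M) (hm : m ∈ (trivializationAt F V x).baseSet)
    (v : TopPow F V m) : topCoord F V x m v • topFrame F V x m = v := by
  let e : V m ≃ₗ[ℝ] F := (trivializationAt F V x).linearEquivAt ℝ m hm
  have he : ∀ v, (trivializationAt F V x).linearMapAt ℝ m v = e v := fun v => by
    rw [Trivialization.coe_linearMapAt_of_mem _ hm]; rfl
  let b : Basis (Fin (finrank ℝ F)) ℝ (V m) := (finBasis ℝ F).map e.symm
  have hb : ∀ j, (trivializationAt F V x).symm m (finBasis ℝ F j) = b j := fun j => rfl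
  suffices h : (LinearMap.toSpanSingleton ℝ _ (topFrame F V x m)).comp (topCoord F V x m)
      = LinearMap.id by
    exact LinearMap.congr_fun h v
  refine exteriorPower.linearMap_ext (M := V m) ?_
  refine Basis.ext_alternating b fun σ hσ => ?_
  have h1 : topCoord F V x m (wedge fun j => b (σ j)) =
      (finBasis ℝ F).det fun j => finBasis ℝ F (σ j) := by
    rw [topCoord_wedge]
    congr 1
    ext j
    simp [he, b]
  change topCoord F V x m (wedge fun j => b (σ j)) • topFrame F V x m = wedge fun j => b (σ j)
  rw [h1]
  let τ : Equiv.Perm (Fin (finrank ℝ F)) :=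
    Equiv.ofBijective σ (Finite.injective_iff_bijective.1 hσ)
  have h2 : (finBasis ℝ F).det (fun j => finBasis ℝ F (σ j)) = (Equiv.Perm.sign τ : ℤ) := by
    have := (finBasis ℝ F).det.map_perm (finBasis ℝ F) τ
    rw [Basis.det_self, Units.smul_def, zsmul_one] at this
    exact this
  have h3 : (wedge fun j => b (σ j) : TopPow F V m) = Equiv.Perm.sign τ • topFrame F V x m :=
    (exteriorPower.ιMulti ℝ (finrank ℝ F) (M := V m)).map_perm b τ
  rw [h2, h3, Units.smul_def, Int.cast_smul_eq_zsmul]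

lemma contDiff_det {G : Type*} [NormedAddCommGroup G] [NormedSpace ℝ G]
    [FiniteDimensional ℝ G] {ι : Type*} [Fintype ι] [DecidableEq ι] (b : Basis ι ℝ G) :
    ContDiff ℝ ∞ fun v : ι → G => b.det v := by
  simp only [Basis.det_apply, Matrix.det_apply, Basis.toMatrix_apply, Units.smul_def,
    ← Int.cast_smul_eq_zsmul ℝ]
  have hc : ∀ i j, ContDiff ℝ ∞ fun v : ι → G => b.repr (v j) i := fun i j =>
    (LinearMap.toContinuousLinearMap (b.coord i)).contDiff.comp (contDiff_apply ℝ G j)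
  refine ContDiff.sum fun σ _ => ?_
  exact (contDiff_prod fun i _ => hc (σ i) i).const_smul ((Equiv.Perm.sign σ : ℤ) : ℝ)

lemma topCoord_frame_self (x m : M) (hm : m ∈ (trivializationAt F V x).baseSet) :
    topCoord F V x m (topFrame F V x m) = 1 := by
  rw [topCoord_frame]
  convert (finBasis ℝ F).det_self with j
  exact linearMapAt_symm_of_mem _ hm _

lemma topCoord_frame_eqOn (x y : M) : Set.EqOn (fun m => topCoord F V y m (topFrame F V x m))
    (fun m => (finBasis ℝ F).det fun j => ((trivializationAt F V x).coordChangeL ℝ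
      (trivializationAt F V y) m : F →L[ℝ] F) (finBasis ℝ F j))
    ((trivializationAt F V x).baseSet ∩ (trivializationAt F V y).baseSet) := by
  intro m hm
  simp only [topCoord_frame]
  congr 1
  ext j
  rw [ContinuousLinearEquiv.coe_coe,
    Trivialization.coordChangeL_apply (R := ℝ) _ _ hm, Trivialization.coe_linearMapAt_of_mem _ hm.2]

/-- The frames that make `∧^top V` a line bundle. -/
def topFrames : LineFrames (TopPow F V) where
  U x := (trivializationAt F V x).baseSet
  isOpen_U x := (trivializationAt F V x).open_baseSet
  mem_U x := FiberBundle.mem_baseSet_trivializationAt F V x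
  frame := topFrame F V
  coord := topCoord F V
  coord_frame := topCoord_frame_self F V
  coord_smul_frame := topCoord_smul_frame F V
  continuousOn x y := by
    refine ContinuousOn.congr ?_ (topCoord_frame_eqOn F V x y)
    refine (contDiff_det (finBasis ℝ F)).continuous.comp_continuousOn
      (continuousOn_pi.2 fun j => ?_)
    exact (VectorBundle.continuousOn_coordChange' (R := ℝ) (trivializationAt F V x)
      (trivializationAt F V y)).clm_apply continuousOn_const

instance : TopologicalSpace (TotalSpace ℝ (TopPow F V)) :=
  (topFrames F V).prebundle.totalSpaceTopology
instance : FiberBundle ℝ (TopPow F V) := (topFrames F V).prebundle.toFiberBundle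
instance : VectorBundle ℝ ℝ (TopPow F V) := (topFrames F V).prebundle.toVectorBundle

instance [ContMDiffVectorBundle ∞ F V 𝓘(ℝ, E)] :
    ContMDiffVectorBundle ∞ ℝ (TopPow F V) 𝓘(ℝ, E) := by
  have : (topFrames F V).prebundle.IsContMDiff 𝓘(ℝ, E) ∞ := by
    refine LineFrames.prebundle_isContMDiff _ fun x y => ?_
    refine ContMDiffOn.congr ?_ (topCoord_frame_eqOn F V x y)
    refine (contDiff_det (finBasis ℝ F)).contMDiff.comp_contMDiffOn
      (contMDiffOn_pi_space.2 fun j => ?_)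
    exact (contMDiffOn_coordChangeL (IB := 𝓘(ℝ, E)) (n := ∞) (trivializationAt F V x)
      (trivializationAt F V y)).clm_apply contMDiffOn_const
  exact (topFrames F V).prebundle.contMDiffVectorBundle 𝓘(ℝ, E)

/-! ### The tensor product of two line bundles -/

section Tensor

variable (L₁ L₂ : M → Type*)
  [∀ m, AddCommGroup (L₁ m)] [∀ m, Module ℝ (L₁ m)]
  [∀ m, AddCommGroup (L₂ m)] [∀ m, Module ℝ (L₂ m)]

/-- The fibres of the tensor product of two line bundles. -/
def LineTensor (m : M) : Type _ := L₁ m ⊗[ℝ] L₂ m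

instance (m : M) : AddCommGroup (LineTensor L₁ L₂ m) :=
  inferInstanceAs (AddCommGroup (L₁ m ⊗[ℝ] L₂ m))
instance (m : M) : Module ℝ (LineTensor L₁ L₂ m) :=
  inferInstanceAs (Module ℝ (L₁ m ⊗[ℝ] L₂ m))
instance (m : M) : TopologicalSpace (LineTensor L₁ L₂ m) := moduleTopology ℝ _
instance (m : M) : IsModuleTopology ℝ (LineTensor L₁ L₂ m) := ⟨rfl⟩

variable {L₁ L₂} in
/-- The element `v ⊗ w`. -/
def tmul {m : M} (v : L₁ m) (w : L₂ m) : LineTensor L₁ L₂ m := v ⊗ₜ[ℝ] w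

variable
  [∀ m, TopologicalSpace (L₁ m)] [TopologicalSpace (TotalSpace ℝ L₁)]
  [FiberBundle ℝ L₁] [VectorBundle ℝ ℝ L₁]
  [∀ m, TopologicalSpace (L₂ m)] [TopologicalSpace (TotalSpace ℝ L₂)]
  [FiberBundle ℝ L₂] [VectorBundle ℝ ℝ L₂]

lemma linearMapAt_smul_symm_one {L : M → Type*} [∀ m, AddCommGroup (L m)] [∀ m, Module ℝ (L m)]
    [∀ m, TopologicalSpace (L m)] [TopologicalSpace (TotalSpace ℝ L)]
    [FiberBundle ℝ L] [VectorBundle ℝ ℝ L]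
    (e : Trivialization ℝ (π ℝ L)) [MemTrivializationAtlas e] {m : M}
    (hm : m ∈ e.baseSet) (v : L m) : e.linearMapAt ℝ m v • e.symm m 1 = v := by
  rw [← e.symmₗ_apply (R := ℝ) hm, ← map_smul, smul_eq_mul, mul_one]
  exact e.symmₗ_linearMapAt hm v

/-- The tensor product of the local frames of `L₁` and `L₂`. -/
def tensorFrame (x m : M) : LineTensor L₁ L₂ m :=
  tmul ((trivializationAt ℝ L₁ x).symm m 1) ((trivializationAt ℝ L₂ x).symm m 1)

/-- The coordinate with respect to `tensorFrame`. -/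
def tensorCoord (x m : M) : LineTensor L₁ L₂ m →ₗ[ℝ] ℝ :=
  LinearMap.mul' ℝ ℝ ∘ₗ TensorProduct.map ((trivializationAt ℝ L₁ x).linearMapAt ℝ m)
    ((trivializationAt ℝ L₂ x).linearMapAt ℝ m)

lemma tensorCoord_tmul (x m : M) (v : L₁ m) (w : L₂ m) :
    tensorCoord L₁ L₂ x m (tmul v w) = (trivializationAt ℝ L₁ x).linearMapAt ℝ m v *
      (trivializationAt ℝ L₂ x).linearMapAt ℝ m w := rfl

lemma tensorCoord_smul_frame (x m : M)
    (hm : m ∈ (trivializationAt ℝ L₁ x).baseSet ∩ (trivializationAt ℝ L₂ x).baseSet)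
    (v : LineTensor L₁ L₂ m) : tensorCoord L₁ L₂ x m v • tensorFrame L₁ L₂ x m = v := by
  have h1 : ∀ v : L₁ m, (trivializationAt ℝ L₁ x).linearMapAt ℝ m v •
      (trivializationAt ℝ L₁ x).symm m 1 = v := fun v => by
    exact linearMapAt_smul_symm_one _ hm.1 v
  have h2 : ∀ v : L₂ m, (trivializationAt ℝ L₂ x).linearMapAt ℝ m v •
      (trivializationAt ℝ L₂ x).symm m 1 = v := fun v => by
    exact linearMapAt_smul_symm_one _ hm.2 v
  suffices h : (LinearMap.toSpanSingleton ℝ _ (tensorFrame L₁ L₂ x m)).comp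
      (tensorCoord L₁ L₂ x m) = LinearMap.id by
    exact LinearMap.congr_fun h v
  refine TensorProduct.ext' (M := L₁ m) (N := L₂ m) fun v w => ?_
  change tensorCoord L₁ L₂ x m (tmul v w) • tensorFrame L₁ L₂ x m = tmul v w
  rw [tensorCoord_tmul]
  conv_rhs => rw [← h1 v, ← h2 w]
  exact (TensorProduct.smul_tmul_smul _ _ _ _).symm

lemma tensorCoord_frame_eqOn (x y : M) :
    Set.EqOn (fun m => tensorCoord L₁ L₂ y m (tensorFrame L₁ L₂ x m))
    (fun m => ((trivializationAt ℝ L₁ x).coordChangeL ℝ (trivializationAt ℝ L₁ y) m : ℝ →L[ℝ] ℝ) 1 *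
      ((trivializationAt ℝ L₂ x).coordChangeL ℝ (trivializationAt ℝ L₂ y) m : ℝ →L[ℝ] ℝ) 1)
    (((trivializationAt ℝ L₁ x).baseSet ∩ (trivializationAt ℝ L₂ x).baseSet) ∩
      ((trivializationAt ℝ L₁ y).baseSet ∩ (trivializationAt ℝ L₂ y).baseSet)) := by
  intro m hm
  simp only [tensorFrame, tensorCoord_tmul, ContinuousLinearEquiv.coe_coe]
  rw [Trivialization.coordChangeL_apply (R := ℝ) _ _ ⟨hm.1.1, hm.2.1⟩,
    Trivialization.coordChangeL_apply (R := ℝ) _ _ ⟨hm.1.2, hm.2.2⟩,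
    Trivialization.coe_linearMapAt_of_mem _ hm.2.1, Trivialization.coe_linearMapAt_of_mem _ hm.2.2]

/-- The frames that make `L₁ ⊗ L₂` a line bundle. -/
def tensorFrames : LineFrames (LineTensor L₁ L₂) where
  U x := (trivializationAt ℝ L₁ x).baseSet ∩ (trivializationAt ℝ L₂ x).baseSet
  isOpen_U x := (trivializationAt ℝ L₁ x).open_baseSet.inter (trivializationAt ℝ L₂ x).open_baseSet
  mem_U x := ⟨FiberBundle.mem_baseSet_trivializationAt ℝ L₁ x,
    FiberBundle.mem_baseSet_trivializationAt ℝ L₂ x⟩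
  frame := tensorFrame L₁ L₂
  coord := tensorCoord L₁ L₂
  coord_frame x m hm := by
    simp only [tensorFrame, tensorCoord_tmul]
    rw [linearMapAt_symm_of_mem _ hm.1, linearMapAt_symm_of_mem _ hm.2, mul_one]
  coord_smul_frame := tensorCoord_smul_frame L₁ L₂
  continuousOn x y := by
    refine ContinuousOn.congr ?_ (tensorCoord_frame_eqOn L₁ L₂ x y)
    exact (((VectorBundle.continuousOn_coordChange' (R := ℝ) (trivializationAt ℝ L₁ x)
      (trivializationAt ℝ L₁ y)).mono fun m hm => ⟨hm.1.1, hm.2.1⟩).clm_apply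
        continuousOn_const).mul
      (((VectorBundle.continuousOn_coordChange' (R := ℝ) (trivializationAt ℝ L₂ x)
      (trivializationAt ℝ L₂ y)).mono fun m hm => ⟨hm.1.2, hm.2.2⟩).clm_apply
        continuousOn_const)

instance : TopologicalSpace (TotalSpace ℝ (LineTensor L₁ L₂)) :=
  (tensorFrames L₁ L₂).prebundle.totalSpaceTopology
instance : FiberBundle ℝ (LineTensor L₁ L₂) := (tensorFrames L₁ L₂).prebundle.toFiberBundle
instance : VectorBundle ℝ ℝ (LineTensor L₁ L₂) := (tensorFrames L₁ L₂).prebundle.toVectorBundle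

instance [ContMDiffVectorBundle ∞ ℝ L₁ 𝓘(ℝ, E)] [ContMDiffVectorBundle ∞ ℝ L₂ 𝓘(ℝ, E)] :
    ContMDiffVectorBundle ∞ ℝ (LineTensor L₁ L₂) 𝓘(ℝ, E) := by
  have : (tensorFrames L₁ L₂).prebundle.IsContMDiff 𝓘(ℝ, E) ∞ := by
    refine LineFrames.prebundle_isContMDiff _ fun x y => ?_
    refine ContMDiffOn.congr ?_ (tensorCoord_frame_eqOn L₁ L₂ x y)
    exact (((contMDiffOn_coordChangeL (IB := 𝓘(ℝ, E)) (n := ∞) (trivializationAt ℝ L₁ x)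
      (trivializationAt ℝ L₁ y)).mono fun m hm => ⟨hm.1.1, hm.2.1⟩).clm_apply
        contMDiffOn_const).mul
      (((contMDiffOn_coordChangeL (IB := 𝓘(ℝ, E)) (n := ∞) (trivializationAt ℝ L₂ x)
      (trivializationAt ℝ L₂ y)).mono fun m hm => ⟨hm.1.2, hm.2.2⟩).clm_apply
        contMDiffOn_const)
  exact (tensorFrames L₁ L₂).prebundle.contMDiffVectorBundle 𝓘(ℝ, E)

end Tensor

end LineBundles

/-! ### Sections -/

section Sections

variable {E : Type*} [NormedAddCommGroup E] [NormedSpace ℝ E]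
  {M : Type*} [TopologicalSpace M] [ChartedSpace E M]

/-- Smooth global sections of the vector bundle `V`, with model fibre `F`, over the smooth
manifold `M` modelled on `E`. -/
abbrev Sec (E : Type*) [NormedAddCommGroup E] [NormedSpace ℝ E]
    {M : Type*} [TopologicalSpace M] [ChartedSpace E M]
    (F : Type*) [NormedAddCommGroup F] [NormedSpace ℝ F] (V : M → Type*)
    [TopologicalSpace (TotalSpace F V)] [∀ m, TopologicalSpace (V m)] [FiberBundle F V] :=
  Cₛ^∞⟮𝓘(ℝ, E); F, V⟯

variable {F : Type*} [NormedAddCommGroup F] [NormedSpace ℝ F] {V : M → Type*}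
  [∀ m, AddCommGroup (V m)] [∀ m, Module ℝ (V m)]
  [TopologicalSpace (TotalSpace F V)] [∀ m, TopologicalSpace (V m)] [FiberBundle F V]
  [VectorBundle ℝ F V]

/-- The product of a smooth function and a smooth section. -/
def fsmul (f : C^∞⟮𝓘(ℝ, E), M; 𝓘(ℝ, ℝ), ℝ⟯) (s : Sec E F V) : Sec E F V where
  toFun m := f m • s m
  contMDiff_toFun := f.contMDiff.smul_section s.contMDiff

/-- A section vanishes nowhere. -/
def NowhereZero (s : Sec E F V) : Prop := ∀ m, s m ≠ 0

section Hom

variable {F₁ : Type*} [NormedAddCommGroup F₁] [NormedSpace ℝ F₁] {V₁ : M → Type*}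
  [∀ m, AddCommGroup (V₁ m)] [∀ m, Module ℝ (V₁ m)]
  [TopologicalSpace (TotalSpace F₁ V₁)] [∀ m, TopologicalSpace (V₁ m)] [FiberBundle F₁ V₁]
  [VectorBundle ℝ F₁ V₁]
  {F₂ : Type*} [NormedAddCommGroup F₂] [NormedSpace ℝ F₂] {V₂ : M → Type*}
  [∀ m, AddCommGroup (V₂ m)] [∀ m, Module ℝ (V₂ m)]
  [TopologicalSpace (TotalSpace F₂ V₂)] [∀ m, TopologicalSpace (V₂ m)] [FiberBundle F₂ V₂]
  [VectorBundle ℝ F₂ V₂] [∀ m, IsTopologicalAddGroup (V₂ m)] [∀ m, ContinuousSMul ℝ (V₂ m)]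
  {F₃ : Type*} [NormedAddCommGroup F₃] [NormedSpace ℝ F₃] {V₃ : M → Type*}
  [∀ m, AddCommGroup (V₃ m)] [∀ m, Module ℝ (V₃ m)]
  [TopologicalSpace (TotalSpace F₃ V₃)] [∀ m, TopologicalSpace (V₃ m)] [FiberBundle F₃ V₃]
  [VectorBundle ℝ F₃ V₃] [∀ m, IsTopologicalAddGroup (V₃ m)] [∀ m, ContinuousSMul ℝ (V₃ m)]

/-- Base-preserving smooth vector bundle maps `V₁ → V₂`, as smooth sections of `Hom(V₁, V₂)`. -/
abbrev BundleMap (E : Type*) [NormedAddCommGroup E] [NormedSpace ℝ E]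
    {M : Type*} [TopologicalSpace M] [ChartedSpace E M]
    (F₁ : Type*) [NormedAddCommGroup F₁] [NormedSpace ℝ F₁] (V₁ : M → Type*)
    [∀ m, AddCommGroup (V₁ m)] [∀ m, Module ℝ (V₁ m)]
    [TopologicalSpace (TotalSpace F₁ V₁)] [∀ m, TopologicalSpace (V₁ m)] [FiberBundle F₁ V₁]
    [VectorBundle ℝ F₁ V₁]
    (F₂ : Type*) [NormedAddCommGroup F₂] [NormedSpace ℝ F₂] (V₂ : M → Type*)
    [∀ m, AddCommGroup (V₂ m)] [∀ m, Module ℝ (V₂ m)]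
    [TopologicalSpace (TotalSpace F₂ V₂)] [∀ m, TopologicalSpace (V₂ m)] [FiberBundle F₂ V₂]
    [VectorBundle ℝ F₂ V₂] [∀ m, IsTopologicalAddGroup (V₂ m)] [∀ m, ContinuousSMul ℝ (V₂ m)] :=
  Sec E (F₁ →L[ℝ] F₂) fun m => V₁ m →L[ℝ] V₂ m

/-- The map on sections induced by a bundle map. -/
def BundleMap.app (φ : BundleMap E F₁ V₁ F₂ V₂) (s : Sec E F₁ V₁) : Sec E F₂ V₂ where
  toFun m := φ m (s m)
  contMDiff_toFun := φ.contMDiff.clm_bundle_apply s.contMDiff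

/-- Composition of bundle maps. -/
def BundleMap.comp (ψ : BundleMap E F₂ V₂ F₃ V₃) (φ : BundleMap E F₁ V₁ F₂ V₂) :
    BundleMap E F₁ V₁ F₃ V₃ where
  toFun m := (ψ m).comp (φ m)
  contMDiff_toFun := by
    intro x
    have h1 := (contMDiffAt_hom_bundle _).1 (φ.contMDiff x)
    have h2 := (contMDiffAt_hom_bundle _).1 (ψ.contMDiff x)
    refine (contMDiffAt_hom_bundle _).2 ⟨contMDiffAt_id, ?_⟩
    refine (h2.2.clm_comp h1.2).congr_of_eventuallyEq ?_
    filter_upwards [(trivializationAt F₂ V₂ x).open_baseSet.mem_nhds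
      (FiberBundle.mem_baseSet_trivializationAt F₂ V₂ x)] with m hm
    ext v
    simp only [ContinuousLinearMap.inCoordinates, ContinuousLinearMap.comp_apply]
    congr 2
    exact ((trivializationAt F₂ V₂ x).symmL_continuousLinearMapAt (R := ℝ) hm _).symm

end Hom

/-- Sections of the dual bundle `V^*`. -/
abbrev DualSec (E : Type*) [NormedAddCommGroup E] [NormedSpace ℝ E]
    {M : Type*} [TopologicalSpace M] [ChartedSpace E M]
    (F : Type*) [NormedAddCommGroup F] [NormedSpace ℝ F] (V : M → Type*)
    [∀ m, AddCommGroup (V m)] [∀ m, Module ℝ (V m)]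
    [TopologicalSpace (TotalSpace F V)] [∀ m, TopologicalSpace (V m)] [FiberBundle F V]
    [VectorBundle ℝ F V] :=
  BundleMap E F V ℝ (Bundle.Trivial M ℝ)

/-- The section `s₁ ∧ … ∧ s_r` of the top exterior power of `V`. -/
def wedgeSec [FiniteDimensional ℝ F] [ContMDiffVectorBundle ∞ F V 𝓘(ℝ, E)]
    (s : Fin (finrank ℝ F) → Sec E F V) : Sec E ℝ (TopPow F V) where
  toFun m := wedge fun j => s j m
  contMDiff_toFun := by
    intro x
    refine (contMDiffAt_section x).2 ?_
    change ContMDiffAt 𝓘(ℝ, E) 𝓘(ℝ, ℝ) ∞ (fun m => topCoord F V x m (wedge fun j => s j m)) x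
    simp only [topCoord_wedge]
    have h : ∀ j, ContMDiffAt 𝓘(ℝ, E) 𝓘(ℝ, F) ∞
        (fun m => (trivializationAt F V x).linearMapAt ℝ m (s j m)) x := fun j => by
      refine ((contMDiffAt_section x).1 ((s j).contMDiff x)).congr_of_eventuallyEq ?_
      filter_upwards [(trivializationAt F V x).open_baseSet.mem_nhds
        (FiberBundle.mem_baseSet_trivializationAt F V x)] with m hm
      rw [Trivialization.coe_linearMapAt_of_mem _ hm]
    exact (contDiff_det (finBasis ℝ F)).contMDiff.contMDiffAt.comp x
      (contMDiffAt_pi_space.2 h)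

/-- The section `s₁ ⊗ s₂` of the tensor product of two line bundles. -/
def tensorSec {L₁ L₂ : M → Type*}
    [∀ m, AddCommGroup (L₁ m)] [∀ m, Module ℝ (L₁ m)]
    [∀ m, AddCommGroup (L₂ m)] [∀ m, Module ℝ (L₂ m)]
    [∀ m, TopologicalSpace (L₁ m)] [TopologicalSpace (TotalSpace ℝ L₁)]
    [FiberBundle ℝ L₁] [VectorBundle ℝ ℝ L₁]
    [∀ m, TopologicalSpace (L₂ m)] [TopologicalSpace (TotalSpace ℝ L₂)]
    [FiberBundle ℝ L₂] [VectorBundle ℝ ℝ L₂]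
    (s₁ : Sec E ℝ L₁) (s₂ : Sec E ℝ L₂) : Sec E ℝ (LineTensor L₁ L₂) where
  toFun m := tmul (s₁ m) (s₂ m)
  contMDiff_toFun := by
    intro x
    refine (contMDiffAt_section x).2 ?_
    change ContMDiffAt 𝓘(ℝ, E) 𝓘(ℝ, ℝ) ∞
      (fun m => tensorCoord L₁ L₂ x m (tmul (s₁ m) (s₂ m))) x
    simp only [tensorCoord_tmul]
    refine ContMDiffAt.mul ?_ ?_
    · refine ((contMDiffAt_section x).1 (s₁.contMDiff x)).congr_of_eventuallyEq ?_
      filter_upwards [(trivializationAt ℝ L₁ x).open_baseSet.mem_nhds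
        (FiberBundle.mem_baseSet_trivializationAt ℝ L₁ x)] with m hm
      rw [Trivialization.coe_linearMapAt_of_mem _ hm]
    · refine ((contMDiffAt_section x).1 (s₂.contMDiff x)).congr_of_eventuallyEq ?_
      filter_upwards [(trivializationAt ℝ L₂ x).open_baseSet.mem_nhds
        (FiberBundle.mem_baseSet_trivializationAt ℝ L₂ x)] with m hm
      rw [Trivialization.coe_linearMapAt_of_mem _ hm]

end Sections

/-! ### Lie algebroids -/

section LieAlgebroids

variable {E : Type*} [NormedAddCommGroup E] [NormedSpace ℝ E] [FiniteDimensional ℝ E]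
  {M : Type*} [TopologicalSpace M] [ChartedSpace E M] [IsManifold 𝓘(ℝ, E) ∞ M]

/-- The fibres of the tangent bundle of `M`. -/
abbrev Tan (E : Type*) [NormedAddCommGroup E] [NormedSpace ℝ E]
    {M : Type*} [TopologicalSpace M] [ChartedSpace E M] (m : M) : Type _ :=
  TangentSpace 𝓘(ℝ, E) m

/-- The fibres of the cotangent bundle of `M`. -/
abbrev Cotan (E : Type*) [NormedAddCommGroup E] [NormedSpace ℝ E]
    {M : Type*} [TopologicalSpace M] [ChartedSpace E M] (m : M) : Type _ :=
  Tan E m →L[ℝ] Bundle.Trivial M ℝ m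

lemma mdifferentiableAt_pairing (ξ : DualSec E E (Tan E (M := M))) {w : ∀ x : M, Tan E x} {m : M}
    (hw : MDifferentiableAt 𝓘(ℝ, E) (𝓘(ℝ, E).prod 𝓘(ℝ, E))
      (fun x => TotalSpace.mk' E x (w x)) m) :
    MDifferentiableAt 𝓘(ℝ, E) 𝓘(ℝ, ℝ) (fun x => (ξ x (w x) : ℝ)) m :=
  (mdifferentiableAt_section 𝓘(ℝ, E) _).1
    ((ξ.mdifferentiableAt (x := m)).clm_bundle_apply hw)

/-- The Lie derivative `L_v ξ` at `m` of a `1`-form `ξ` along a vector field `v`: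
`(L_v ξ)(w) = v (ξ w) - ξ [v, w]` for every vector field `w`. -/
def lieDeriv (v : Sec E E (Tan E (M := M))) (ξ : DualSec E E (Tan E (M := M))) (m : M) :
    Cotan E m :=
  TensorialAt.mkHom (I := 𝓘(ℝ, E)) (F := E) (A := ℝ)
    (fun w : ∀ x : M, Tan E x =>
      mvfderiv 𝓘(ℝ, E) (fun x => (ξ x (w x) : ℝ)) m (v m)
        - (ξ m (VectorField.mlieBracket 𝓘(ℝ, E) (fun x => v x) w m) : ℝ)) m
    { smul := fun {f w} hf hw => by
        have h : MDifferentiableAt 𝓘(ℝ, E) 𝓘(ℝ, ℝ) (fun x => (ξ x (w x) : ℝ)) m :=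
          mdifferentiableAt_pairing ξ hw
        have e : (fun x => (ξ x ((f • w) x) : ℝ)) = f • fun x => (ξ x (w x) : ℝ) := by
          ext x
          exact (ξ x).map_smul (f x) (w x)
        rw [e, mvfderiv_smul hf h, VectorField.mlieBracket_smul_right hf hw]
        have e2 := (ξ m).map_add
          (mvfderiv 𝓘(ℝ, E) f m (v m) • w m)
          (f m • VectorField.mlieBracket 𝓘(ℝ, E) (fun x => v x) w m)
        rw [(ξ m).map_smul, (ξ m).map_smul] at e2
        simp only [add_apply, smul_apply,
          ContinuousLinearMap.smulRight_apply, smul_eq_mul]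
        refine (congrArg (fun t : ℝ => _ - t) e2).trans ?_
        change _ - (_ * (ξ m (w m) : ℝ) + _ * (_ : ℝ)) = _
        ring
      add := fun {w w'} hw hw' => by
        have h : MDifferentiableAt 𝓘(ℝ, E) 𝓘(ℝ, ℝ) (fun x => (ξ x (w x) : ℝ)) m :=
          mdifferentiableAt_pairing ξ hw
        have h' : MDifferentiableAt 𝓘(ℝ, E) 𝓘(ℝ, ℝ) (fun x => (ξ x (w' x) : ℝ)) m :=
          mdifferentiableAt_pairing ξ hw'
        have e : (fun x => (ξ x ((w + w') x) : ℝ)) =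
            (fun x => (ξ x (w x) : ℝ)) + fun x => (ξ x (w' x) : ℝ) := by
          ext x
          exact (ξ x).map_add (w x) (w' x)
        rw [e, mvfderiv_add h h', VectorField.mlieBracket_add_right hw hw']
        have e2 := (ξ m).map_add
          (VectorField.mlieBracket 𝓘(ℝ, E) (fun x => v x) w m)
          (VectorField.mlieBracket 𝓘(ℝ, E) (fun x => v x) w' m)
        simp only [add_apply]
        refine (congrArg (fun t : ℝ => _ - t) e2).trans ?_
        change _ - ((_ : ℝ) + (_ : ℝ)) = _
        ring }

variable (E) in
/-- A Lie algebroid structure on the vector bundle `A` over `M`: an anchor `A → TM` and a Lie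
bracket on the sections of `A` satisfying `[a, f b] = f [a, b] + (ρ(a) f) b`. (The anchor then
automatically maps the bracket of `A` to the bracket of vector fields; this is included.) -/
structure LieAlgebroid (F : Type*) [NormedAddCommGroup F] [NormedSpace ℝ F] (A : M → Type*)
    [∀ m, AddCommGroup (A m)] [∀ m, Module ℝ (A m)]
    [TopologicalSpace (TotalSpace F A)] [∀ m, TopologicalSpace (A m)] [FiberBundle F A]
    [VectorBundle ℝ F A] where
  anchor : BundleMap E F A E (Tan E)
  bracket : Sec E F A →ₗ[ℝ] Sec E F A →ₗ[ℝ] Sec E F A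
  bracket_self : ∀ a, bracket a a = 0
  jacobi : ∀ a b c, bracket a (bracket b c) = bracket (bracket a b) c + bracket b (bracket a c)
  leibniz : ∀ a b (f : C^∞⟮𝓘(ℝ, E), M; 𝓘(ℝ, ℝ), ℝ⟯) m,
    bracket a (fsmul f b) m
      = f m • bracket a b m + mvfderiv 𝓘(ℝ, E) f m (anchor m (a m)) • b m
  anchor_bracket : ∀ a b m, anchor m (bracket a b m) =
    VectorField.mlieBracket 𝓘(ℝ, E) (fun x => anchor x (a x)) (fun x => anchor x (b x)) m

namespace LieAlgebroid

variable {F : Type*} [NormedAddCommGroup F] [NormedSpace ℝ F] {A : M → Type*}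
  [∀ m, AddCommGroup (A m)] [∀ m, Module ℝ (A m)]
  [TopologicalSpace (TotalSpace F A)] [∀ m, TopologicalSpace (A m)] [FiberBundle F A]
  [VectorBundle ℝ F A]

/-- A Lie algebroid is transitive if its anchor is surjective. -/
def IsTransitive (LA : LieAlgebroid E F A) : Prop :=
  ∀ m, Function.Surjective (LA.anchor m)

/-- The derivative at `m` of the function `f` along the vector field `ρ(a)`. -/
def deriv (LA : LieAlgebroid E F A) (a : Sec E F A) (f : M → ℝ) (m : M) : ℝ :=
  mvfderiv 𝓘(ℝ, E) f m (LA.anchor m (a m))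

/-! #### Cohomology in degree one -/

/-- The evaluation of a section of `A^*` on a section of `A`, as a function on `M`. -/
def pair (α : DualSec E F A) (a : Sec E F A) (m : M) : ℝ := α m (a m)

lemma pair_add (α β : DualSec E F A) (a : Sec E F A) :
    pair (α + β) a = pair α a + pair β a := rfl

lemma pair_smul (c : ℝ) (α : DualSec E F A) (a : Sec E F A) :
    pair (c • α) a = c • pair α a := rfl

lemma mdifferentiable_pair (α : DualSec E F A) (a : Sec E F A) :
    MDifferentiable 𝓘(ℝ, E) 𝓘(ℝ, ℝ) (pair α a) := fun m =>
  (mdifferentiableAt_section 𝓘(ℝ, E) _).1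
    ((α.mdifferentiableAt (x := m)).clm_bundle_apply (a.mdifferentiableAt (x := m)))

/-- The `1`-cocycles of a Lie algebroid: the sections `α` of `A^*` such that
`(d_A α)(a, b) = ρ(a) α(b) - ρ(b) α(a) - α([a, b])` vanishes for all sections `a`, `b`. -/
def cocycles (LA : LieAlgebroid E F A) : Submodule ℝ (DualSec E F A) where
  carrier := {α | ∀ a b m,
    LA.deriv a (pair α b) m - LA.deriv b (pair α a) m - pair α (LA.bracket a b) m = 0}
  zero_mem' a b m := by
    have h : ∀ a : Sec E F A, pair (0 : DualSec E F A) a = 0 := fun _ => rfl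
    simp [h, deriv, mvfderiv_zero]
  add_mem' {α β} hα hβ a b m := by
    have h1 := hα a b m
    have h2 := hβ a b m
    simp only [deriv, pair_add, Pi.add_apply] at h1 h2 ⊢
    rw [mvfderiv_add (mdifferentiable_pair α b m) (mdifferentiable_pair β b m),
      mvfderiv_add (mdifferentiable_pair α a m) (mdifferentiable_pair β a m)]
    simp only [add_apply]
    linarith
  smul_mem' c α hα a b m := by
    have h1 := hα a b m
    have h : ∀ f : M → ℝ, MDifferentiable 𝓘(ℝ, E) 𝓘(ℝ, ℝ) f → ∀ v : Tan E m,
        mvfderiv 𝓘(ℝ, E) (c • f) m v = c * mvfderiv 𝓘(ℝ, E) f m v := fun f hf v => by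
      have := mvfderiv_smul (I := 𝓘(ℝ, E)) (a := fun _ : M => c) (x := m)
        mdifferentiableAt_const (hf m)
      have e : (c • f) = (fun _ : M => c) • f := rfl
      rw [e, this, mvfderiv_const]
      simp
    simp only [deriv, pair_smul, Pi.smul_apply, smul_eq_mul] at h1 ⊢
    rw [h _ (mdifferentiable_pair α b), h _ (mdifferentiable_pair α a)]
    linear_combination c * h1

/-- The exact `1`-cocycles `d_A f`, where `(d_A f)(a) = ρ(a) f`, for smooth functions `f`. -/
def coboundaries (LA : LieAlgebroid E F A) : Submodule ℝ LA.cocycles where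
  carrier := {α | ∃ f : C^∞⟮𝓘(ℝ, E), M; 𝓘(ℝ, ℝ), ℝ⟯, ∀ a m, pair α.1 a m = LA.deriv a f m}
  zero_mem' := ⟨0, fun a m => by
    have h : ((0 : C^∞⟮𝓘(ℝ, E), M; 𝓘(ℝ, ℝ), ℝ⟯) : M → ℝ) = 0 := rfl
    simp only [deriv, h, mvfderiv_zero]
    rfl⟩
  add_mem' := by
    rintro α β ⟨f, hf⟩ ⟨g, hg⟩
    refine ⟨f + g, fun a m => ?_⟩
    have h : ((f + g : C^∞⟮𝓘(ℝ, E), M; 𝓘(ℝ, ℝ), ℝ⟯) : M → ℝ) = f + g := rfl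
    have := hf a m
    have := hg a m
    simp only [deriv] at *
    rw [h, mvfderiv_add (f.contMDiff.mdifferentiable (by simp) m)
      (g.contMDiff.mdifferentiable (by simp) m)]
    simp only [add_apply, Submodule.coe_add, pair_add, Pi.add_apply]
    linarith
  smul_mem' := by
    rintro c α ⟨f, hf⟩
    refine ⟨c • f, fun a m => ?_⟩
    have h : ((c • f : C^∞⟮𝓘(ℝ, E), M; 𝓘(ℝ, ℝ), ℝ⟯) : M → ℝ) = (fun _ : M => c) • (f : M → ℝ) :=
      rfl
    have := hf a m
    simp only [deriv] at *
    rw [h, mvfderiv_smul mdifferentiableAt_const (f.contMDiff.mdifferentiable (by simp) m),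
      mvfderiv_const]
    simp [pair_smul, this]

/-- The first Lie algebroid cohomology space `H¹(A)`. -/
abbrev H1 (LA : LieAlgebroid E F A) : Type _ := LA.cocycles ⧸ LA.coboundaries

/-! #### Representations -/

variable {G : Type*} [NormedAddCommGroup G] [NormedSpace ℝ G] {W : M → Type*}
  [∀ m, AddCommGroup (W m)] [∀ m, Module ℝ (W m)]
  [TopologicalSpace (TotalSpace G W)] [∀ m, TopologicalSpace (W m)] [FiberBundle G W]
  [VectorBundle ℝ G W]

/-- A representation of the Lie algebroid `A` on the vector bundle `W`. -/
structure Rep (LA : LieAlgebroid E F A) (G : Type*) [NormedAddCommGroup G] [NormedSpace ℝ G]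
    (W : M → Type*) [∀ m, AddCommGroup (W m)] [∀ m, Module ℝ (W m)]
    [TopologicalSpace (TotalSpace G W)] [∀ m, TopologicalSpace (W m)] [FiberBundle G W]
    [VectorBundle ℝ G W] where
  /-- The operator `D(a)` on sections of `W`. -/
  D : Sec E F A →ₗ[ℝ] Sec E G W →ₗ[ℝ] Sec E G W
  smul_left : ∀ (f : C^∞⟮𝓘(ℝ, E), M; 𝓘(ℝ, ℝ), ℝ⟯) a x, D (fsmul f a) x = fsmul f (D a x)
  leibniz : ∀ (f : C^∞⟮𝓘(ℝ, E), M; 𝓘(ℝ, ℝ), ℝ⟯) a x m,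
    D a (fsmul f x) m = f m • D a x m + LA.deriv a f m • x m
  flat : ∀ a b x, D a (D b x) - D b (D a x) = D (LA.bracket a b) x

section Line

variable {LA : LieAlgebroid E F A}
  {L : M → Type*} [∀ m, AddCommGroup (L m)] [∀ m, Module ℝ (L m)]
  [TopologicalSpace (TotalSpace ℝ L)] [∀ m, TopologicalSpace (L m)] [FiberBundle ℝ L]
  [VectorBundle ℝ ℝ L]
  {L' : M → Type*} [∀ m, AddCommGroup (L' m)] [∀ m, Module ℝ (L' m)]
  [TopologicalSpace (TotalSpace ℝ L')] [∀ m, TopologicalSpace (L' m)] [FiberBundle ℝ L']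
  [VectorBundle ℝ ℝ L']

/-- `D` is the tensor product of the representations `D₁` and `D₂` on line bundles:
`D(a)(x ⊗ y) = D₁(a) x ⊗ y + x ⊗ D₂(a) y`. -/
def IsTensor (D₁ : LA.Rep ℝ L) (D₂ : LA.Rep ℝ L') (D : LA.Rep ℝ (LineTensor L L')) : Prop :=
  ∀ a x y, D.D a (tensorSec x y) = tensorSec (D₁.D a x) y + tensorSec x (D₂.D a y)

/-- `α` is the characteristic cocycle of `D` with respect to the section `x` of the line
bundle: `D(a) x = ⟨α, a⟩ x`. -/
def IsCharCocycle (D : LA.Rep ℝ L) (x : Sec E ℝ L) (α : LA.cocycles) : Prop :=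
  ∀ a m, D.D a x m = pair α.1 a m • x m

/-- `c` is the characteristic class of the representation `D` on the line bundle `L`. If `L` is
orientable, that is, has a nowhere-vanishing section, then `c` is the class of a characteristic
cocycle of `D`; otherwise `c` is one-half of the class of a characteristic cocycle of `D ⊗ D` on
`L ⊗ L`. -/
def IsCharClass (D : LA.Rep ℝ L) (c : LA.H1) : Prop :=
  (∃ x : Sec E ℝ L, NowhereZero x ∧ ∃ α, IsCharCocycle D x α ∧ c = LA.coboundaries.mkQ α) ∨
  ((¬ ∃ x : Sec E ℝ L, NowhereZero x) ∧ ∃ D₂ : LA.Rep ℝ (LineTensor L L), IsTensor D D D₂ ∧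
    ∃ y : Sec E ℝ (LineTensor L L), NowhereZero y ∧ ∃ α, IsCharCocycle D₂ y α ∧
      c = (1 / 2 : ℝ) • LA.coboundaries.mkQ α)

/-- The characteristic class `char D`. -/
def charClass (D : LA.Rep ℝ L) : LA.H1 := Classical.epsilon (IsCharClass D)

end Line

/-! #### Modular classes -/

/-- The value at `m` of the Gerstenhaber bracket
`[X, s₁ ∧ … ∧ s_k] = ∑ j, s₁ ∧ … ∧ [X, s_j] ∧ … ∧ s_k`. -/
def gerstenhaber (LA : LieAlgebroid E F A) {k : ℕ} (X : Sec E F A) (s : Fin k → Sec E F A)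
    (m : M) : ⋀[ℝ]^k (A m) :=
  ∑ j, exteriorPower.ιMulti ℝ k (Function.update (fun l => s l m) j (LA.bracket X (s j) m))

/-- The value at `m` of the Lie derivative
`L_v (ξ₁ ∧ … ∧ ξ_n) = ∑ j, ξ₁ ∧ … ∧ L_v ξ_j ∧ … ∧ ξ_n` of a form of top degree. -/
def lieDerivTop (v : Sec E E (Tan E (M := M)))
    (ξ : Fin (finrank ℝ (E →L[ℝ] ℝ)) → DualSec E E (Tan E (M := M))) (m : M) :
    TopPow (E →L[ℝ] ℝ) (Cotan E) m :=
  ∑ j, wedge (Function.update (fun l => ξ l m) j (lieDeriv v (ξ j) m))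

variable [FiniteDimensional ℝ F] [ContMDiffVectorBundle ∞ F A 𝓘(ℝ, E)]

/-- The line bundle `L^A = ∧^top A ⊗ ∧^top T^*M`. -/
abbrev ModLine (E : Type*) [NormedAddCommGroup E] [NormedSpace ℝ E]
    {M : Type*} [TopologicalSpace M] [ChartedSpace E M]
    (F : Type*) [NormedAddCommGroup F] (A : M → Type*) [NormedSpace ℝ F]
    [∀ m, AddCommGroup (A m)] [∀ m, Module ℝ (A m)] : M → Type _ :=
  LineTensor (TopPow F A) (TopPow (E →L[ℝ] ℝ) (Cotan E (M := M)))

/-- `D` is the canonical representation of `A` on `∧^top A ⊗ ∧^top T^*M`: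
`D(a)(ω ⊗ μ) = [a, ω] ⊗ μ + ω ⊗ L_{ρ(a)} μ`. -/
def IsModularRep (LA : LieAlgebroid E F A) (D : LA.Rep ℝ (ModLine E F A)) : Prop :=
  ∀ (X : Sec E F A) (s : Fin (finrank ℝ F) → Sec E F A)
    (ξ : Fin (finrank ℝ (E →L[ℝ] ℝ)) → DualSec E E (Tan E (M := M))) (m : M),
    D.D X (tensorSec (wedgeSec s) (wedgeSec ξ)) m =
      tmul (L₁ := TopPow F A) (LA.gerstenhaber X s m) (wedgeSec ξ m) +
        tmul (wedgeSec s m) (lieDerivTop (LA.anchor.app X) ξ m)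

/-- `c` is the modular class of the Lie algebroid `A`: the characteristic class of its canonical
representation. -/
def IsModClass (LA : LieAlgebroid E F A) (c : LA.H1) : Prop :=
  ∃ D : LA.Rep ℝ (ModLine E F A), LA.IsModularRep D ∧ IsCharClass D c

/-- The modular class `Mod A`. -/
def modClass (LA : LieAlgebroid E F A) : LA.H1 := Classical.epsilon LA.IsModClass

/-- A Lie algebroid is unimodular if its modular class vanishes. -/
def IsUnimodular (LA : LieAlgebroid E F A) : Prop := LA.modClass = 0

end LieAlgebroid

/-! ### Base-preserving morphisms and extensions -/

section Morphisms

variable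
  {FA : Type*} [NormedAddCommGroup FA] [NormedSpace ℝ FA] {A : M → Type*}
  [∀ m, AddCommGroup (A m)] [∀ m, Module ℝ (A m)]
  [TopologicalSpace (TotalSpace FA A)] [∀ m, TopologicalSpace (A m)] [FiberBundle FA A]
  [VectorBundle ℝ FA A] [∀ m, IsTopologicalAddGroup (A m)] [∀ m, ContinuousSMul ℝ (A m)]
  {FB : Type*} [NormedAddCommGroup FB] [NormedSpace ℝ FB] {B : M → Type*}
  [∀ m, AddCommGroup (B m)] [∀ m, Module ℝ (B m)]
  [TopologicalSpace (TotalSpace FB B)] [∀ m, TopologicalSpace (B m)] [FiberBundle FB B]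
  [VectorBundle ℝ FB B] [∀ m, IsTopologicalAddGroup (B m)] [∀ m, ContinuousSMul ℝ (B m)]
  {FC : Type*} [NormedAddCommGroup FC] [NormedSpace ℝ FC] {C : M → Type*}
  [∀ m, AddCommGroup (C m)] [∀ m, Module ℝ (C m)]
  [TopologicalSpace (TotalSpace FC C)] [∀ m, TopologicalSpace (C m)] [FiberBundle FC C]
  [VectorBundle ℝ FC C]

/-- A base-preserving morphism of Lie algebroids: a vector bundle map that preserves anchors and
brackets. -/
structure IsLieAlgebroidHom (LA : LieAlgebroid E FA A) (LB : LieAlgebroid E FB B)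
    (Φ : BundleMap E FA A FB B) : Prop where
  anchor : ∀ m v, LB.anchor m (Φ m v) = LA.anchor m v
  bracket : ∀ a b, Φ.app (LA.bracket a b) = LB.bracket (Φ.app a) (Φ.app b)

/-- The pull-back `Φ^* : H¹(B) → H¹(A)` induced by `α ↦ α ∘ Φ`. -/
def pullback {LA : LieAlgebroid E FA A} {LB : LieAlgebroid E FB B} {Φ : BundleMap E FA A FB B}
    (h : IsLieAlgebroidHom LA LB Φ) : LB.H1 →ₗ[ℝ] LA.H1 :=
  Submodule.mapQ LB.coboundaries LA.coboundaries
    { toFun := fun α => ⟨BundleMap.comp α.1 Φ, fun a b m => by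
        have := α.2 (Φ.app a) (Φ.app b) m
        rw [← h.bracket] at this
        have e : ∀ a, LieAlgebroid.pair (BundleMap.comp α.1 Φ) a
          = LieAlgebroid.pair α.1 (Φ.app a) := fun _ => rfl
        have e' : ∀ a f, LB.deriv (Φ.app a) f m = LA.deriv a f m := fun a f =>
          congrArg (mvfderiv 𝓘(ℝ, E) f m) (h.anchor m (a m))
        simpa only [e, e'] using this⟩
      map_add' := fun _ _ => rfl
      map_smul' := fun _ _ => rfl }
    (by
      rintro α ⟨f, hf⟩
      exact ⟨f, fun a m => (hf (Φ.app a) m).trans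
        (congrArg (mvfderiv 𝓘(ℝ, E) f m) (h.anchor m (a m)))⟩)

/-- The modular class `Mod Φ = Mod A - Φ^* (Mod B)` of a base-preserving morphism `Φ : A → B`. -/
def modClassHom [FiniteDimensional ℝ FA] [ContMDiffVectorBundle ∞ FA A 𝓘(ℝ, E)]
    [FiniteDimensional ℝ FB] [ContMDiffVectorBundle ∞ FB B 𝓘(ℝ, E)]
    {LA : LieAlgebroid E FA A} {LB : LieAlgebroid E FB B} {Φ : BundleMap E FA A FB B}
    (h : IsLieAlgebroidHom LA LB Φ) : LA.H1 :=
  LA.modClass - pullback h LB.modClass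

/-- A Lie algebroid extension `0 → C → A → B → 0`. -/
structure IsExtension (LC : LieAlgebroid E FC C) (LA : LieAlgebroid E FA A)
    (LB : LieAlgebroid E FB B) (i : BundleMap E FC C FA A) (Φ : BundleMap E FA A FB B) : Prop where
  hom_left : IsLieAlgebroidHom LC LA i
  hom_right : IsLieAlgebroidHom LA LB Φ
  injective : ∀ m, Function.Injective (i m)
  exact : ∀ m, Function.Exact (i m) (Φ m)
  surjective : ∀ m, Function.Surjective (Φ m)

/-- `D` is the representation of `A` on `K = ∧^top C` induced by the adjoint action:
`(∧^r i)(D(X) λ) = [X, (∧^r i) λ]`, where `r` is the rank of `C`. -/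
def IsAdjointTop [FiniteDimensional ℝ FC] [ContMDiffVectorBundle ∞ FC C 𝓘(ℝ, E)]
    (LA : LieAlgebroid E FA A) (i : BundleMap E FC C FA A)
    (D : LA.Rep ℝ (TopPow FC C)) : Prop :=
  ∀ (X : Sec E FA A) (k : Fin (finrank ℝ FC) → Sec E FC C) (m : M),
    exteriorPower.map (finrank ℝ FC) (i m : C m →ₗ[ℝ] A m) (D.D X (wedgeSec k) m) =
      LA.gerstenhaber X (fun j => i.app (k j)) m

end Morphisms

end LieAlgebroids

end LieAlgd

end

open LieAlgd LieAlgd.LieAlgebroid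

/-!
The line bundle `L^A = ∧^top A ⊗ ∧^top T^*M` of an extension `0 → C → A → B → 0` is isomorphic to
`∧^top C ⊗ L^B`: the wedge product of elements of `C` and of lifts of elements of `B` defines an
isomorphism `∧^top C ⊗ ∧^top B ≅ ∧^top A`. The bracket with a section `X` of `A` acts on the elements
of `C` by the adjoint action and on the lifts as the bracket with `Φ(X)`, so that this is an
isomorphism of representations of `A` (`IsExtension.exists_isProductRep`). Characteristic classes are
additive under tensor products (`IsProductRep.charClass_eq`) and compatible with pullbacks
(`IsLieAlgebroidHom.isCharClass_pullRep`), so `Mod A = Φ^* (char D) + Φ^* (Mod B)`, where `D` is the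
representation of `B` on `∧^top C`.

The representation `D` exists because `C` acts trivially on `∧^top C`: the anchor of `C` vanishes, hence
so do the coboundaries of `C`, and unimodularity makes the canonical representation of `C` itself zero,
not only its class (`gerstenhaber_eq_zero`). So the adjoint representation of `A` descends to `B`
(`IsExtension.exists_quotientRep`), as sections of `B` lift to `A` and sections of `ker Φ` come from
`C`.

All representations are built from derivations of line bundles. A derivation over a given vector field
is determined by its value on a local frame, so each identity between such operators only has to be
checked on wedge products of sections (`IsDer.line_ext`, `exists_rep_of_generators`), and a derivation
of `V` induces one of `∧^top V` (`exists_topDer`). That the canonical representation is linear over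
the functions in `a` is a cancellation of traces: `[f a, ·]` and `f [a, ·]` differ by an endomorphism of
rank one of trace `-ρ(a) f`, and `L_{f ρ(a)}` and `f L_{ρ(a)}` by one of trace `ρ(a) f` on `T^*M`
(`topBracket_fsmul`, `topLie_fsmul`). The characteristic class of a representation exists in the
nonorientable case because the square of a line bundle has a nowhere-vanishing section
(`exists_nowhereZero_square`).
-/

noncomputable section

namespace LieAlgd

open Set Filter Function

/-! ### Smooth functions and sections -/

section Sections

variable {E : Type*} [NormedAddCommGroup E] [NormedSpace ℝ E] [FiniteDimensional ℝ E]
  {M : Type*} [TopologicalSpace M] [ChartedSpace E M] [IsManifold 𝓘(ℝ, E) ∞ M] [T2Space M]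

/-- Smooth real functions on `M`. -/
abbrev Fn (E : Type*) [NormedAddCommGroup E] [NormedSpace ℝ E]
    (M : Type*) [TopologicalSpace M] [ChartedSpace E M] := C^∞⟮𝓘(ℝ, E), M; 𝓘(ℝ, ℝ), ℝ⟯

/-- Bump functions, supported in a given neighbourhood. -/
lemma exists_bump {x : M} {U : Set M} (hU : U ∈ 𝓝 x) :
    ∃ χ : Fn E M, (∀ᶠ y in 𝓝 x, χ y = 1) ∧ tsupport χ ⊆ U := by
  obtain ⟨f, -, hf⟩ := (SmoothBumpFunction.nhds_basis_tsupport (I := 𝓘(ℝ, E)) x).mem_iff.1 hU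
  exact ⟨⟨f, f.contMDiff⟩, f.eventuallyEq_one, hf⟩

lemma mvfderiv_congr {f g : M → ℝ} {m : M} (h : ∀ᶠ y in 𝓝 m, f y = g y) :
    mvfderiv 𝓘(ℝ, E) f m = mvfderiv 𝓘(ℝ, E) g m := by
  have h' : f =ᶠ[𝓝 m] g := h
  unfold mvfderiv
  ext v
  have := h'.mfderiv_eq (I := 𝓘(ℝ, E)) (I' := 𝓘(ℝ, ℝ))
  exact congrArg (fun L => L v) this

lemma Fn.mdifferentiableAt (f : Fn E M) (m : M) : MDifferentiableAt 𝓘(ℝ, E) 𝓘(ℝ, ℝ) f m :=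
  f.contMDiff.mdifferentiable (by simp) m

lemma mvfderiv_fn_mul (f g : Fn E M) (m : M) (v : Tan E m) :
    mvfderiv 𝓘(ℝ, E) (f * g : Fn E M) m v =
      f m * mvfderiv 𝓘(ℝ, E) g m v + mvfderiv 𝓘(ℝ, E) f m v * g m := by
  have e : ((f * g : Fn E M) : M → ℝ) = (f : M → ℝ) * g := rfl
  rw [e, mvfderiv_mul (f.mdifferentiableAt m) (g.mdifferentiableAt m)]
  simp [mul_comm]

lemma mvfderiv_fn_add (f g : Fn E M) (m : M) :
    mvfderiv 𝓘(ℝ, E) (f + g : Fn E M) m =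
      mvfderiv 𝓘(ℝ, E) f m + mvfderiv 𝓘(ℝ, E) g m :=
  mvfderiv_add (f.mdifferentiableAt m) (g.mdifferentiableAt m)

lemma mvfderiv_fn_smul (c : ℝ) (f : Fn E M) (m : M) :
    mvfderiv 𝓘(ℝ, E) (c • f : Fn E M) m = c • mvfderiv 𝓘(ℝ, E) f m := by
  have e : ((c • f : Fn E M) : M → ℝ) = (fun _ : M => c) • (f : M → ℝ) := rfl
  rw [e, mvfderiv_smul mdifferentiableAt_const (f.mdifferentiableAt m), mvfderiv_const]
  ext v
  simp

lemma contMDiff_mvfderiv (v : Sec E E (Tan E (M := M))) (f : Fn E M) :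
    ContMDiff 𝓘(ℝ, E) 𝓘(ℝ, ℝ) ∞ fun m => mvfderiv 𝓘(ℝ, E) f m (v m) := by
  have h1 : ContMDiff 𝓘(ℝ, E).tangent 𝓘(ℝ, ℝ).tangent ∞ (tangentMap 𝓘(ℝ, E) 𝓘(ℝ, ℝ) f) :=
    f.contMDiff.contMDiff_tangentMap (by simp)
  exact (contMDiff_snd_tangentBundle_modelSpace ℝ 𝓘(ℝ, ℝ)).comp (h1.comp v.contMDiff)

/-- The derivative `v(f)` of a smooth function along a smooth vector field. -/
def derivFn (v : Sec E E (Tan E (M := M))) (f : Fn E M) : Fn E M :=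
  ⟨fun m => mvfderiv 𝓘(ℝ, E) f m (v m), contMDiff_mvfderiv v f⟩

variable {F : Type*} [NormedAddCommGroup F] [NormedSpace ℝ F] [FiniteDimensional ℝ F]
  {V : M → Type*}
  [∀ m, AddCommGroup (V m)] [∀ m, Module ℝ (V m)]
  [TopologicalSpace (TotalSpace F V)] [∀ m, TopologicalSpace (V m)] [FiberBundle F V]
  [VectorBundle ℝ F V] [ContMDiffVectorBundle ∞ F V 𝓘(ℝ, E)]

@[simp] lemma fsmul_apply (f : Fn E M) (s : Sec E F V) (m : M) : fsmul f s m = f m • s m := rfl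

lemma fsmul_add (f : Fn E M) (s t : Sec E F V) : fsmul f (s + t) = fsmul f s + fsmul f t := by
  ext m; simp

lemma fsmul_smul (c : ℝ) (f : Fn E M) (s : Sec E F V) : fsmul f (c • s) = c • fsmul f s := by
  ext m; exact smul_comm (f m) c (s m)

lemma sum_sec_apply {ι : Type*} (t : Finset ι) (s : ι → Sec E F V) (m : M) :
    (∑ j ∈ t, s j) m = ∑ j ∈ t, s j m := by
  have : ∀ s : Sec E F V, s m = (ContMDiffSection.coeAddHom 𝓘(ℝ, E) F ∞ V s) m := fun _ => rfl
  rw [this, map_sum, Finset.sum_apply]; rfl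

/-- Evaluation of sections at a point. -/
def evalSec (E : Type*) [NormedAddCommGroup E] [NormedSpace ℝ E]
    {M : Type*} [TopologicalSpace M] [ChartedSpace E M]
    (F : Type*) [NormedAddCommGroup F] [NormedSpace ℝ F] (V : M → Type*)
    [∀ m, AddCommGroup (V m)] [∀ m, Module ℝ (V m)]
    [TopologicalSpace (TotalSpace F V)] [∀ m, TopologicalSpace (V m)] [FiberBundle F V]
    [VectorBundle ℝ F V] (m : M) : Sec E F V →ₗ[ℝ] V m where
  toFun s := s m
  map_add' _ _ := rfl
  map_smul' _ _ := rfl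

/-- A section that is smooth near `x` agrees near `x` with a global smooth section. -/
lemma exists_sec_eventuallyEq {x : M} {U : Set M} (hU : U ∈ 𝓝 x) {s : ∀ y, V y}
    (hs : ContMDiffOn 𝓘(ℝ, E) (𝓘(ℝ, E).prod 𝓘(ℝ, F)) ∞ (fun y => TotalSpace.mk' F y (s y)) U) :
    ∃ t : Sec E F V, ∀ᶠ y in 𝓝 x, t y = s y := by
  obtain ⟨χ, h1, h2⟩ := exists_bump (E := E) (interior_mem_nhds.2 hU)
  refine ⟨⟨_, ContMDiffOn.smul_section_of_tsupport χ.contMDiff.contMDiffOn isOpen_interior h2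
    (hs.mono interior_subset)⟩, ?_⟩
  filter_upwards [h1] with y hy
  change χ y • s y = s y
  rw [hy, one_smul]

/-- Local sections that are constant in a trivialization extend to global ones. -/
lemma exists_sec_eventuallyEq_symm (m : M) (v : F) :
    ∃ s : Sec E F V, ∀ᶠ y in 𝓝 m, s y = (trivializationAt F V m).symm y v := by
  let e := trivializationAt F V m
  have hm : m ∈ e.baseSet := FiberBundle.mem_baseSet_trivializationAt F V m
  have hs : ContMDiffOn 𝓘(ℝ, E) (𝓘(ℝ, E).prod 𝓘(ℝ, F)) ∞
      (fun y => TotalSpace.mk' F y (e.symm y v)) e.baseSet := by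
    rw [e.contMDiffOn_section_baseSet_iff]
    refine (contMDiffOn_const (c := v)).congr fun y hy => ?_
    rw [e.apply_mk_symm hy]
  exact exists_sec_eventuallyEq (e.open_baseSet.mem_nhds hm) hs

/-- Every vector in a fibre is the value of a smooth section. -/
lemma exists_sec_eq (m : M) (v : V m) : ∃ s : Sec E F V, s m = v := by
  obtain ⟨s, hs⟩ := exists_sec_eventuallyEq_symm (E := E) (V := V) m (trivializationAt F V m ⟨m, v⟩).2
  exact ⟨s, hs.self_of_nhds.trans ((trivializationAt F V m).symm_proj_apply ⟨m, v⟩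
    (FiberBundle.mem_baseSet_trivializationAt F V m))⟩

lemma Sec.contMDiffOn_coord (s : Sec E F V) (x : M) :
    ContMDiffOn 𝓘(ℝ, E) 𝓘(ℝ, F) ∞ (fun y => (trivializationAt F V x ⟨y, s y⟩).2)
      (trivializationAt F V x).baseSet :=
  (Trivialization.contMDiffOn_section_baseSet_iff _).1 s.contMDiff.contMDiffOn

/-- Sections whose values at `x` form a basis are a frame near `x`: all sections have smooth
coefficients, linear over the smooth functions, with respect to them. -/
lemma exists_coeff {ι : Type*} [Fintype ι] {x : M} (e : ι → Sec E F V) (b : Basis ι ℝ (V x))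
    (he : ∀ j, e j x = b j) :
    ∃ U : Set M, IsOpen U ∧ x ∈ U ∧ ∃ κ : ι → Sec E F V → Fn E M,
      (∀ j s t, κ j (s + t) = κ j s + κ j t) ∧ (∀ j f s, κ j (fsmul f s) = f * κ j s) ∧
      ∀ y ∈ U, LinearIndependent ℝ (fun j => e j y) ∧ ∀ s, s y = ∑ j, κ j s y • e j y := by
  classical
  let T := trivializationAt F V x
  have hx : x ∈ T.baseSet := FiberBundle.mem_baseSet_trivializationAt F V x
  -- `P y` takes the coefficients to the linear combination, read in the trivialization at `x`; it is
  -- invertible at `x`, hence on the neighbourhood `U`, and `κ` is its inverse, cut off by a bump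
  -- function `χ`.
  let P : M → (ι → ℝ) →L[ℝ] F := fun y =>
    ∑ j, (ContinuousLinearMap.proj (R := ℝ) (φ := fun _ : ι => ℝ) j).smulRight (T ⟨y, e j y⟩).2
  have hP : ∀ y (c : ι → ℝ), P y c = ∑ j, c j • (T ⟨y, e j y⟩).2 := fun y c => by
    simp [P]
  have hPs : ∀ y ∈ T.baseSet, ∀ c : ι → ℝ, P y c = (T ⟨y, ∑ j, c j • e j y⟩).2 := by
    intro y hy c
    rw [hP]
    have : ∀ v, (T ⟨y, v⟩).2 = T.linearMapAt ℝ y v := fun v => by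
      rw [T.coe_linearMapAt_of_mem hy]
    simp only [this, map_sum, map_smul]
  have hPsm : ContMDiffOn 𝓘(ℝ, E) 𝓘(ℝ, (ι → ℝ) →L[ℝ] F) ∞ P T.baseSet := by
    refine contMDiffOn_finsetSum fun j _ => ?_
    have := (ContinuousLinearMap.smulRightL ℝ (ι → ℝ) F
      (ContinuousLinearMap.proj (R := ℝ) (φ := fun _ : ι => ℝ) j)).contMDiff (n := ∞)
    exact this.comp_contMDiffOn ((e j).contMDiffOn_coord x)
  let Q : (ι → ℝ) ≃L[ℝ] F :=
    (b.equivFun.symm.trans (T.linearEquivAt ℝ x hx)).toContinuousLinearEquiv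
  have hQ : (Q : (ι → ℝ) →L[ℝ] F) = P x := by
    refine ContinuousLinearMap.ext fun c => ?_
    rw [hPs x hx]
    change T.linearEquivAt ℝ x hx (b.equivFun.symm c) = _
    rw [b.equivFun_symm_apply]
    simp only [he]
    rfl
  let U : Set M := T.baseSet ∩ P ⁻¹' Set.range ((↑) : ((ι → ℝ) ≃L[ℝ] F) → (ι → ℝ) →L[ℝ] F)
  have hUo : IsOpen U :=
    hPsm.continuousOn.isOpen_inter_preimage T.open_baseSet ContinuousLinearEquiv.isOpen
  have hxU : x ∈ U := ⟨hx, Q, hQ⟩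
  have hc : ∀ s : Sec E F V, ContMDiffOn 𝓘(ℝ, E) 𝓘(ℝ, ι → ℝ) ∞
      (fun y => (P y).inverse (T ⟨y, s y⟩).2) U := by
    intro s y hy
    obtain ⟨R, hR⟩ := hy.2
    have h1 : ContDiffAt ℝ ∞ ContinuousLinearMap.inverse (P y) := by
      rw [← hR]; exact contDiffAt_map_inverse R
    have h2 : ContMDiffAt 𝓘(ℝ, E) 𝓘(ℝ, F →L[ℝ] (ι → ℝ)) ∞ (fun y => (P y).inverse) y :=
      h1.contMDiffAt.comp y (hPsm.contMDiffAt (T.open_baseSet.mem_nhds hy.1))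
    exact (h2.clm_apply
      ((s.contMDiffOn_coord x).contMDiffAt (T.open_baseSet.mem_nhds hy.1))).contMDiffWithinAt
  obtain ⟨χ, h1, h2⟩ := exists_bump (E := E) (hUo.mem_nhds hxU)
  have hTl : ∀ y ∈ U, ∀ v, (T ⟨y, v⟩).2 = T.linearMapAt ℝ y v := fun y hy v => by
      rw [T.coe_linearMapAt_of_mem hy.1]
  have hχ : ∀ y, y ∉ U → χ y = 0 := fun y hy =>
    image_eq_zero_of_notMem_tsupport fun h => hy (h2 h)
  obtain ⟨W, hW1, hWo, hxW⟩ := eventually_nhds_iff.1 h1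
  refine ⟨U ∩ W, hUo.inter hWo, ⟨hxU, hxW⟩, fun j s => ⟨fun y => χ y * (P y).inverse (T ⟨y, s y⟩).2 j,
    contMDiff_of_tsupport fun y hy => ?_⟩, ?_, ?_, ?_⟩
  · have hy' : y ∈ U := h2 ((tsupport_smul_subset_left (χ : M → ℝ) _) hy)
    exact χ.contMDiff.contMDiffAt.mul
      (contMDiffAt_pi_space.1 ((hc s).contMDiffAt (hUo.mem_nhds hy')) j)
  · intro j s t
    ext y
    change χ y * (P y).inverse (T ⟨y, s y + t y⟩).2 j =
      χ y * (P y).inverse (T ⟨y, s y⟩).2 j + χ y * (P y).inverse (T ⟨y, t y⟩).2 j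
    by_cases hy : y ∈ U
    · simp [hTl y hy, mul_add]
    · simp [hχ y hy]
  · intro j f s
    ext y
    change χ y * (P y).inverse (T ⟨y, f y • s y⟩).2 j =
      f y * (χ y * (P y).inverse (T ⟨y, s y⟩).2 j)
    by_cases hy : y ∈ U
    · simp [hTl y hy]; ring
    · simp [hχ y hy]
  · rintro y ⟨hyU, hyW⟩
    obtain ⟨R, hR⟩ := hyU.2
    have hinj : ∀ v w : V y, (T ⟨y, v⟩).2 = (T ⟨y, w⟩).2 → v = w := fun v w h =>
      (T.linearEquivAt ℝ y hyU.1).injective h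
    constructor
    · rw [Fintype.linearIndependent_iff]
      intro g hg
      have : P y g = P y 0 := by
        rw [hPs y hyU.1, hPs y hyU.1, hg]; simp
      rw [← hR] at this
      exact fun i => congrFun (R.injective this) i
    · intro s
      apply hinj
      change (T ⟨y, s y⟩).2 = (T ⟨y, ∑ j, (χ y * (P y).inverse (T ⟨y, s y⟩).2 j) • e j y⟩).2
      rw [← hPs y hyU.1, hW1 y hyW]
      simp only [one_mul]
      rw [← hR, ContinuousLinearMap.inverse_equiv]
      exact (R.apply_symm_apply _).symm

end Sections

/-! ### Tensoriality and the bracket of vector fields -/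

section Tensorial

variable {E : Type*} [NormedAddCommGroup E] [NormedSpace ℝ E] [FiniteDimensional ℝ E]
  {M : Type*} [TopologicalSpace M] [ChartedSpace E M] [IsManifold 𝓘(ℝ, E) ∞ M] [T2Space M]
  {F : Type*} [NormedAddCommGroup F] [NormedSpace ℝ F] [FiniteDimensional ℝ F]
  {V : M → Type*}
  [∀ m, AddCommGroup (V m)] [∀ m, Module ℝ (V m)]
  [TopologicalSpace (TotalSpace F V)] [∀ m, TopologicalSpace (V m)] [FiberBundle F V]
  [VectorBundle ℝ F V] [ContMDiffVectorBundle ∞ F V 𝓘(ℝ, E)]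

/-- The basis of a fibre given by the trivialization and the chosen basis of the model fibre. -/
def fibreBasis (F : Type*) [NormedAddCommGroup F] [NormedSpace ℝ F] [FiniteDimensional ℝ F]
    (V : M → Type*) [∀ m, AddCommGroup (V m)] [∀ m, Module ℝ (V m)]
    [TopologicalSpace (TotalSpace F V)] [∀ m, TopologicalSpace (V m)] [FiberBundle F V]
    [VectorBundle ℝ F V] (x : M) : Basis (Fin (finrank ℝ F)) ℝ (V x) :=
  (finBasis ℝ F).map ((trivializationAt F V x).linearEquivAt ℝ x
    (FiberBundle.mem_baseSet_trivializationAt F V x)).symm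

/-- Given a basis of a fibre, there are sections with these values. -/
lemma exists_sec_basis {ι : Type*} {x : M} (b : Basis ι ℝ (V x)) :
    ∃ e : ι → Sec E F V, ∀ j, e j x = b j := by
  choose e he using fun j => exists_sec_eq (E := E) (F := F) x (b j)
  exact ⟨e, he⟩

/-- A functional on sections that satisfies `T (f s) = f(x) T s` depends only on the value
of the section at `x`. -/
lemma eq_zero_of_tensorial {N : Type*} [AddCommGroup N] [Module ℝ N] {x : M}
    (T : Sec E F V →+ N) (hT : ∀ (f : Fn E M) s, T (fsmul f s) = f x • T s) {s : Sec E F V}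
    (hs : s x = 0) : T s = 0 := by
  let b := fibreBasis F V x
  obtain ⟨e, he⟩ := exists_sec_basis (E := E) (F := F) b
  obtain ⟨U, hU, hxU, κ, -, -, hκ⟩ := exists_coeff e b he
  obtain ⟨χ, h1, h2⟩ := exists_bump (E := E) (hU.mem_nhds hxU)
  have h3 : fsmul χ s = ∑ j, fsmul (χ * κ j s) (e j) := by
    ext y
    rw [sum_sec_apply]
    by_cases hy : y ∈ U
    · rw [fsmul_apply, (hκ y hy).2 s, Finset.smul_sum]
      refine Finset.sum_congr rfl fun j _ => ?_
      exact smul_smul _ _ _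
    · have : χ y = 0 := image_eq_zero_of_notMem_tsupport fun h => hy (h2 h)
      rw [fsmul_apply, this, zero_smul, eq_comm]
      refine Finset.sum_eq_zero fun j _ => ?_
      change (χ y * κ j s y) • e j y = 0
      rw [this, zero_mul, zero_smul]
  have h4 : ∀ j, κ j s x = 0 := by
    have := (hκ x hxU).2 s
    rw [hs] at this
    exact Fintype.linearIndependent_iff.1 (hκ x hxU).1 _ this.symm
  have h5 := hT χ s
  rw [h1.self_of_nhds, one_smul] at h5
  rw [← h5, h3, map_sum]
  refine Finset.sum_eq_zero fun j _ => ?_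
  rw [hT]
  change (χ x * κ j s x) • _ = _
  rw [h4, mul_zero, zero_smul]

/-- The value of a tensorial map depends only on the value of the section. -/
lemma eq_of_tensorial {N : Type*} [AddCommGroup N] [Module ℝ N] {x : M}
    (T : Sec E F V →+ N) (hT : ∀ (f : Fn E M) s, T (fsmul f s) = f x • T s) {s t : Sec E F V}
    (hs : s x = t x) : T s = T t := by
  have : T (s - t) = 0 := eq_zero_of_tensorial T hT (sub_eq_zero.2 hs)
  rwa [map_sub, sub_eq_zero] at this

/-- A `C^∞(M)`-linear map from the sections of `V` to the functions is a section of `V^*`. -/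
lemma exists_dualSec (T : Sec E F V →+ Fn E M) (hT : ∀ f s, T (fsmul f s) = f * T s) :
    ∃ α : DualSec E F V, ∀ s m, pair α s m = T s m := by
  let Tx : ∀ x : M, Sec E F V →+ ℝ := fun x =>
    { toFun := fun s => T s x
      map_zero' := by rw [map_zero]; rfl
      map_add' := fun s t => by rw [map_add]; rfl }
  have hTx : ∀ x (f : Fn E M) s, Tx x (fsmul f s) = f x • Tx x s := fun x f s => by
    change T _ x = _ * T _ x
    rw [hT]; rfl
  choose ext hext using fun x (v : V x) => exists_sec_eq (E := E) (F := F) x v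
  let l : ∀ x, V x →ₗ[ℝ] ℝ := fun x =>
    { toFun := fun v => Tx x (ext x v)
      map_add' := fun v w => by
        rw [← map_add]
        exact eq_of_tensorial _ (hTx x) (by simp [hext])
      map_smul' := fun c v => by
        have := hTx x (ContMDiffMap.const c) (ext x v)
        refine Eq.trans ?_ this
        refine eq_of_tensorial _ (hTx x) ?_
        rw [hext, fsmul_apply, hext]; rfl }
  have hl : ∀ x s, l x (s x) = T s x := fun x s =>
    eq_of_tensorial _ (hTx x) (by simp [hext])
  have hcont : ∀ x, Continuous (l x) := fun x => by
    let e := (trivializationAt F V x).continuousLinearEquivAt ℝ x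
      (FiberBundle.mem_baseSet_trivializationAt F V x)
    have h1 : Continuous ((l x).comp (e.symm : F →ₗ[ℝ] V x)) :=
      LinearMap.continuous_of_finiteDimensional _
    have h2 := h1.comp e.continuous
    convert h2 using 1
    ext v
    simp
  let α : ∀ x, V x →L[ℝ] Bundle.Trivial M ℝ x := fun x => ⟨l x, hcont x⟩
  refine ⟨⟨α, ?_⟩, fun s m => hl m s⟩
  intro x
  refine (contMDiffAt_hom_bundle _).2 ⟨contMDiffAt_id, ?_⟩
  let b := finBasis ℝ F
  choose t ht using fun j => exists_sec_eventuallyEq_symm (E := E) (V := V) x (b j)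
  have h1 : ContMDiffAt 𝓘(ℝ, E) 𝓘(ℝ, F →L[ℝ] ℝ) ∞
      (fun y => ∑ j, T (t j) y • LinearMap.toContinuousLinearMap (b.coord j)) x :=
    contMDiffAt_finsetSum fun j _ => (T (t j)).contMDiff.contMDiffAt.smul contMDiffAt_const
  refine h1.congr_of_eventuallyEq ?_
  filter_upwards [eventually_all.2 ht, (trivializationAt F V x).open_baseSet.mem_nhds
    (FiberBundle.mem_baseSet_trivializationAt F V x)] with y hy hyU
  refine ContinuousLinearMap.coe_injective (b.ext fun k => ?_)
  have h2 : ContinuousLinearMap.inCoordinates F V ℝ (Bundle.Trivial M ℝ) x y x y (α y) (b k) =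
      l y ((trivializationAt F V x).symm y (b k)) := by
    rw [ContinuousLinearMap.inCoordinates_eq hyU (Set.mem_univ _)]
    rfl
  refine h2.trans ?_
  rw [← hy k, hl]
  simp [Finsupp.single_apply]

end Tensorial

section Bracket

variable {E : Type*} [NormedAddCommGroup E] [NormedSpace ℝ E] [FiniteDimensional ℝ E]
  {M : Type*} [TopologicalSpace M] [ChartedSpace E M] [IsManifold 𝓘(ℝ, E) ∞ M] [T2Space M]

/-- The Lie bracket of vector fields, as an operation on smooth sections. -/
def lieB (v w : Sec E E (Tan E (M := M))) : Sec E E (Tan E (M := M)) where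
  toFun m := VectorField.mlieBracket 𝓘(ℝ, E) (fun x => v x) (fun x => w x) m
  contMDiff_toFun := by
    have : IsManifold 𝓘(ℝ, E) ((⊤ : ℕ∞) + 1) M := by simpa using ‹IsManifold 𝓘(ℝ, E) ∞ M›
    have : IsManifold 𝓘(ℝ, E) (minSmoothness ℝ 2) M := by
      rw [minSmoothness_of_isRCLikeNormedField]
      exact IsManifold.of_le (n := ∞) (WithTop.coe_le_coe.2 (le_top : (2 : ℕ∞) ≤ ⊤))
    exact fun m => ContMDiffAt.mlieBracket_vectorField (n := (⊤ : ℕ∞)) (m := (⊤ : ℕ∞))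
      v.contMDiff.contMDiffAt w.contMDiff.contMDiffAt (by simp)

lemma lieB_add_left (v v' w : Sec E E (Tan E (M := M))) :
    lieB (v + v') w = lieB v w + lieB v' w := by
  ext m
  exact VectorField.mlieBracket_add_left v.mdifferentiableAt v'.mdifferentiableAt

lemma lieB_add_right (v w w' : Sec E E (Tan E (M := M))) :
    lieB v (w + w') = lieB v w + lieB v w' := by
  ext m
  exact VectorField.mlieBracket_add_right w.mdifferentiableAt w'.mdifferentiableAt

lemma lieB_swap (v w : Sec E E (Tan E (M := M))) : lieB v w = -lieB w v := by
  ext m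
  exact VectorField.mlieBracket_swap_apply

lemma lieB_fsmul_right (v w : Sec E E (Tan E (M := M))) (f : Fn E M) :
    lieB v (fsmul f w) = fsmul f (lieB v w) + fsmul (derivFn v f) w := by
  ext m
  rw [add_comm]
  exact VectorField.mlieBracket_smul_right (f.mdifferentiableAt m) w.mdifferentiableAt

lemma lieB_jacobi (u v w : Sec E E (Tan E (M := M))) :
    lieB u (lieB v w) = lieB (lieB u v) w + lieB v (lieB u w) := by
  have : IsManifold 𝓘(ℝ, E) (minSmoothness ℝ 3) M := by
    rw [minSmoothness_of_isRCLikeNormedField]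
    exact IsManifold.of_le (n := ∞) (WithTop.coe_le_coe.2 (le_top : (3 : ℕ∞) ≤ ⊤))
  have h : ∀ s : Sec E E (Tan E (M := M)), ∀ m, ContMDiffAt 𝓘(ℝ, E) (𝓘(ℝ, E).prod 𝓘(ℝ, E))
      (minSmoothness ℝ 2) (fun x => TotalSpace.mk' E x (s x)) m := fun s m => by
    rw [minSmoothness_of_isRCLikeNormedField]
    exact s.contMDiff.contMDiffAt.of_le (WithTop.coe_le_coe.2 (le_top : (2 : ℕ∞) ≤ ⊤))
  ext m
  exact VectorField.leibniz_identity_mlieBracket_apply (h u m) (h v m) (h w m)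

/-- The Lie bracket of vector fields is their commutator as derivations of functions. This
follows from the Jacobi identity for `v`, `w` and `f u`. -/
lemma mvfderiv_lieB (v w : Sec E E (Tan E (M := M))) (f : Fn E M) :
    derivFn (lieB v w) f = derivFn v (derivFn w f) - derivFn w (derivFn v f) := by
  ext m
  rcases subsingleton_or_nontrivial E with hE | hE
  · have h : ∀ u : Sec E E (Tan E (M := M)), ∀ g : Fn E M, derivFn u g m = 0 := fun u g => by
      change mvfderiv 𝓘(ℝ, E) g m (u m) = 0
      have : u m = 0 := Subsingleton.elim (α := E) _ _
      rw [this, map_zero]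
    change derivFn (lieB v w) f m = derivFn v (derivFn w f) m - derivFn w (derivFn v f) m
    rw [h, h, h, sub_zero]
  · obtain ⟨e, he⟩ := exists_ne (0 : E)
    obtain ⟨u, hu⟩ := exists_sec_eq (E := E) (F := E) (V := Tan E (M := M)) m e
    have h1 := lieB_jacobi v w (fsmul f u)
    simp only [lieB_fsmul_right, lieB_add_right, lieB_jacobi v w u] at h1
    have h2 := congrArg (fun s : Sec E E (Tan E (M := M)) => s m) h1
    simp only [ContMDiffSection.coe_add, Pi.add_apply, fsmul_apply, smul_add] at h2
    have h3 : (derivFn (lieB v w) f m - (derivFn v (derivFn w f) m - derivFn w (derivFn v f) m)) •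
        u m = 0 := by
      linear_combination (norm := module) (-1 : ℝ) • h2
    have h4 := (smul_eq_zero.1 h3).resolve_right (by rw [hu]; exact he)
    exact sub_eq_zero.1 h4

end Bracket

/-! ### Derivations of line bundles -/

section Derivations

variable {E : Type*} [NormedAddCommGroup E] [NormedSpace ℝ E] [FiniteDimensional ℝ E]
  {M : Type*} [TopologicalSpace M] [ChartedSpace E M] [IsManifold 𝓘(ℝ, E) ∞ M] [T2Space M]
  {F : Type*} [NormedAddCommGroup F] [NormedSpace ℝ F] [FiniteDimensional ℝ F]
  {V : M → Type*}
  [∀ m, AddCommGroup (V m)] [∀ m, Module ℝ (V m)]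
  [TopologicalSpace (TotalSpace F V)] [∀ m, TopologicalSpace (V m)] [FiberBundle F V]
  [VectorBundle ℝ F V] [ContMDiffVectorBundle ∞ F V 𝓘(ℝ, E)]

/-- `P`, with values in the fibre at `m`, is a derivation of sections of `V` over the tangent
vector `v`: `P(f s) = f(m) P(s) + v(f) s(m)`. -/
def IsPtDer {m : M} (v : Tan E m) (P : Sec E F V →ₗ[ℝ] V m) : Prop :=
  ∀ (f : Fn E M) s, P (fsmul f s) = f m • P s + mvfderiv 𝓘(ℝ, E) f m v • s m

/-- `δ` is a derivation of sections of `V` over the vector field `v`: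
`δ(f s) = f δ(s) + v(f) s`. -/
def IsDer (v : Sec E E (Tan E (M := M))) (δ : Sec E F V →ₗ[ℝ] Sec E F V) : Prop :=
  ∀ m, IsPtDer (v m) (evalSec E F V m ∘ₗ δ)

lemma IsDer.apply {v : Sec E E (Tan E (M := M))} {δ : Sec E F V →ₗ[ℝ] Sec E F V}
    (h : IsDer v δ) (f : Fn E M) (s : Sec E F V) (m : M) :
    δ (fsmul f s) m = f m • δ s m + mvfderiv 𝓘(ℝ, E) f m (v m) • s m := h m f s

lemma IsDer.fsmul {v : Sec E E (Tan E (M := M))} {δ : Sec E F V →ₗ[ℝ] Sec E F V}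
    (h : IsDer v δ) (f : Fn E M) (s : Sec E F V) :
    δ (fsmul f s) = LieAlgd.fsmul f (δ s) + LieAlgd.fsmul (derivFn v f) s := by
  ext m
  exact h m f s

/-- Derivations are local. -/
lemma IsPtDer.congr {m : M} {v : Tan E m} {P : Sec E F V →ₗ[ℝ] V m} (h : IsPtDer v P)
    {s t : Sec E F V} (hst : ∀ᶠ y in 𝓝 m, s y = t y) : P s = P t := by
  obtain ⟨χ, h1, h2⟩ := exists_bump (E := E) hst
  have h3 : fsmul χ s = fsmul χ t := by
    ext y
    by_cases hy : s y = t y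
    · rw [fsmul_apply, fsmul_apply, hy]
    · have : χ y = 0 := image_eq_zero_of_notMem_tsupport fun h => hy (h2 h)
      rw [fsmul_apply, fsmul_apply, this, zero_smul, zero_smul]
  have h4 : ∀ s, P (fsmul χ s) = P s := fun s => by
    have : mvfderiv 𝓘(ℝ, E) χ m v = 0 := by
      rw [mvfderiv_congr (g := fun _ => (1 : ℝ)) h1, mvfderiv_const]; simp
    rw [h, h1.self_of_nhds, this, one_smul, zero_smul, add_zero]
  rw [← h4 s, h3, h4]

/-- The difference of two derivations over the same tangent vector is tensorial. -/
lemma IsPtDer.sub_tensorial {m : M} {v : Tan E m} {P Q : Sec E F V →ₗ[ℝ] V m}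
    (hP : IsPtDer v P) (hQ : IsPtDer v Q) (f : Fn E M) (s : Sec E F V) :
    (P - Q) (fsmul f s) = f m • (P - Q) s := by
  rw [LinearMap.sub_apply, LinearMap.sub_apply, hP, hQ, smul_sub]
  abel

/-! #### Line bundles -/

section Line

variable {L : M → Type*} [∀ m, AddCommGroup (L m)] [∀ m, Module ℝ (L m)]
  [TopologicalSpace (TotalSpace ℝ L)] [∀ m, TopologicalSpace (L m)] [FiberBundle ℝ L]
  [VectorBundle ℝ ℝ L] [ContMDiffVectorBundle ∞ ℝ L 𝓘(ℝ, E)]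

lemma finrank_line (L : M → Type*) [∀ m, AddCommGroup (L m)] [∀ m, Module ℝ (L m)]
    [TopologicalSpace (TotalSpace ℝ L)] [∀ m, TopologicalSpace (L m)] [FiberBundle ℝ L]
    [VectorBundle ℝ ℝ L] (m : M) : finrank ℝ (L m) = 1 := by
  rw [((trivializationAt ℝ L m).linearEquivAt ℝ m
    (FiberBundle.mem_baseSet_trivializationAt ℝ L m)).finrank_eq, finrank_self]

lemma exists_smul_of_line {m : M} {v : L m} (hv : v ≠ 0) (w : L m) : ∃ c : ℝ, w = c • v := by
  obtain ⟨c, hc⟩ := (finrank_eq_one_iff_of_nonzero' v hv).1 (finrank_line L m) w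
  exact ⟨c, hc.symm⟩

/-- A section of a line bundle that does not vanish at `x` is a frame near `x`. -/
lemma exists_lineCoeff {x : M} {τ : Sec E ℝ L} (hτ : τ x ≠ 0) :
    ∃ U : Set M, IsOpen U ∧ x ∈ U ∧ ∃ κ : Sec E ℝ L → Fn E M,
      (∀ s t, κ (s + t) = κ s + κ t) ∧ (∀ f s, κ (fsmul f s) = f * κ s) ∧
      ∀ y ∈ U, τ y ≠ 0 ∧ ∀ s, s y = κ s y • τ y := by
  let b : Basis Unit ℝ (L x) := Basis.mk (v := fun _ => τ x)
    (LinearIndependent.of_subsingleton () hτ) (fun w _ => by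
      obtain ⟨c, hc⟩ := exists_smul_of_line hτ w
      rw [hc]
      exact Submodule.smul_mem _ _ (Submodule.subset_span ⟨(), rfl⟩))
  obtain ⟨U, hU, hx, κ, h1, h2, h3⟩ := exists_coeff (fun _ : Unit => τ) b (fun j => by simp [b])
  refine ⟨U, hU, hx, κ (), h1 (), h2 (), fun y hy => ⟨(h3 y hy).1.ne_zero (), fun s => ?_⟩⟩
  simpa using (h3 y hy).2 s

lemma exists_sec_ne_zero (L : M → Type*) [∀ m, AddCommGroup (L m)] [∀ m, Module ℝ (L m)]
    [TopologicalSpace (TotalSpace ℝ L)] [∀ m, TopologicalSpace (L m)] [FiberBundle ℝ L]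
    [VectorBundle ℝ ℝ L] [ContMDiffVectorBundle ∞ ℝ L 𝓘(ℝ, E)] (m : M) :
    ∃ τ : Sec E ℝ L, τ m ≠ 0 := by
  have : Nontrivial (L m) := Module.nontrivial_of_finrank_pos (R := ℝ) (by rw [finrank_line]; simp)
  obtain ⟨v, hv⟩ := exists_ne (0 : L m)
  obtain ⟨τ, h⟩ := exists_sec_eq (E := E) (F := ℝ) m v
  exact ⟨τ, h ▸ hv⟩

/-- A derivation of a line bundle at `m` over `v` is determined by its value on one section that
does not vanish at `m`. -/
lemma IsPtDer.line_ext {m : M} {v : Tan E m} {P Q : Sec E ℝ L →ₗ[ℝ] L m}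
    (hP : IsPtDer v P) (hQ : IsPtDer v Q) {τ : Sec E ℝ L} (hτ : τ m ≠ 0) (h : P τ = Q τ) :
    P = Q := by
  ext s
  obtain ⟨c, hc⟩ := exists_smul_of_line hτ (s m)
  have h1 : (P - Q) s = (P - Q) (c • τ) :=
    eq_of_tensorial (P - Q).toAddMonoidHom (hP.sub_tensorial hQ) hc
  rw [map_smul, LinearMap.sub_apply, LinearMap.sub_apply, h, sub_self, smul_zero,
    sub_eq_zero] at h1
  exact h1

/-- A derivation of a line bundle at `m` can be prescribed on a section with `τ(m) ≠ 0`. -/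
lemma exists_ptDer_line {m : M} (v : Tan E m) {τ : Sec E ℝ L} (hτ : τ m ≠ 0) (d : L m) :
    ∃ P : Sec E ℝ L →ₗ[ℝ] L m, IsPtDer v P ∧ P τ = d := by
  obtain ⟨U, hU, hx, κ, h1, h2, h3⟩ := exists_lineCoeff hτ
  have hc : ∀ (c : ℝ) s, κ (c • s) = c • κ s := fun c s => by
    have := h2 (ContMDiffMap.const c) s
    exact this
  refine ⟨{
    -- the Leibniz rule for `s = κ(s) τ` near `m`
    toFun := fun s => κ s m • d + mvfderiv 𝓘(ℝ, E) (κ s) m v • τ m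
    map_add' := fun s t => by
      rw [h1, mvfderiv_fn_add]
      change (κ s m + κ t m) • d + (mvfderiv 𝓘(ℝ, E) (κ s) m v + mvfderiv 𝓘(ℝ, E) (κ t) m v) • τ m = _
      module
    map_smul' := fun c s => by
      rw [hc, mvfderiv_fn_smul]
      change (c * κ s m) • d + (c * mvfderiv 𝓘(ℝ, E) (κ s) m v) • τ m =
        c • (κ s m • d + mvfderiv 𝓘(ℝ, E) (κ s) m v • τ m)
      module }, fun f s => ?_, ?_⟩
  · change κ (fsmul f s) m • d + mvfderiv 𝓘(ℝ, E) (κ (fsmul f s)) m v • τ m =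
      f m • (κ s m • d + mvfderiv 𝓘(ℝ, E) (κ s) m v • τ m) + _
    rw [h2, mvfderiv_fn_mul, (h3 m hx).2 s]
    change (f m * κ s m) • d + _ = _
    module
  · have h4 : ∀ᶠ y in 𝓝 m, κ τ y = 1 := by
      filter_upwards [hU.mem_nhds hx] with y hy
      have := (h3 y hy).2 τ
      have h5 : (κ τ y - 1) • τ y = 0 := by rw [sub_smul, one_smul, ← this, sub_self]
      exact sub_eq_zero.1 ((smul_eq_zero.1 h5).resolve_right (h3 y hy).1)
    change κ τ m • d + mvfderiv 𝓘(ℝ, E) (κ τ) m v • τ m = d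
    rw [mvfderiv_congr (g := fun _ => (1 : ℝ)) h4, mvfderiv_const, h4.self_of_nhds]
    simp

/-- A family of derivations of a line bundle at all points defines smooth sections if it does so
on local frames. -/
lemma exists_der_of_ptDer (v : Sec E E (Tan E (M := M))) (P : ∀ m, Sec E ℝ L →ₗ[ℝ] L m)
    (hP : ∀ m, IsPtDer (v m) (P m))
    (h : ∀ x, ∃ τ t : Sec E ℝ L, τ x ≠ 0 ∧ ∀ᶠ y in 𝓝 x, P y τ = t y) :
    ∃ δ : Sec E ℝ L →ₗ[ℝ] Sec E ℝ L, IsDer v δ ∧ ∀ s m, δ s m = P m s := by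
  have hsm : ∀ s, ContMDiff 𝓘(ℝ, E) (𝓘(ℝ, E).prod 𝓘(ℝ, ℝ)) ∞
      (fun y => TotalSpace.mk' ℝ y (P y s)) := by
    intro s x
    obtain ⟨τ, t, hτ, ht⟩ := h x
    obtain ⟨U, hU, hx, κ, h1, h2, h3⟩ := exists_lineCoeff hτ
    refine ((fsmul (κ s) t + fsmul (derivFn v (κ s)) τ).contMDiff x).congr_of_eventuallyEq ?_
    filter_upwards [ht, hU.mem_nhds hx] with y hy hyU
    refine congrArg (TotalSpace.mk' ℝ y) ?_
    rw [(hP y).congr (t := fsmul (κ s) τ) (eventually_of_mem (hU.mem_nhds hyU) fun z hz =>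
      (h3 z hz).2 s), hP y, hy]
    rfl
  exact ⟨{
    toFun := fun s => ⟨fun y => P y s, hsm s⟩
    map_add' := fun s t => by ext y; exact map_add (P y) s t
    map_smul' := fun c s => by ext y; exact map_smul (P y) c s }, hP, fun _ _ => rfl⟩

/-- A derivation of a line bundle over `v` is determined by its values on sections without common
zeros. -/
lemma IsDer.line_ext {v : Sec E E (Tan E (M := M))} {δ ε : Sec E ℝ L →ₗ[ℝ] Sec E ℝ L}
    (hδ : IsDer v δ) (hε : IsDer v ε) (h : ∀ x, ∃ τ, τ x ≠ 0 ∧ δ τ x = ε τ x) : δ = ε := by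
  ext s x
  obtain ⟨τ, h1, h2⟩ := h x
  exact LinearMap.congr_fun ((hδ x).line_ext (hε x) h1 h2) s

end Line

end Derivations

/-! ### Derivations of top exterior powers -/

section Alternating

variable {ι : Type*} [Fintype ι] [DecidableEq ι] {S W N : Type*} [AddCommGroup S] [Module ℝ S]
  [AddCommGroup W] [Module ℝ W] [AddCommGroup N] [Module ℝ N]

/-- The alternating map `s ↦ ∑ j, φ(s₁, …, P s_j, …, s_n)`, where the other arguments are taken
to the domain of `φ` by `ev`. -/
def derivAlt (φ : W [⋀^ι]→ₗ[ℝ] N) (ev P : S →ₗ[ℝ] W) : S [⋀^ι]→ₗ[ℝ] N :=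
  { ∑ j, φ.toMultilinearMap.compLinearMap fun l => if l = j then P else ev with
    map_eq_zero_of_eq' := by
      intro s a b hab hne
      have h1 : ∀ j, (fun l => (if l = j then P else ev) (s l)) =
          update (fun l => ev (s l)) j (P (s j)) := fun j => by
        ext l
        by_cases h : l = j
        · subst h; simp
        · simp [h]
      change (∑ j, φ.toMultilinearMap.compLinearMap fun l => if l = j then P else ev) s = 0
      rw [sum_apply]
      simp only [MultilinearMap.compLinearMap_apply, AlternatingMap.coe_multilinearMap, h1]
      rw [Finset.sum_eq_add_of_mem a b (Finset.mem_univ _) (Finset.mem_univ _) hne]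
      · have h2 : update (fun l => ev (s l)) b (P (s b)) =
            update (fun l => ev (s l)) a (P (s a)) ∘ Equiv.swap a b := by
          ext l
          by_cases ha : l = a
          · subst ha; simp [hne, hne.symm, hab]
          · by_cases hb : l = b
            · subst hb; simp [hab]
            · simp [ha, hb, Equiv.swap_apply_of_ne_of_ne ha hb]
        rw [h2, φ.map_swap _ hne, add_neg_cancel]
      · intro c _ hc
        exact φ.map_eq_zero_of_eq _ (by simp [hc.1.symm, hc.2.symm, hab]) hne }

lemma derivAlt_apply (φ : W [⋀^ι]→ₗ[ℝ] N) (ev P : S →ₗ[ℝ] W) (s : ι → S) :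
    derivAlt φ ev P s = ∑ j, φ (update (fun l => ev (s l)) j (P (s j))) := by
  change (∑ j, φ.toMultilinearMap.compLinearMap fun l => if l = j then P else ev) s = _
  rw [sum_apply]
  refine Finset.sum_congr rfl fun j _ => ?_
  simp only [MultilinearMap.compLinearMap_apply, AlternatingMap.coe_multilinearMap]
  congr 1
  ext l
  by_cases h : l = j
  · subst h; simp
  · simp [h]

/-- An alternating map that vanishes when some argument is in the kernel of `ev`, and
vanishes on a family that `ev` maps to a basis, is zero. -/
lemma alternating_eq_zero {ev : S →ₗ[ℝ] W} (T : S [⋀^ι]→ₗ[ℝ] N)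
    (hT : ∀ s j, ev (s j) = 0 → T s = 0) (b : Basis ι ℝ W) {e : ι → S} (he : ∀ j, ev (e j) = b j)
    (h : T e = 0) : T = 0 := by
  let ext : W →ₗ[ℝ] S := b.constr ℝ e
  have hext : ∀ w, ev (ext w) = w := fun w => by
    have : ev ∘ₗ ext = LinearMap.id := b.ext fun j => by simp [ext, he]
    exact LinearMap.congr_fun this w
  have h1 : T.compLinearMap ext = 0 := by
    refine Basis.ext_alternating b fun σ hσ => ?_
    let τ : Equiv.Perm ι := Equiv.ofBijective σ (Finite.injective_iff_bijective.1 hσ)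
    have h2 : (fun j => ext (b (σ j))) = e ∘ τ := by
      ext j; simp [ext, τ]
    change T (fun j => ext (b (σ j))) = 0
    rw [h2, T.map_perm, h, smul_zero]
  ext s
  have h3 : s = (fun j => ext (ev (s j))) + fun j => s j - ext (ev (s j)) := by
    ext j; simp
  rw [h3]
  have h4 := T.toMultilinearMap.map_add_univ (fun j => ext (ev (s j)))
    (fun j => s j - ext (ev (s j)))
  refine h4.trans ?_
  refine Finset.sum_eq_zero fun A _ => ?_
  by_cases hA : ∃ j, j ∉ A
  · obtain ⟨j, hj⟩ := hA
    exact hT _ j (by simp [hj, hext])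
  · push Not at hA
    have : A = Finset.univ := Finset.eq_univ_iff_forall.2 hA
    rw [this, Finset.piecewise_univ]
    exact AlternatingMap.congr_fun h1 fun j => ev (s j)

end Alternating

section Top

variable {E : Type*} [NormedAddCommGroup E] [NormedSpace ℝ E] [FiniteDimensional ℝ E]
  {M : Type*} [TopologicalSpace M] [ChartedSpace E M] [IsManifold 𝓘(ℝ, E) ∞ M] [T2Space M]
  {F : Type*} [NormedAddCommGroup F] [NormedSpace ℝ F] [FiniteDimensional ℝ F]
  {V : M → Type*}
  [∀ m, AddCommGroup (V m)] [∀ m, Module ℝ (V m)]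
  [TopologicalSpace (TotalSpace F V)] [∀ m, TopologicalSpace (V m)] [FiberBundle F V]
  [VectorBundle ℝ F V] [ContMDiffVectorBundle ∞ F V 𝓘(ℝ, E)]

/-- The wedge product of vectors in a fibre, as an alternating map. -/
def wedgeAlt (F : Type*) [NormedAddCommGroup F] [NormedSpace ℝ F]
    (V : M → Type*) [∀ m, AddCommGroup (V m)] [∀ m, Module ℝ (V m)] (m : M) :
    V m [⋀^Fin (finrank ℝ F)]→ₗ[ℝ] TopPow F V m := exteriorPower.ιMulti ℝ (finrank ℝ F)

lemma wedge_basis_ne_zero {m : M} (b : Basis (Fin (finrank ℝ F)) ℝ (V m)) :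
    (wedge b : TopPow F V m) ≠ 0 := by
  intro h
  have h1 : exteriorPower.alternatingMapLinearEquiv b.det (wedge (F := F) b) = 1 := by
    refine (exteriorPower.alternatingMapLinearEquiv_apply_ιMulti _ _).trans b.det_self
  rw [h] at h1
  erw [map_zero] at h1
  exact zero_ne_one h1

lemma exists_wedgeSec_ne_zero (x : M) :
    ∃ s : Fin (finrank ℝ F) → Sec E F V, ∃ b : Basis (Fin (finrank ℝ F)) ℝ (V x),
      (∀ j, s j x = b j) ∧ wedgeSec s x ≠ 0 := by
  let b := fibreBasis F V x
  obtain ⟨e, he⟩ := exists_sec_basis (E := E) (F := F) b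
  refine ⟨e, b, he, ?_⟩
  have : wedgeSec e x = wedge b := congrArg wedge (funext he)
  rw [this]
  exact wedge_basis_ne_zero b

lemma update_sec_apply {ι : Type*} [DecidableEq ι] (s : ι → Sec E F V) (j : ι) (t : Sec E F V)
    (m : M) : (fun l => update s j t l m) = update (fun l => s l m) j (t m) := by
  ext l
  by_cases h : l = j
  · subst h; simp
  · simp [h]

lemma wedgeSec_update_apply (s : Fin (finrank ℝ F) → Sec E F V) (j) (t : Sec E F V) (m : M) :
    wedgeSec (update s j t) m = wedge (update (fun l => s l m) j (t m)) :=
  congrArg wedge (update_sec_apply s j t m)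

/-- The wedge product of sections, as an alternating map. -/
def wedgeSecAlt (E : Type*) [NormedAddCommGroup E] [NormedSpace ℝ E] [FiniteDimensional ℝ E]
    {M : Type*} [TopologicalSpace M] [ChartedSpace E M] [IsManifold 𝓘(ℝ, E) ∞ M]
    (F : Type*) [NormedAddCommGroup F] [NormedSpace ℝ F] [FiniteDimensional ℝ F]
    (V : M → Type*) [∀ m, AddCommGroup (V m)] [∀ m, Module ℝ (V m)]
    [TopologicalSpace (TotalSpace F V)] [∀ m, TopologicalSpace (V m)] [FiberBundle F V]
    [VectorBundle ℝ F V] [ContMDiffVectorBundle ∞ F V 𝓘(ℝ, E)] :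
    Sec E F V [⋀^Fin (finrank ℝ F)]→ₗ[ℝ] Sec E ℝ (TopPow F V) where
  toFun s := wedgeSec s
  map_update_add' s j t t' := by
    ext m
    exact ((wedgeAlt F V m).compLinearMap (evalSec E F V m)).map_update_add' s j t t'
  map_update_smul' s j c t := by
    ext m
    exact ((wedgeAlt F V m).compLinearMap (evalSec E F V m)).map_update_smul' s j c t
  map_eq_zero_of_eq' s i j h hij := by
    ext m
    exact ((wedgeAlt F V m).compLinearMap (evalSec E F V m)).map_eq_zero_of_eq' s i j h hij

/-- If a derivation of `∧^top V` over `v` is induced by a derivation `P` of `V` on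
one frame, then it is induced by `P` on all sections. -/
lemma IsPtDer.wedge_formula {m : M} {v : Tan E m} {P : Sec E F V →ₗ[ℝ] V m} (hP : IsPtDer v P)
    {Q : Sec E ℝ (TopPow F V) →ₗ[ℝ] TopPow F V m} (hQ : IsPtDer v Q)
    {e : Fin (finrank ℝ F) → Sec E F V} (b : Basis (Fin (finrank ℝ F)) ℝ (V m))
    (he : ∀ j, e j m = b j)
    (h : Q (wedgeSec e) = ∑ j, wedge (update (fun l => e l m) j (P (e j))))
    (s : Fin (finrank ℝ F) → Sec E F V) :
    Q (wedgeSec s) = ∑ j, wedge (update (fun l => s l m) j (P (s j))) := by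
  let T : Sec E F V [⋀^Fin (finrank ℝ F)]→ₗ[ℝ] TopPow F V m :=
    Q.compAlternatingMap (wedgeSecAlt E F V) - derivAlt (wedgeAlt F V m) (evalSec E F V m) P
  have hTa : ∀ s, T s = Q (wedgeSec s) - ∑ j, wedge (update (fun l => s l m) j (P (s j))) := by
    intro s
    change Q (wedgeSec s) - derivAlt _ _ _ s = _
    rw [derivAlt_apply]; rfl
  suffices hT : T = 0 by
    have := hTa s
    rw [hT] at this
    exact (sub_eq_zero.1 this.symm)
  refine alternating_eq_zero (ev := evalSec E F V m) T ?_ b he (by rw [hTa, h, sub_self])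
  intro s j hs
  -- tensoriality in the `j`-th argument
  have key : ∀ (f : Fn E M) t, T (update s j (fsmul f t)) = f m • T (update s j t) := by
    intro f t
    rw [hTa, hTa]
    have h1 : wedgeSec (update s j (fsmul f t)) = fsmul f (wedgeSec (update s j t)) := by
      ext y
      rw [fsmul_apply, wedgeSec_update_apply, wedgeSec_update_apply]
      exact (wedgeAlt F V y).map_update_smul _ _ _ _
    rw [h1, hQ, smul_sub]
    have h2 : ∀ k, (wedge (update (fun l => update s j (fsmul f t) l m) k
          (P (update s j (fsmul f t) k))) : TopPow F V m) =
        f m • wedge (update (fun l => update s j t l m) k (P (update s j t k))) +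
          if k = j then mvfderiv 𝓘(ℝ, E) f m v • wedgeSec (update s j t) m else 0 := by
      intro k
      rw [wedgeSec_update_apply, update_sec_apply, update_sec_apply]
      by_cases hk : k = j
      · subst hk
        simp only [update_self, update_idem, if_true]
        rw [hP]
        have h3 := (wedgeAlt F V m).map_update_add (fun l => s l m) k (f m • P t)
          (mvfderiv 𝓘(ℝ, E) f m v • t m)
        rw [(wedgeAlt F V m).map_update_smul, (wedgeAlt F V m).map_update_smul] at h3
        exact h3
      · simp only [update_of_ne hk, if_neg hk, add_zero]
        rw [update_comm (Ne.symm hk), update_comm (Ne.symm hk)]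
        exact (wedgeAlt F V m).map_update_smul _ _ _ _
    simp only [h2, Finset.sum_add_distrib, Finset.sum_ite_eq', Finset.mem_univ, if_true,
      ← Finset.smul_sum]
    abel
  have := eq_zero_of_tensorial (T.toMultilinearMap.toLinearMap s j).toAddMonoidHom
    (fun f t => key f t) hs
  have h5 : T (update s j (s j)) = 0 := this
  rwa [update_eq_self] at h5

/-- A derivation of `V` induces a derivation of `∧^top V`. -/
lemma exists_topDer {v : Sec E E (Tan E (M := M))} {δ : Sec E F V →ₗ[ℝ] Sec E F V}
    (hδ : IsDer v δ) : ∃ Δ : Sec E ℝ (TopPow F V) →ₗ[ℝ] Sec E ℝ (TopPow F V),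
      IsDer v Δ ∧ ∀ s, Δ (wedgeSec s) = ∑ j, wedgeSec (update s j (δ (s j))) := by
  choose e b he hne using fun x => exists_wedgeSec_ne_zero (E := E) (F := F) (V := V) x
  choose P hP hPe using fun m => exists_ptDer_line (v m) (hne m)
    (∑ j, wedge (update (fun l => e m l m) j (δ (e m j) m)))
  have hformula : ∀ m s, P m (wedgeSec s) = (∑ j, wedgeSec (update s j (δ (s j)))) m := by
    intro m s
    rw [sum_sec_apply]
    simp only [wedgeSec_update_apply]
    exact (hδ m).wedge_formula (hP m) (b m) (he m) (hPe m) s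
  obtain ⟨Δ, h1, h2⟩ := exists_der_of_ptDer v P hP fun x =>
    ⟨wedgeSec (e x), ∑ j, wedgeSec (update (e x) j (δ (e x j))), hne x,
      Eventually.of_forall fun y => hformula y _⟩
  refine ⟨Δ, h1, fun s => ?_⟩
  ext m
  rw [h2, hformula]

/-- Two derivations of `∧^top V` over the same vector field are equal if they agree on the wedge
products of sections. -/
lemma IsDer.top_ext {v : Sec E E (Tan E (M := M))}
    {Δ Δ' : Sec E ℝ (TopPow F V) →ₗ[ℝ] Sec E ℝ (TopPow F V)} (h : IsDer v Δ) (h' : IsDer v Δ')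
    (hs : ∀ s, Δ (wedgeSec s) = Δ' (wedgeSec s)) : Δ = Δ' :=
  h.line_ext h' fun x => by
    obtain ⟨s, -, -, hs'⟩ := exists_wedgeSec_ne_zero (E := E) (F := F) (V := V) x
    exact ⟨wedgeSec s, hs', by rw [hs]⟩

/-- The derivation of `∧^top V` induced by a derivation of `V`. -/
def topDer {v : Sec E E (Tan E (M := M))} {δ : Sec E F V →ₗ[ℝ] Sec E F V} (hδ : IsDer v δ) :
    Sec E ℝ (TopPow F V) →ₗ[ℝ] Sec E ℝ (TopPow F V) := (exists_topDer hδ).choose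

lemma isDer_topDer {v : Sec E E (Tan E (M := M))} {δ : Sec E F V →ₗ[ℝ] Sec E F V}
    (hδ : IsDer v δ) : IsDer v (topDer hδ) := (exists_topDer hδ).choose_spec.1

lemma topDer_wedgeSec {v : Sec E E (Tan E (M := M))} {δ : Sec E F V →ₗ[ℝ] Sec E F V}
    (hδ : IsDer v δ) (s : Fin (finrank ℝ F) → Sec E F V) :
    topDer hδ (wedgeSec s) = ∑ j, wedgeSec (update s j (δ (s j))) :=
  (exists_topDer hδ).choose_spec.2 s

lemma topDer_wedgeSec_apply {v : Sec E E (Tan E (M := M))} {δ : Sec E F V →ₗ[ℝ] Sec E F V}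
    (hδ : IsDer v δ) (s : Fin (finrank ℝ F) → Sec E F V) (m : M) :
    topDer hδ (wedgeSec s) m = ∑ j, wedge (update (fun l => s l m) j (δ (s j) m)) := by
  rw [topDer_wedgeSec, sum_sec_apply]
  simp only [wedgeSec_update_apply]

/-- The commutator of derivations is a derivation over the Lie bracket of the vector fields. -/
lemma IsDer.commutator {v w : Sec E E (Tan E (M := M))} {δ ε : Sec E F V →ₗ[ℝ] Sec E F V}
    (hδ : IsDer v δ) (hε : IsDer w ε) : IsDer (lieB v w) (δ ∘ₗ ε - ε ∘ₗ δ) := by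
  intro m f s
  have h := congrArg (fun g : Fn E M => g m) (mvfderiv_lieB v w f)
  change derivFn (lieB v w) f m = derivFn v (derivFn w f) m - derivFn w (derivFn v f) m at h
  change δ (ε (LieAlgd.fsmul f s)) m - ε (δ (LieAlgd.fsmul f s)) m =
    f m • (δ (ε s) m - ε (δ s) m) + derivFn (lieB v w) f m • s m
  rw [h, hε.fsmul, hδ.fsmul, map_add, map_add, hδ.fsmul, hδ.fsmul, hε.fsmul, hε.fsmul]
  simp only [ContMDiffSection.coe_add, Pi.add_apply, fsmul_apply]
  module

/-- On wedge products, the commutator of induced derivations is given by the commutators. -/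
lemma topDer_commutator {v w : Sec E E (Tan E (M := M))} {δ ε : Sec E F V →ₗ[ℝ] Sec E F V}
    (hδ : IsDer v δ) (hε : IsDer w ε) :
    topDer hδ ∘ₗ topDer hε - topDer hε ∘ₗ topDer hδ = topDer (hδ.commutator hε) := by
  refine ((isDer_topDer hδ).commutator (isDer_topDer hε)).top_ext (isDer_topDer _) fun s => ?_
  have key : ∀ {v w : Sec E E (Tan E (M := M))} {δ ε : Sec E F V →ₗ[ℝ] Sec E F V}
      (hδ : IsDer v δ) (hε : IsDer w ε), topDer hδ (topDer hε (wedgeSec s)) =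
        ∑ j, ∑ k, if k = j then wedgeSec (update s j (δ (ε (s j)))) else
          wedgeSec (update (update s j (ε (s j))) k (δ (s k))) := by
    intro v w δ ε hδ hε
    rw [topDer_wedgeSec, map_sum]
    refine Finset.sum_congr rfl fun j _ => ?_
    rw [topDer_wedgeSec]
    refine Finset.sum_congr rfl fun k _ => ?_
    by_cases h : k = j
    · subst h; simp
    · simp [h]
  rw [LinearMap.sub_apply, LinearMap.comp_apply, LinearMap.comp_apply, key hδ hε, key hε hδ,
    Finset.sum_comm (f := fun j k => if k = j then wedgeSec (update s j (ε (δ (s j)))) else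
          wedgeSec (update (update s j (δ (s j))) k (ε (s k)))), ← Finset.sum_sub_distrib,
    topDer_wedgeSec]
  refine Finset.sum_congr rfl fun j _ => ?_
  rw [← Finset.sum_sub_distrib, Finset.sum_eq_single j]
  · simp only [if_true]
    exact ((wedgeSecAlt E F V).map_update_sub s j _ _).symm
  · intro k _ hk
    rw [if_neg hk, if_neg (Ne.symm hk), update_comm hk, sub_self]
  · exact fun h => absurd (Finset.mem_univ j) h

end Top

/-! ### Pairings of line bundles -/

section Pairings

variable {E : Type*} [NormedAddCommGroup E] [NormedSpace ℝ E] [FiniteDimensional ℝ E]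
  {M : Type*} [TopologicalSpace M] [ChartedSpace E M] [IsManifold 𝓘(ℝ, E) ∞ M] [T2Space M]
  {L₁ : M → Type*} [∀ m, AddCommGroup (L₁ m)] [∀ m, Module ℝ (L₁ m)]
  [TopologicalSpace (TotalSpace ℝ L₁)] [∀ m, TopologicalSpace (L₁ m)] [FiberBundle ℝ L₁]
  [VectorBundle ℝ ℝ L₁] [ContMDiffVectorBundle ∞ ℝ L₁ 𝓘(ℝ, E)]
  {L₂ : M → Type*} [∀ m, AddCommGroup (L₂ m)] [∀ m, Module ℝ (L₂ m)]
  [TopologicalSpace (TotalSpace ℝ L₂)] [∀ m, TopologicalSpace (L₂ m)] [FiberBundle ℝ L₂]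
  [VectorBundle ℝ ℝ L₂] [ContMDiffVectorBundle ∞ ℝ L₂ 𝓘(ℝ, E)]
  {L₃ : M → Type*} [∀ m, AddCommGroup (L₃ m)] [∀ m, Module ℝ (L₃ m)]
  [TopologicalSpace (TotalSpace ℝ L₃)] [∀ m, TopologicalSpace (L₃ m)] [FiberBundle ℝ L₃]
  [VectorBundle ℝ ℝ L₃] [ContMDiffVectorBundle ∞ ℝ L₃ 𝓘(ℝ, E)]

/-- A smooth nondegenerate bilinear pairing of line bundles `L₁ × L₂ → L₃`, that is, an
isomorphism `L₁ ⊗ L₂ ≅ L₃`. -/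
structure LinePairing (E : Type*) [NormedAddCommGroup E] [NormedSpace ℝ E]
    {M : Type*} [TopologicalSpace M] [ChartedSpace E M]
    (L₁ : M → Type*) [∀ m, AddCommGroup (L₁ m)] [∀ m, Module ℝ (L₁ m)]
    [TopologicalSpace (TotalSpace ℝ L₁)] [∀ m, TopologicalSpace (L₁ m)] [FiberBundle ℝ L₁]
    [VectorBundle ℝ ℝ L₁]
    (L₂ : M → Type*) [∀ m, AddCommGroup (L₂ m)] [∀ m, Module ℝ (L₂ m)]
    [TopologicalSpace (TotalSpace ℝ L₂)] [∀ m, TopologicalSpace (L₂ m)] [FiberBundle ℝ L₂]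
    [VectorBundle ℝ ℝ L₂]
    (L₃ : M → Type*) [∀ m, AddCommGroup (L₃ m)] [∀ m, Module ℝ (L₃ m)]
    [TopologicalSpace (TotalSpace ℝ L₃)] [∀ m, TopologicalSpace (L₃ m)] [FiberBundle ℝ L₃]
    [VectorBundle ℝ ℝ L₃] where
  /-- The pairing of the fibres. -/
  J : ∀ m, L₁ m →ₗ[ℝ] L₂ m →ₗ[ℝ] L₃ m
  nondeg : ∀ m v w, v ≠ 0 → w ≠ 0 → J m v w ≠ 0
  /-- The pairing of sections. -/
  B : Sec E ℝ L₁ → Sec E ℝ L₂ → Sec E ℝ L₃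
  B_apply : ∀ s t m, B s t m = J m (s m) (t m)

lemma eq_zero_of_tensorial_line {N : Type*} [AddCommGroup N] [Module ℝ N] {m : M}
    (T : Sec E ℝ L₁ →+ N) (hT : ∀ (f : Fn E M) s, T (fsmul f s) = f m • T s) {τ : Sec E ℝ L₁}
    (hτ : τ m ≠ 0) (h : T τ = 0) (s : Sec E ℝ L₁) : T s = 0 := by
  obtain ⟨c, hc⟩ := exists_smul_of_line hτ (s m)
  have h1 : T s = T (fsmul (ContMDiffMap.const c) τ) := eq_of_tensorial T hT hc
  rw [h1, hT, h, smul_zero]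

/-- A fibrewise pairing of line bundles is smooth if it is smooth on local frames. -/
def LinePairing.ofFrames (J : ∀ m, L₁ m →ₗ[ℝ] L₂ m →ₗ[ℝ] L₃ m)
    (hJ : ∀ m v w, v ≠ 0 → w ≠ 0 → J m v w ≠ 0)
    (h : ∀ x, ∃ (τ₁ : Sec E ℝ L₁) (τ₂ : Sec E ℝ L₂) (t : Sec E ℝ L₃), τ₁ x ≠ 0 ∧ τ₂ x ≠ 0 ∧
      ∀ y, J y (τ₁ y) (τ₂ y) = t y) : LinePairing E L₁ L₂ L₃ where
  J := J
  nondeg := hJ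
  B s₁ s₂ := ⟨fun y => J y (s₁ y) (s₂ y), by
    intro x
    obtain ⟨τ₁, τ₂, t, hτ₁, hτ₂, ht⟩ := h x
    obtain ⟨U, hU, hxU, κ, -, -, hκ⟩ := exists_lineCoeff hτ₁
    obtain ⟨U', hU', hxU', κ', -, -, hκ'⟩ := exists_lineCoeff hτ₂
    refine ((fsmul (κ s₁ * κ' s₂) t).contMDiff x).congr_of_eventuallyEq ?_
    filter_upwards [hU.mem_nhds hxU, hU'.mem_nhds hxU'] with y hy hy'
    refine congrArg (TotalSpace.mk' ℝ y) ?_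
    rw [(hκ y hy).2 s₁, (hκ' y hy').2 s₂, map_smul, map_smul, LinearMap.smul_apply, ht,
      smul_smul, mul_comm]
    rfl⟩
  B_apply _ _ _ := rfl

namespace LinePairing

variable (p : LinePairing E L₁ L₂ L₃)

lemma B_add_left (s s' : Sec E ℝ L₁) (t : Sec E ℝ L₂) : p.B (s + s') t = p.B s t + p.B s' t := by
  ext m; simp [p.B_apply]

lemma B_add_right (s : Sec E ℝ L₁) (t t' : Sec E ℝ L₂) : p.B s (t + t') = p.B s t + p.B s t' := by
  ext m; simp [p.B_apply]

lemma B_sub_left (s s' : Sec E ℝ L₁) (t : Sec E ℝ L₂) : p.B (s - s') t = p.B s t - p.B s' t := by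
  ext m; simp [p.B_apply]

lemma B_sub_right (s : Sec E ℝ L₁) (t t' : Sec E ℝ L₂) : p.B s (t - t') = p.B s t - p.B s t' := by
  ext m; simp [p.B_apply]

lemma B_fsmul_left (f : Fn E M) (s : Sec E ℝ L₁) (t : Sec E ℝ L₂) :
    p.B (fsmul f s) t = fsmul f (p.B s t) := by
  ext m; simp [p.B_apply]

lemma B_fsmul_right (f : Fn E M) (s : Sec E ℝ L₁) (t : Sec E ℝ L₂) :
    p.B s (fsmul f t) = fsmul f (p.B s t) := by
  ext m; simp [p.B_apply]

/-- Derivations of `L₁`, `L₂`, `L₃` at a point that satisfy the Leibniz rule for the pairing of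
two frames satisfy it for all sections. -/
lemma leibniz_of_frame {m : M} {v : Tan E m} {P₁ : Sec E ℝ L₁ →ₗ[ℝ] L₁ m}
    {P₂ : Sec E ℝ L₂ →ₗ[ℝ] L₂ m} {P₃ : Sec E ℝ L₃ →ₗ[ℝ] L₃ m} (h₁ : IsPtDer v P₁)
    (h₂ : IsPtDer v P₂) (h₃ : IsPtDer v P₃) {τ₁ : Sec E ℝ L₁} {τ₂ : Sec E ℝ L₂}
    (hτ₁ : τ₁ m ≠ 0) (hτ₂ : τ₂ m ≠ 0)
    (h : P₃ (p.B τ₁ τ₂) = p.J m (P₁ τ₁) (τ₂ m) + p.J m (τ₁ m) (P₂ τ₂))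
    (s : Sec E ℝ L₁) (t : Sec E ℝ L₂) :
    P₃ (p.B s t) = p.J m (P₁ s) (t m) + p.J m (s m) (P₂ t) := by
  have key₁ : P₃ (p.B s τ₂) = p.J m (P₁ s) (τ₂ m) + p.J m (s m) (P₂ τ₂) := by
    let T : Sec E ℝ L₁ →+ L₃ m := AddMonoidHom.mk'
      (fun s => P₃ (p.B s τ₂) - (p.J m (P₁ s) (τ₂ m) + p.J m (s m) (P₂ τ₂)))
      (fun s s' => by
        simp only [B_add_left, map_add, ContMDiffSection.coe_add, Pi.add_apply,
          LinearMap.add_apply]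
        abel)
    refine sub_eq_zero.1 (eq_zero_of_tensorial_line T (fun f s => ?_) hτ₁ (sub_eq_zero.2 h) s)
    change P₃ (p.B (fsmul f s) τ₂) - (p.J m (P₁ (fsmul f s)) (τ₂ m) +
      p.J m (fsmul f s m) (P₂ τ₂)) =
      f m • (P₃ (p.B s τ₂) - (p.J m (P₁ s) (τ₂ m) + p.J m (s m) (P₂ τ₂)))
    rw [B_fsmul_left, h₃, h₁, p.B_apply, fsmul_apply]
    simp only [map_add, map_smul, LinearMap.add_apply, LinearMap.smul_apply]
    module
  let T : Sec E ℝ L₂ →+ L₃ m := AddMonoidHom.mk'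
    (fun t => P₃ (p.B s t) - (p.J m (P₁ s) (t m) + p.J m (s m) (P₂ t)))
    (fun t t' => by
      simp only [B_add_right, map_add, ContMDiffSection.coe_add, Pi.add_apply]
      abel)
  refine sub_eq_zero.1 (eq_zero_of_tensorial_line T (fun f t => ?_) hτ₂ (sub_eq_zero.2 key₁) t)
  change P₃ (p.B s (fsmul f t)) - (p.J m (P₁ s) (fsmul f t m) +
    p.J m (s m) (P₂ (fsmul f t))) =
    f m • (P₃ (p.B s t) - (p.J m (P₁ s) (t m) + p.J m (s m) (P₂ t)))
  rw [B_fsmul_right, h₃, h₂, p.B_apply, fsmul_apply]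
  simp only [map_add, map_smul]
  module

lemma B_ne_zero {s : Sec E ℝ L₁} {t : Sec E ℝ L₂} {m : M} (hs : s m ≠ 0) (ht : t m ≠ 0) :
    p.B s t m ≠ 0 := by
  rw [p.B_apply]; exact p.nondeg m _ _ hs ht

/-- Two derivations of `L₃` that agree on the pairings of sections are equal. -/
lemma der_ext {v : Sec E E (Tan E (M := M))} {Δ Δ' : Sec E ℝ L₃ →ₗ[ℝ] Sec E ℝ L₃}
    (h : IsDer v Δ) (h' : IsDer v Δ')
    (hs : ∀ m, ∃ s t, s m ≠ 0 ∧ t m ≠ 0 ∧ Δ (p.B s t) m = Δ' (p.B s t) m) : Δ = Δ' :=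
  h.line_ext h' fun x => by
    obtain ⟨s, t, h1, h2, h3⟩ := hs x
    exact ⟨p.B s t, p.B_ne_zero h1 h2, h3⟩

/-- Derivations of `L₁` and `L₂` induce a derivation of `L₃ ≅ L₁ ⊗ L₂`. -/
lemma exists_der {v : Sec E E (Tan E (M := M))} {δ₁ : Sec E ℝ L₁ →ₗ[ℝ] Sec E ℝ L₁}
    {δ₂ : Sec E ℝ L₂ →ₗ[ℝ] Sec E ℝ L₂} (h₁ : IsDer v δ₁) (h₂ : IsDer v δ₂) :
    ∃ Δ : Sec E ℝ L₃ →ₗ[ℝ] Sec E ℝ L₃, IsDer v Δ ∧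
      ∀ s t, Δ (p.B s t) = p.B (δ₁ s) t + p.B s (δ₂ t) := by
  choose τ₁ hτ₁ using exists_sec_ne_zero (E := E) L₁
  choose τ₂ hτ₂ using exists_sec_ne_zero (E := E) L₂
  choose P hP hPτ using fun m => exists_ptDer_line (v m) (p.B_ne_zero (hτ₁ m) (hτ₂ m))
    (p.B (δ₁ (τ₁ m)) (τ₂ m) m + p.B (τ₁ m) (δ₂ (τ₂ m)) m)
  have hf : ∀ m s t, P m (p.B s t) = (p.B (δ₁ s) t + p.B s (δ₂ t)) m := by
    intro m s t
    rw [p.leibniz_of_frame (h₁ m) (h₂ m) (hP m) (hτ₁ m) (hτ₂ m)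
      (by rw [hPτ, p.B_apply, p.B_apply]; rfl)]
    rw [ContMDiffSection.coe_add, Pi.add_apply, p.B_apply, p.B_apply]
    rfl
  obtain ⟨Δ, hΔ, hΔP⟩ := exists_der_of_ptDer v P hP fun x =>
    ⟨p.B (τ₁ x) (τ₂ x), _, p.B_ne_zero (hτ₁ x) (hτ₂ x), Eventually.of_forall fun y => hf y _ _⟩
  exact ⟨Δ, hΔ, fun s t => by ext m; rw [hΔP, hf]⟩

end LinePairing

lemma tmul_ne_zero {m : M} {v : L₁ m} {w : L₂ m} (hv : v ≠ 0) (hw : w ≠ 0) :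
    (tmul v w : LineTensor L₁ L₂ m) ≠ 0 := by
  obtain ⟨f, hf⟩ := Projective.exists_dual_ne_zero ℝ hv
  obtain ⟨g, hg⟩ := Projective.exists_dual_ne_zero ℝ hw
  intro h
  have h1 := congrArg (LinearMap.mul' ℝ ℝ ∘ₗ TensorProduct.map f g :
    L₁ m ⊗[ℝ] L₂ m →ₗ[ℝ] ℝ) h
  have h2 : f v * g w = 0 := h1.trans (map_zero _)
  exact mul_ne_zero hf hg h2

/-- The canonical pairing `L₁ × L₂ → L₁ ⊗ L₂`. -/
def tensorPairing (E : Type*) [NormedAddCommGroup E] [NormedSpace ℝ E] [FiniteDimensional ℝ E]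
    {M : Type*} [TopologicalSpace M] [ChartedSpace E M] [IsManifold 𝓘(ℝ, E) ∞ M] [T2Space M]
    (L₁ : M → Type*) [∀ m, AddCommGroup (L₁ m)] [∀ m, Module ℝ (L₁ m)]
    [TopologicalSpace (TotalSpace ℝ L₁)] [∀ m, TopologicalSpace (L₁ m)] [FiberBundle ℝ L₁]
    [VectorBundle ℝ ℝ L₁]
    (L₂ : M → Type*) [∀ m, AddCommGroup (L₂ m)] [∀ m, Module ℝ (L₂ m)]
    [TopologicalSpace (TotalSpace ℝ L₂)] [∀ m, TopologicalSpace (L₂ m)] [FiberBundle ℝ L₂]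
    [VectorBundle ℝ ℝ L₂] :
    LinePairing E L₁ L₂ (LineTensor L₁ L₂) where
  J m := TensorProduct.mk ℝ (L₁ m) (L₂ m)
  nondeg _ _ _ hv hw := tmul_ne_zero hv hw
  B s t := tensorSec s t
  B_apply _ _ _ := rfl

lemma tensorPairing_B (s : Sec E ℝ L₁) (t : Sec E ℝ L₂) :
    (tensorPairing E L₁ L₂).B s t = tensorSec s t := rfl

lemma exists_eq_tmul_smul {m : M} {v : L₁ m} {w : L₂ m} (hv : v ≠ 0) (hw : w ≠ 0)
    (z : LineTensor L₁ L₂ m) : ∃ c : ℝ, z = c • tmul v w :=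
  exists_smul_of_line (tmul_ne_zero hv hw) z

/-- The pairing `(v ⊗ v', w ⊗ w') ↦ J(v, w) ⊗ J(v', w')`. -/
def squareMap {m : M} (J : L₁ m →ₗ[ℝ] L₂ m →ₗ[ℝ] L₃ m) :
    LineTensor L₁ L₁ m →ₗ[ℝ] LineTensor L₂ L₂ m →ₗ[ℝ] LineTensor L₃ L₃ m :=
  TensorProduct.map₂ J J

/-- A pairing `L₁ × L₂ → L₃` induces a pairing of the squares of these line bundles. -/
def LinePairing.square (p : LinePairing E L₁ L₂ L₃) :
    LinePairing E (LineTensor L₁ L₁) (LineTensor L₂ L₂) (LineTensor L₃ L₃) :=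
  LinePairing.ofFrames (fun m => squareMap (p.J m))
    (fun m z z' hz hz' => by
      obtain ⟨τ₁, hτ₁⟩ := exists_sec_ne_zero (E := E) L₁ m
      obtain ⟨τ₂, hτ₂⟩ := exists_sec_ne_zero (E := E) L₂ m
      obtain ⟨c, rfl⟩ := exists_eq_tmul_smul hτ₁ hτ₁ z
      obtain ⟨d, rfl⟩ := exists_eq_tmul_smul hτ₂ hτ₂ z'
      rw [map_smul, map_smul, LinearMap.smul_apply]
      refine smul_ne_zero (left_ne_zero_of_smul hz') (smul_ne_zero (left_ne_zero_of_smul hz) ?_)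
      exact tmul_ne_zero (p.nondeg m _ _ hτ₁ hτ₂) (p.nondeg m _ _ hτ₁ hτ₂))
    (fun x => by
      obtain ⟨τ₁, hτ₁⟩ := exists_sec_ne_zero (E := E) L₁ x
      obtain ⟨τ₂, hτ₂⟩ := exists_sec_ne_zero (E := E) L₂ x
      refine ⟨tensorSec τ₁ τ₁, tensorSec τ₂ τ₂, tensorSec (p.B τ₁ τ₂) (p.B τ₁ τ₂),
        tmul_ne_zero hτ₁ hτ₁, tmul_ne_zero hτ₂ hτ₂, fun y => ?_⟩
      change _ = tmul (p.B τ₁ τ₂ y) (p.B τ₁ τ₂ y)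
      rw [p.B_apply]
      rfl)

lemma LinePairing.square_B (p : LinePairing E L₁ L₂ L₃) (s s' : Sec E ℝ L₁) (t t' : Sec E ℝ L₂) :
    p.square.B (tensorSec s s') (tensorSec t t') = tensorSec (p.B s t) (p.B s' t') := by
  ext m
  rw [p.square.B_apply]
  change _ = tmul (p.B s t m) (p.B s' t' m)
  rw [p.B_apply, p.B_apply]
  rfl

/-- The square of a line bundle is orientable: the elements `v ⊗ v` with `v ≠ 0` form a convex set in
each fibre, so local sections with values in these sets can be glued. -/
lemma exists_nowhereZero_square [SigmaCompactSpace M] (L : M → Type*)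
    [∀ m, AddCommGroup (L m)] [∀ m, Module ℝ (L m)]
    [TopologicalSpace (TotalSpace ℝ L)] [∀ m, TopologicalSpace (L m)] [FiberBundle ℝ L]
    [VectorBundle ℝ ℝ L] [ContMDiffVectorBundle ∞ ℝ L 𝓘(ℝ, E)] :
    ∃ y : Sec E ℝ (LineTensor L L), NowhereZero y := by
  obtain ⟨y, hy⟩ := exists_contMDiffSection_forall_mem_convex_of_local (I := 𝓘(ℝ, E))
    (n := (⊤ : ℕ∞)) (F_fiber := ℝ) (V := LineTensor L L) (t := fun m => {z | ∃ v : L m, v ≠ 0 ∧ z = tmul v v})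
    (fun m => by
      rintro _ ⟨v, hv, rfl⟩ _ ⟨w, hw, rfl⟩ a b ha hb hab
      obtain ⟨c, rfl⟩ := exists_smul_of_line hv w
      have hc : c ≠ 0 := left_ne_zero_of_smul hw
      have hpos : 0 < a + b * c ^ 2 := by
        rcases ha.eq_or_lt with rfl | ha
        · have : b = 1 := by linarith
          subst this; positivity
        · positivity
      refine ⟨√(a + b * c ^ 2) • v, smul_ne_zero (Real.sqrt_pos.2 hpos).ne' hv, ?_⟩
      have h1 : ∀ r : ℝ, (tmul (r • v) (r • v) : LineTensor L L m) = r ^ 2 • tmul v v := fun r => by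
        refine (TensorProduct.smul_tmul_smul _ _ _ _).trans ?_
        rw [sq]; rfl
      rw [h1, h1, Real.sq_sqrt hpos.le]
      module)
    (fun x => by
      obtain ⟨τ, hτ⟩ := exists_sec_ne_zero (E := E) L x
      obtain ⟨U, hU, hx, κ, -, -, hκ⟩ := exists_lineCoeff hτ
      exact ⟨U, hU.mem_nhds hx, tensorSec τ τ, (tensorSec τ τ).contMDiff.contMDiffOn,
        fun y hy => ⟨τ y, (hκ y hy).1, rfl⟩⟩)
  refine ⟨y, fun m => ?_⟩
  obtain ⟨v, hv, h⟩ := hy m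
  rw [h]
  exact tmul_ne_zero hv hv

end Pairings

/-! ### Representations on line bundles and their characteristic classes -/

section Reps

variable {E : Type*} [NormedAddCommGroup E] [NormedSpace ℝ E] [FiniteDimensional ℝ E]
  {M : Type*} [TopologicalSpace M] [ChartedSpace E M] [IsManifold 𝓘(ℝ, E) ∞ M] [T2Space M]
  {F : Type*} [NormedAddCommGroup F] [NormedSpace ℝ F] [FiniteDimensional ℝ F]
  {A : M → Type*}
  [∀ m, AddCommGroup (A m)] [∀ m, Module ℝ (A m)]
  [TopologicalSpace (TotalSpace F A)] [∀ m, TopologicalSpace (A m)] [FiberBundle F A]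
  [VectorBundle ℝ F A] [ContMDiffVectorBundle ∞ F A 𝓘(ℝ, E)]
  {LA : LieAlgebroid E F A}
  {L : M → Type*} [∀ m, AddCommGroup (L m)] [∀ m, Module ℝ (L m)]
  [TopologicalSpace (TotalSpace ℝ L)] [∀ m, TopologicalSpace (L m)] [FiberBundle ℝ L]
  [VectorBundle ℝ ℝ L] [ContMDiffVectorBundle ∞ ℝ L 𝓘(ℝ, E)]

lemma app_apply {F₂ : Type*} [NormedAddCommGroup F₂] [NormedSpace ℝ F₂] {V₂ : M → Type*}
    [∀ m, AddCommGroup (V₂ m)] [∀ m, Module ℝ (V₂ m)]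
    [TopologicalSpace (TotalSpace F₂ V₂)] [∀ m, TopologicalSpace (V₂ m)] [FiberBundle F₂ V₂]
    [VectorBundle ℝ F₂ V₂] [∀ m, IsTopologicalAddGroup (V₂ m)] [∀ m, ContinuousSMul ℝ (V₂ m)]
    (φ : BundleMap E F A F₂ V₂) (s : Sec E F A) (m : M) : φ.app s m = φ m (s m) := rfl

lemma app_add {F₂ : Type*} [NormedAddCommGroup F₂] [NormedSpace ℝ F₂] {V₂ : M → Type*}
    [∀ m, AddCommGroup (V₂ m)] [∀ m, Module ℝ (V₂ m)]
    [TopologicalSpace (TotalSpace F₂ V₂)] [∀ m, TopologicalSpace (V₂ m)] [FiberBundle F₂ V₂]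
    [VectorBundle ℝ F₂ V₂] [∀ m, IsTopologicalAddGroup (V₂ m)] [∀ m, ContinuousSMul ℝ (V₂ m)]
    (φ : BundleMap E F A F₂ V₂) (s t : Sec E F A) : φ.app (s + t) = φ.app s + φ.app t := by
  ext m; exact map_add (φ m) _ _

lemma app_fsmul {F₂ : Type*} [NormedAddCommGroup F₂] [NormedSpace ℝ F₂] {V₂ : M → Type*}
    [∀ m, AddCommGroup (V₂ m)] [∀ m, Module ℝ (V₂ m)]
    [TopologicalSpace (TotalSpace F₂ V₂)] [∀ m, TopologicalSpace (V₂ m)] [FiberBundle F₂ V₂]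
    [VectorBundle ℝ F₂ V₂] [∀ m, IsTopologicalAddGroup (V₂ m)] [∀ m, ContinuousSMul ℝ (V₂ m)]
    (φ : BundleMap E F A F₂ V₂) (f : Fn E M) (s : Sec E F A) :
    φ.app (fsmul f s) = fsmul f (φ.app s) := by
  ext m; exact map_smul (φ m) _ _

lemma anchor_app_bracket (LA : LieAlgebroid E F A) (a b : Sec E F A) :
    LA.anchor.app (LA.bracket a b) = lieB (LA.anchor.app a) (LA.anchor.app b) := by
  ext m; exact LA.anchor_bracket a b m

lemma deriv_eq (LA : LieAlgebroid E F A) (a : Sec E F A) (f : Fn E M) (m : M) :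
    LA.deriv a f m = derivFn (LA.anchor.app a) f m := rfl

lemma isDer_bracket (LA : LieAlgebroid E F A) (a : Sec E F A) :
    IsDer (LA.anchor.app a) (LA.bracket a) := fun m f s => LA.leibniz a s f m

lemma bracket_swap (LA : LieAlgebroid E F A) (a b : Sec E F A) :
    LA.bracket a b = -LA.bracket b a := by
  have := LA.bracket_self (a + b)
  simp only [map_add, LinearMap.add_apply, LA.bracket_self, zero_add, add_zero] at this
  exact eq_neg_of_add_eq_zero_right this

lemma bracket_fsmul_left (LA : LieAlgebroid E F A) (f : Fn E M) (a b : Sec E F A) :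
    LA.bracket (fsmul f a) b =
      fsmul f (LA.bracket a b) - fsmul (derivFn (LA.anchor.app b) f) a := by
  rw [bracket_swap, (isDer_bracket LA b).fsmul, bracket_swap LA a b]
  ext m
  change -(f m • LA.bracket b a m + derivFn (LA.anchor.app b) f m • a m) =
    f m • -LA.bracket b a m - derivFn (LA.anchor.app b) f m • a m
  module

lemma LieAlgebroid.Rep.isDer {G : Type*} [NormedAddCommGroup G] [NormedSpace ℝ G] {W : M → Type*}
    [∀ m, AddCommGroup (W m)] [∀ m, Module ℝ (W m)]
    [TopologicalSpace (TotalSpace G W)] [∀ m, TopologicalSpace (W m)] [FiberBundle G W]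
    [VectorBundle ℝ G W] (D : LA.Rep G W) (a : Sec E F A) : IsDer (LA.anchor.app a) (D.D a) :=
  fun m f s => D.leibniz f a s m

lemma LieAlgebroid.Rep.ext {G : Type*} [NormedAddCommGroup G] [NormedSpace ℝ G] {W : M → Type*}
    [∀ m, AddCommGroup (W m)] [∀ m, Module ℝ (W m)]
    [TopologicalSpace (TotalSpace G W)] [∀ m, TopologicalSpace (W m)] [FiberBundle G W]
    [VectorBundle ℝ G W] {D D' : LA.Rep G W} (h : ∀ a, D.D a = D'.D a) : D = D' := by
  obtain ⟨D, _, _, _⟩ := D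
  obtain ⟨D', _, _, _⟩ := D'
  obtain rfl : D = D' := LinearMap.ext h
  rfl

/-- The operator of multiplication by a smooth function. -/
def fsmulHom (f : Fn E M) : Sec E F A →ₗ[ℝ] Sec E F A where
  toFun := fsmul f
  map_add' := fsmul_add f
  map_smul' c s := fsmul_smul c f s

lemma IsDer.add {v w : Sec E E (Tan E (M := M))} {δ ε : Sec E F A →ₗ[ℝ] Sec E F A}
    (hδ : IsDer v δ) (hε : IsDer w ε) : IsDer (v + w) (δ + ε) := fun m f s => by
  change δ (LieAlgd.fsmul f s) m + ε (LieAlgd.fsmul f s) m = f m • (δ s m + ε s m) +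
    mvfderiv 𝓘(ℝ, E) f m (v m + w m) • s m
  rw [hδ.apply, hε.apply, map_add]
  module

lemma IsDer.fsmulHom_comp {v : Sec E E (Tan E (M := M))} {δ : Sec E F A →ₗ[ℝ] Sec E F A}
    (hδ : IsDer v δ) (g : Fn E M) : IsDer (LieAlgd.fsmul g v) (fsmulHom g ∘ₗ δ) := fun m f s => by
  change g m • δ (LieAlgd.fsmul f s) m = f m • (g m • δ s m) +
    mvfderiv 𝓘(ℝ, E) f m (g m • v m) • s m
  rw [hδ.apply, map_smul, smul_eq_mul]
  module

/-- A family of derivations of a line bundle is a representation if the three laws hold on sections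
without common zeros: both sides of each law are derivations over the same vector field. -/
lemma exists_rep_of_generators (D : Sec E F A → Sec E ℝ L →ₗ[ℝ] Sec E ℝ L)
    (hD : ∀ a, IsDer (LA.anchor.app a) (D a)) (S : Set (Sec E ℝ L))
    (hS : ∀ m, ∃ x ∈ S, x m ≠ 0)
    (hadd : ∀ a b, ∀ x ∈ S, D (a + b) x = D a x + D b x)
    (hsmul : ∀ f a, ∀ x ∈ S, D (fsmul f a) x = fsmul f (D a x))
    (hflat : ∀ a b, ∀ x ∈ S, D a (D b x) - D b (D a x) = D (LA.bracket a b) x) :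
    ∃ R : LA.Rep ℝ L, ∀ a, R.D a = D a := by
  have key : ∀ {v} {δ ε : Sec E ℝ L →ₗ[ℝ] Sec E ℝ L}, IsDer v δ → IsDer v ε →
      (∀ x ∈ S, δ x = ε x) → δ = ε := fun hδ hε h => hδ.line_ext hε fun m => by
    obtain ⟨x, hx, hxm⟩ := hS m
    exact ⟨x, hxm, by rw [h x hx]⟩
  have hf : ∀ (f : Fn E M) a, D (fsmul f a) = fsmulHom f ∘ₗ D a := fun f a =>
    key (hD _) (by rw [app_fsmul]; exact (hD a).fsmulHom_comp f) (hsmul f a)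
  refine ⟨{
    D :=
    { toFun := D
      map_add' := fun a b => key (hD _) (by
        rw [app_add]; exact (hD a).add (hD b)) (hadd a b)
      map_smul' := fun c a => hf (ContMDiffMap.const c) a }
    smul_left := fun f a x => LinearMap.congr_fun (hf f a) x
    leibniz := fun f a x m => hD a m f x
    flat := fun a b x => LinearMap.congr_fun (key ((hD a).commutator (hD b)) (by
      rw [← anchor_app_bracket]; exact hD _) (hflat a b)) x }, fun _ => rfl⟩

/-- The tensor square of a representation on a line bundle exists. -/
lemma exists_isTensor (D : LA.Rep ℝ L) : ∃ D₂, IsTensor D D D₂ := by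
  choose Δ hΔ hΔt using fun a => (tensorPairing E L L).exists_der (D.isDer a) (D.isDer a)
  obtain ⟨R, hR⟩ := exists_rep_of_generators Δ hΔ {x | ∃ s t, x = (tensorPairing E L L).B s t}
    (fun m => by
      obtain ⟨s, hs⟩ := exists_sec_ne_zero (E := E) L m
      exact ⟨_, ⟨s, s, rfl⟩, tmul_ne_zero hs hs⟩)
    (by
      rintro a b _ ⟨s, t, rfl⟩
      simp only [hΔt, map_add, LinearMap.add_apply, LinePairing.B_add_left, LinePairing.B_add_right]
      abel)
    (by
      rintro f a _ ⟨s, t, rfl⟩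
      simp only [hΔt, D.smul_left, LinePairing.B_fsmul_left, LinePairing.B_fsmul_right, fsmul_add])
    (by
      rintro a b _ ⟨s, t, rfl⟩
      simp only [hΔt, map_add, ← D.flat, LinePairing.B_sub_left, LinePairing.B_sub_right]
      abel)
  exact ⟨R, fun a x y => by rw [hR]; exact hΔt a x y⟩

/-- The tensor square of a representation is unique. -/
lemma LieAlgebroid.IsTensor.unique {D : LA.Rep ℝ L} {D₂ D₂' : LA.Rep ℝ (LineTensor L L)}
    (h : IsTensor D D D₂) (h' : IsTensor D D D₂') : D₂ = D₂' :=
  LieAlgebroid.Rep.ext fun a => (tensorPairing E L L).der_ext (D₂.isDer a) (D₂'.isDer a) fun m => by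
    obtain ⟨s, hs⟩ := exists_sec_ne_zero (E := E) L m
    exact ⟨s, s, hs, hs, by rw [tensorPairing_B, h, h']⟩

/-! #### Characteristic classes -/

/-- A nowhere-vanishing section of a line bundle is a global frame. -/
lemma exists_globalCoeff {x : Sec E ℝ L} (hx : NowhereZero x) :
    ∃ κ : Sec E ℝ L → Fn E M, ∀ s m, s m = κ s m • x m := by
  choose c hc using fun (s : Sec E ℝ L) m => exists_smul_of_line (hx m) (s m)
  refine ⟨fun s => ⟨c s, fun m => ?_⟩, hc⟩
  obtain ⟨U, hU, hmU, κ, -, -, hκ⟩ := exists_lineCoeff (hx m)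
  refine (κ s).contMDiff.contMDiffAt.congr_of_eventuallyEq ?_
  filter_upwards [hU.mem_nhds hmU] with y hy
  exact smul_left_injective ℝ (hx y) ((hc s y).symm.trans ((hκ y hy).2 s))

lemma eq_of_smul_eq {x : Sec E ℝ L} (hx : NowhereZero x) {f g : Fn E M}
    (h : ∀ m, f m • x m = g m • x m) : f = g := by
  ext m
  exact smul_left_injective ℝ (hx m) (h m)

/-- A representation on an oriented line bundle has a characteristic cocycle; the cocycle condition
is the flatness of the representation. -/
lemma exists_isCharCocycle (D : LA.Rep ℝ L) {x : Sec E ℝ L} (hx : NowhereZero x) :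
    ∃ α, IsCharCocycle D x α := by
  obtain ⟨κ, hκ⟩ := exists_globalCoeff hx
  obtain ⟨α, hα⟩ := exists_dualSec (AddMonoidHom.mk' (fun a => κ (D.D a x)) fun a b => by
      refine eq_of_smul_eq hx fun m => ?_
      rw [← hκ, map_add]
      change D.D a x m + D.D b x m = (κ (D.D a x) m + κ (D.D b x) m) • x m
      rw [add_smul, ← hκ, ← hκ]) fun f a => by
      refine eq_of_smul_eq hx fun m => ?_
      change κ (D.D (fsmul f a) x) m • x m = (f m * κ (D.D a x) m) • x m
      rw [← hκ, D.smul_left, mul_smul, ← hκ]; rfl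
  have hα' : ∀ a m, pair α a m = κ (D.D a x) m := hα
  have hp : ∀ a, pair α a = κ (D.D a x) := fun a => funext (hα' a)
  have hD : ∀ a, D.D a x = fsmul (κ (D.D a x)) x := fun a => by ext m; exact hκ _ m
  refine ⟨⟨α, fun a b m => ?_⟩, fun a m => by rw [hα', ← hκ]⟩
  have h1 := congrArg (fun s : Sec E ℝ L => s m) (D.flat a b x)
  change D.D a (D.D b x) m - D.D b (D.D a x) m = D.D (LA.bracket a b) x m at h1
  rw [hD b, hD a, D.leibniz, D.leibniz, hκ (D.D a x), hκ (D.D b x), hκ (D.D (LA.bracket a b) x)] at h1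
  rw [hp, hp, hp]
  have h2 : (LA.deriv a (κ (D.D b x)) m - LA.deriv b (κ (D.D a x)) m -
      κ (D.D (LA.bracket a b) x) m) • x m = 0 := by
    linear_combination (norm := module) h1
  exact (smul_eq_zero.1 h2).resolve_right (hx m)

/-- Characteristic cocycles with respect to two nowhere-vanishing sections `x` and `f x` differ by
the exact cocycle of `log |f|`. -/
lemma LieAlgebroid.IsCharCocycle.mkQ_eq {D : LA.Rep ℝ L} {x x' : Sec E ℝ L} (hx : NowhereZero x)
    (hx' : NowhereZero x') {α α' : LA.cocycles} (h : IsCharCocycle D x α)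
    (h' : IsCharCocycle D x' α') : LA.coboundaries.mkQ α = LA.coboundaries.mkQ α' := by
  obtain ⟨κ, hκ⟩ := exists_globalCoeff hx
  set f := κ x' with hf
  have hfx : x' = fsmul f x := by ext m; exact hκ x' m
  have hf0 : ∀ m, f m ≠ 0 := fun m h0 => hx' m (by rw [hκ x', ← hf, h0, zero_smul])
  have hd : ∀ a m, LA.deriv a f m = f m * (pair α'.1 a m - pair α.1 a m) := by
    intro a m
    have h1 := h' a m
    rw [hfx, D.leibniz, h a m, fsmul_apply] at h1
    have h2 : (LA.deriv a f m - f m * (pair α'.1 a m - pair α.1 a m)) • x m = 0 := by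
      linear_combination (norm := module) h1
    exact sub_eq_zero.1 ((smul_eq_zero.1 h2).resolve_right (hx m))
  have hlog : ∀ m, ContMDiffAt 𝓘(ℝ, ℝ) 𝓘(ℝ, ℝ) ∞ Real.log (f m) := fun m =>
    (Real.contDiffAt_log.2 (hf0 m)).contMDiffAt
  let g : Fn E M := ⟨fun m => Real.log (f m), fun m => (hlog m).comp m f.contMDiff.contMDiffAt⟩
  have hq : α' - α ∈ LA.coboundaries := ⟨g, fun a m => by
    have h3 : LA.deriv a g m = (f m)⁻¹ * LA.deriv a f m := by
      change mvfderiv 𝓘(ℝ, E) (Real.log ∘ f) m (LA.anchor m (a m)) = _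
      rw [mvfderiv_comp_apply m ((hlog m).mdifferentiableAt (by simp)) (f.mdifferentiableAt m)]
      change mfderiv 𝓘(ℝ, ℝ) 𝓘(ℝ, ℝ) Real.log (f m) _ = _
      rw [mfderiv_eq_fderiv, (Real.hasDerivAt_log (hf0 m)).hasFDerivAt.fderiv]
      exact mul_comm (_ : ℝ) (_ : ℝ)
    rw [h3, hd, inv_mul_cancel_left₀ (hf0 m)]
    rfl⟩
  exact ((Submodule.Quotient.eq _).2 hq).symm

/-- The characteristic class of a representation on a line bundle is well defined. -/
lemma existsUnique_isCharClass [SigmaCompactSpace M] (D : LA.Rep ℝ L) :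
    ∃! c, IsCharClass D c := by
  by_cases hL : ∃ x : Sec E ℝ L, NowhereZero x
  · obtain ⟨x, hx⟩ := hL
    obtain ⟨α, hα⟩ := exists_isCharCocycle D hx
    refine ⟨_, Or.inl ⟨x, hx, α, hα, rfl⟩, ?_⟩
    rintro c (⟨x', hx', α', hα', rfl⟩ | ⟨hL, -⟩)
    · exact hα'.mkQ_eq hx' hx hα
    · exact absurd ⟨x, hx⟩ hL
  · obtain ⟨D₂, hD₂⟩ := exists_isTensor D
    obtain ⟨y, hy⟩ := exists_nowhereZero_square (E := E) L
    obtain ⟨β, hβ⟩ := exists_isCharCocycle D₂ hy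
    refine ⟨_, Or.inr ⟨hL, D₂, hD₂, y, hy, β, hβ, rfl⟩, ?_⟩
    rintro c (⟨x, hx, -⟩ | ⟨-, D₂', hD₂', y', hy', β', hβ', rfl⟩)
    · exact absurd ⟨x, hx⟩ hL
    · obtain rfl := hD₂'.unique hD₂
      rw [hβ'.mkQ_eq hy' hy hβ]

/-- In the orientable and in the nonorientable case alike, the characteristic class is one half of
that of the tensor square. -/
lemma LieAlgebroid.IsCharClass.exists_square {D : LA.Rep ℝ L} {c : LA.H1} (h : IsCharClass D c) :
    ∃ D₂ : LA.Rep ℝ (LineTensor L L), IsTensor D D D₂ ∧ ∃ y : Sec E ℝ (LineTensor L L),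
      NowhereZero y ∧ ∃ β, IsCharCocycle D₂ y β ∧ c = (1 / 2 : ℝ) • LA.coboundaries.mkQ β := by
  rcases h with ⟨x, hx, α, hα, rfl⟩ | ⟨-, h⟩
  · obtain ⟨D₂, hD₂⟩ := exists_isTensor D
    refine ⟨D₂, hD₂, tensorSec x x, fun m => tmul_ne_zero (hx m) (hx m), (2 : ℝ) • α,
      fun a m => ?_, ?_⟩
    · have hp : pair ((2 : ℝ) • α : LA.cocycles).1 a m = 2 * pair α.1 a m := rfl
      rw [hD₂, ← tensorPairing_B, ← tensorPairing_B, ← tensorPairing_B, ContMDiffSection.coe_add,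
        Pi.add_apply, LinePairing.B_apply, LinePairing.B_apply, LinePairing.B_apply, hα, hp,
        map_smul, map_smul, LinearMap.smul_apply]
      module
    · rw [map_smul, smul_smul]; norm_num
  · exact h

section Product

variable {L₂ : M → Type*} [∀ m, AddCommGroup (L₂ m)] [∀ m, Module ℝ (L₂ m)]
  [TopologicalSpace (TotalSpace ℝ L₂)] [∀ m, TopologicalSpace (L₂ m)] [FiberBundle ℝ L₂]
  [VectorBundle ℝ ℝ L₂] [ContMDiffVectorBundle ∞ ℝ L₂ 𝓘(ℝ, E)]
  {L₃ : M → Type*} [∀ m, AddCommGroup (L₃ m)] [∀ m, Module ℝ (L₃ m)]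
  [TopologicalSpace (TotalSpace ℝ L₃)] [∀ m, TopologicalSpace (L₃ m)] [FiberBundle ℝ L₃]
  [VectorBundle ℝ ℝ L₃] [ContMDiffVectorBundle ∞ ℝ L₃ 𝓘(ℝ, E)]

/-- `D₃` is the tensor product of `D₁` and `D₂` under the isomorphism `L ⊗ L₂ ≅ L₃` given by the
pairing `p`. -/
def IsProductRep (p : LinePairing E L L₂ L₃) (D₁ : LA.Rep ℝ L) (D₂ : LA.Rep ℝ L₂)
    (D₃ : LA.Rep ℝ L₃) : Prop :=
  ∀ a s t, D₃.D a (p.B s t) = p.B (D₁.D a s) t + p.B s (D₂.D a t)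

/-- The Leibniz rule for a product of representations only has to be checked on frames. -/
lemma isProductRep_of_frames (p : LinePairing E L L₂ L₃) {D₁ : LA.Rep ℝ L} {D₂ : LA.Rep ℝ L₂}
    {D₃ : LA.Rep ℝ L₃} (h : ∀ a m, ∃ s t, s m ≠ 0 ∧ t m ≠ 0 ∧
      D₃.D a (p.B s t) m = p.J m (D₁.D a s m) (t m) + p.J m (s m) (D₂.D a t m)) :
    IsProductRep p D₁ D₂ D₃ := by
  intro a s t
  ext m
  obtain ⟨s', t', hs, ht, h'⟩ := h a m
  rw [ContMDiffSection.coe_add, Pi.add_apply, p.B_apply, p.B_apply]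
  exact p.leibniz_of_frame (D₁.isDer a m) (D₂.isDer a m) (D₃.isDer a m) hs ht h' s t

/-- The tensor squares of the factors of a product have the tensor square as their product. -/
lemma IsProductRep.square {p : LinePairing E L L₂ L₃} {D₁ : LA.Rep ℝ L} {D₂ : LA.Rep ℝ L₂}
    {D₃ : LA.Rep ℝ L₃} (h : IsProductRep p D₁ D₂ D₃) {D₁' D₂' D₃'} (h₁ : IsTensor D₁ D₁ D₁')
    (h₂ : IsTensor D₂ D₂ D₂') (h₃ : IsTensor D₃ D₃ D₃') :
    IsProductRep p.square D₁' D₂' D₃' := by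
  refine isProductRep_of_frames _ fun a m => ?_
  obtain ⟨s, hs⟩ := exists_sec_ne_zero (E := E) L m
  obtain ⟨t, ht⟩ := exists_sec_ne_zero (E := E) L₂ m
  refine ⟨tensorSec s s, tensorSec t t, tmul_ne_zero hs hs, tmul_ne_zero ht ht, ?_⟩
  rw [← p.square.B_apply, ← p.square.B_apply, p.square_B, h₁, h₂, h₃, h, ← Pi.add_apply,
    ← ContMDiffSection.coe_add]
  congr 1
  simp only [LinePairing.B_add_left, LinePairing.B_add_right, p.square_B]
  simp only [← tensorPairing_B, LinePairing.B_add_left, LinePairing.B_add_right]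
  abel

/-- Characteristic classes are additive under tensor products. The passage to the squares makes all
three line bundles orientable. -/
lemma IsProductRep.charClass_eq {p : LinePairing E L L₂ L₃} {D₁ : LA.Rep ℝ L}
    {D₂ : LA.Rep ℝ L₂} {D₃ : LA.Rep ℝ L₃} (h : IsProductRep p D₁ D₂ D₃) {c₁ c₂ c₃ : LA.H1}
    (h₁ : IsCharClass D₁ c₁) (h₂ : IsCharClass D₂ c₂) (h₃ : IsCharClass D₃ c₃) :
    c₃ = c₁ + c₂ := by
  obtain ⟨D₁', hD₁, y₁, hy₁, β₁, hβ₁, rfl⟩ := h₁.exists_square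
  obtain ⟨D₂', hD₂, y₂, hy₂, β₂, hβ₂, rfl⟩ := h₂.exists_square
  obtain ⟨D₃', hD₃, y₃, hy₃, β₃, hβ₃, rfl⟩ := h₃.exists_square
  have h' := h.square hD₁ hD₂ hD₃
  have hβ : IsCharCocycle D₃' (p.square.B y₁ y₂) (β₁ + β₂) := fun a m => by
    have hp : pair (β₁ + β₂ : LA.cocycles).1 a m = pair β₁.1 a m + pair β₂.1 a m := rfl
    rw [h', ContMDiffSection.coe_add, Pi.add_apply, LinePairing.B_apply, LinePairing.B_apply,
      LinePairing.B_apply, hβ₁, hβ₂, hp, map_smul, map_smul, LinearMap.smul_apply]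
    module
  rw [hβ₃.mkQ_eq hy₃ (fun m => p.square.B_ne_zero (hy₁ m) (hy₂ m)) hβ, map_add, smul_add]

end Product

section Pullback

variable {FB : Type*} [NormedAddCommGroup FB] [NormedSpace ℝ FB] {B : M → Type*}
  [∀ m, AddCommGroup (B m)] [∀ m, Module ℝ (B m)]
  [TopologicalSpace (TotalSpace FB B)] [∀ m, TopologicalSpace (B m)] [FiberBundle FB B]
  [VectorBundle ℝ FB B] [∀ m, IsTopologicalAddGroup (B m)] [∀ m, ContinuousSMul ℝ (B m)]
  {LB : LieAlgebroid E FB B} {Φ : BundleMap E F A FB B}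

/-- The pull-back of a representation along a base-preserving morphism of Lie algebroids. -/
def IsLieAlgebroidHom.pullRep (h : IsLieAlgebroidHom LA LB Φ) (D : LB.Rep ℝ L) : LA.Rep ℝ L where
  D :=
    { toFun := fun a => D.D (Φ.app a)
      map_add' := fun a b => by rw [app_add, map_add]
      map_smul' := fun c a => (congrArg D.D (app_fsmul Φ (ContMDiffMap.const c) a)).trans
        (map_smul D.D c (Φ.app a)) }
  smul_left f a x := by
    change D.D (Φ.app _) x = _
    rw [app_fsmul, D.smul_left]; rfl
  leibniz f a x m := by
    refine (D.leibniz f (Φ.app a) x m).trans ?_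
    congr 2
    exact congrArg (mvfderiv 𝓘(ℝ, E) f m) (h.anchor m (a m))
  flat a b x := by
    change _ = D.D (Φ.app _) x
    rw [h.bracket]
    exact D.flat _ _ x

lemma IsLieAlgebroidHom.pullRep_D (h : IsLieAlgebroidHom LA LB Φ) (D : LB.Rep ℝ L)
    (a : Sec E F A) : (h.pullRep D).D a = D.D (Φ.app a) := rfl

lemma IsLieAlgebroidHom.exists_pullback_mkQ (h : IsLieAlgebroidHom LA LB Φ) (α : LB.cocycles) :
    ∃ α' : LA.cocycles, (∀ a m, pair α'.1 a m = pair α.1 (Φ.app a) m) ∧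
      pullback h (LB.coboundaries.mkQ α) = LA.coboundaries.mkQ α' :=
  ⟨_, fun _ _ => rfl, Submodule.mapQ_apply _ _ _ α⟩

lemma IsLieAlgebroidHom.isCharClass_pullRep (h : IsLieAlgebroidHom LA LB Φ) {D : LB.Rep ℝ L}
    {c : LB.H1} (hc : IsCharClass D c) : IsCharClass (h.pullRep D) (pullback h c) := by
  rcases hc with ⟨x, hx, α, hα, rfl⟩ | ⟨hL, D₂, hD₂, y, hy, β, hβ, rfl⟩
  · obtain ⟨α', h1, h2⟩ := h.exists_pullback_mkQ α
    exact Or.inl ⟨x, hx, α', fun a m => by rw [h1]; exact hα (Φ.app a) m, h2⟩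
  · obtain ⟨β', h1, h2⟩ := h.exists_pullback_mkQ β
    refine Or.inr ⟨hL, h.pullRep D₂, fun a s t => hD₂ (Φ.app a) s t, y, hy, β',
      fun a m => by rw [h1]; exact hβ (Φ.app a) m, ?_⟩
    rw [map_smul, h2]

end Pullback

end Reps

/-! ### The modular class -/

section Trace

variable {E : Type*} [NormedAddCommGroup E] [NormedSpace ℝ E] [FiniteDimensional ℝ E]
  {M : Type*} [TopologicalSpace M] [ChartedSpace E M] [IsManifold 𝓘(ℝ, E) ∞ M] [T2Space M]
  {F : Type*} [NormedAddCommGroup F] [NormedSpace ℝ F] [FiniteDimensional ℝ F]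
  {V : M → Type*}
  [∀ m, AddCommGroup (V m)] [∀ m, Module ℝ (V m)]
  [TopologicalSpace (TotalSpace F V)] [∀ m, TopologicalSpace (V m)] [FiberBundle F V]
  [VectorBundle ℝ F V] [ContMDiffVectorBundle ∞ F V 𝓘(ℝ, E)]

/-- The derivation of the top exterior power induced by an endomorphism of rank one is the
multiplication by its trace. -/
lemma sum_wedge_rankOne {m : M} (φ : V m →ₗ[ℝ] ℝ) (a : V m) (x : Fin (finrank ℝ F) → V m) :
    ∑ j, (wedge (update x j (φ (x j) • a)) : TopPow F V m) = φ a • wedge x := by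
  let b := fibreBasis F V m
  let T := derivAlt (wedgeAlt F V m) LinearMap.id (φ.smulRight a) - φ a • wedgeAlt F V m
  suffices h : T = 0 by
    have h1 := AlternatingMap.congr_fun h x
    have h2 : derivAlt (wedgeAlt F V m) LinearMap.id (φ.smulRight a) x -
      φ a • wedgeAlt F V m x = 0 := h1
    rw [derivAlt_apply] at h2
    exact sub_eq_zero.1 h2
  refine alternating_eq_zero (ev := LinearMap.id) T (fun s j hs => T.map_coord_zero j hs) b
    (e := b) (fun _ => rfl) ?_
  change derivAlt (wedgeAlt F V m) LinearMap.id (φ.smulRight a) b - φ a • wedgeAlt F V m b = 0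
  rw [derivAlt_apply, sub_eq_zero]
  have h1 : ∀ j, wedgeAlt F V m (update (fun l => LinearMap.id (R := ℝ) (b l)) j
      (φ.smulRight a (b j))) = (b.repr a j * φ (b j)) • wedgeAlt F V m b := by
    intro j
    change wedgeAlt F V m (update b j (φ (b j) • a)) = _
    rw [(wedgeAlt F V m).map_update_smul, mul_comm, mul_smul]
    congr 1
    conv_lhs => rw [← b.sum_repr a]
    rw [(wedgeAlt F V m).map_update_sum, Finset.sum_eq_single j]
    · rw [(wedgeAlt F V m).map_update_smul, update_eq_self]
    · intro k _ hk
      rw [(wedgeAlt F V m).map_update_smul, (wedgeAlt F V m).map_update_self _ hk.symm, smul_zero]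
    · exact fun h => absurd (Finset.mem_univ j) h
  rw [Finset.sum_congr rfl fun j _ => h1 j, ← Finset.sum_smul]
  congr 1
  conv_rhs => rw [← b.sum_repr a]
  simp only [map_sum, map_smul, smul_eq_mul]

lemma topDer_congr {v w : Sec E E (Tan E (M := M))} {δ ε : Sec E F V →ₗ[ℝ] Sec E F V}
    (hδ : IsDer v δ) (hε : IsDer w ε) (h : ∀ s, δ s = ε s) (s : Fin (finrank ℝ F) → Sec E F V) :
    topDer hδ (wedgeSec s) = topDer hε (wedgeSec s) := by
  simp only [topDer_wedgeSec, h]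

lemma topDer_add {v₁ v₂ v₃ : Sec E E (Tan E (M := M))} {δ₁ δ₂ δ₃ : Sec E F V →ₗ[ℝ] Sec E F V}
    (h₁ : IsDer v₁ δ₁) (h₂ : IsDer v₂ δ₂) (h₃ : IsDer v₃ δ₃) (h : ∀ s, δ₃ s = δ₁ s + δ₂ s)
    (s : Fin (finrank ℝ F) → Sec E F V) :
    topDer h₃ (wedgeSec s) = topDer h₁ (wedgeSec s) + topDer h₂ (wedgeSec s) := by
  simp only [topDer_wedgeSec, h, ← Finset.sum_add_distrib]
  exact Finset.sum_congr rfl fun j _ => (wedgeSecAlt E F V).map_update_add s j _ _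

/-- A perturbation of a derivation by an endomorphism of rank one changes the induced derivation of
the top exterior power by a trace. -/
lemma topDer_rankOne {v w : Sec E E (Tan E (M := M))} {δ ε : Sec E F V →ₗ[ℝ] Sec E F V}
    (hδ : IsDer v δ) (hε : IsDer w ε) {m : M} (c : ℝ) (φ : V m →ₗ[ℝ] ℝ) (a : V m)
    (h : ∀ s, ε s m = c • δ s m + φ (s m) • a) (s : Fin (finrank ℝ F) → Sec E F V) :
    topDer hε (wedgeSec s) m = c • topDer hδ (wedgeSec s) m + φ a • wedgeSec s m := by
  rw [topDer_wedgeSec_apply, topDer_wedgeSec_apply]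
  refine Eq.trans ?_ (congrArg₂ (· + ·) rfl (sum_wedge_rankOne φ a fun j => s j m))
  rw [Finset.smul_sum, ← Finset.sum_add_distrib]
  refine Finset.sum_congr rfl fun j _ => ?_
  rw [h]
  have := (wedgeAlt F V m).map_update_add (fun l => s l m) j (c • δ (s j) m) (φ (s j m) • a)
  rw [(wedgeAlt F V m).map_update_smul] at this
  exact this

end Trace

section LieDerivative

variable {E : Type*} [NormedAddCommGroup E] [NormedSpace ℝ E] [FiniteDimensional ℝ E]
  {M : Type*} [TopologicalSpace M] [ChartedSpace E M] [IsManifold 𝓘(ℝ, E) ∞ M] [T2Space M]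

/-- The smooth function `ξ w`, for a `1`-form `ξ` and a vector field `w`. -/
def pairFn (ξ : DualSec E E (Tan E (M := M))) (w : Sec E E (Tan E (M := M))) : Fn E M :=
  ⟨pair ξ w, fun x => (contMDiffAt_section x).1 ((ξ.app w).contMDiff x)⟩

lemma pairFn_add_right (ξ : DualSec E E (Tan E (M := M))) (w w' : Sec E E (Tan E (M := M))) :
    pairFn ξ (w + w') = pairFn ξ w + pairFn ξ w' := by
  ext m; exact (ξ m).map_add _ _

lemma pairFn_fsmul_right (ξ : DualSec E E (Tan E (M := M))) (f : Fn E M)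
    (w : Sec E E (Tan E (M := M))) : pairFn ξ (fsmul f w) = f * pairFn ξ w := by
  ext m; exact (ξ m).map_smul _ _

lemma pairFn_sub_right (ξ : DualSec E E (Tan E (M := M))) (w w' : Sec E E (Tan E (M := M))) :
    pairFn ξ (w - w') = pairFn ξ w - pairFn ξ w' := by
  ext m; exact (ξ m).map_sub _ _

lemma pairFn_add_left (ξ η : DualSec E E (Tan E (M := M))) (w : Sec E E (Tan E (M := M))) :
    pairFn (ξ + η) w = pairFn ξ w + pairFn η w := rfl

lemma pairFn_fsmul_left (ξ : DualSec E E (Tan E (M := M))) (f : Fn E M)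
    (w : Sec E E (Tan E (M := M))) : pairFn (fsmul f ξ) w = f * pairFn ξ w := rfl

lemma dualSec_ext {ξ η : DualSec E E (Tan E (M := M))} (h : ∀ w, pairFn ξ w = pairFn η w) :
    ξ = η := by
  ext m v
  obtain ⟨w, rfl⟩ := exists_sec_eq (E := E) (F := E) (V := Tan E (M := M)) m v
  exact congrArg (fun f : Fn E M => f m) (h w)

lemma derivFn_add_right (v : Sec E E (Tan E (M := M))) (f g : Fn E M) :
    derivFn v (f + g) = derivFn v f + derivFn v g := by
  ext m
  change mvfderiv 𝓘(ℝ, E) (f + g : Fn E M) m (v m) = _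
  rw [mvfderiv_fn_add]; rfl

lemma derivFn_smul_right (v : Sec E E (Tan E (M := M))) (c : ℝ) (f : Fn E M) :
    derivFn v (c • f) = c • derivFn v f := by
  ext m
  change mvfderiv 𝓘(ℝ, E) (c • f : Fn E M) m (v m) = _
  rw [mvfderiv_fn_smul]; rfl

lemma derivFn_sub_right (v : Sec E E (Tan E (M := M))) (f g : Fn E M) :
    derivFn v (f - g) = derivFn v f - derivFn v g := by
  rw [eq_sub_iff_add_eq, ← derivFn_add_right, sub_add_cancel]

lemma derivFn_mul (v : Sec E E (Tan E (M := M))) (f g : Fn E M) :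
    derivFn v (f * g) = f * derivFn v g + derivFn v f * g := by
  ext m; exact mvfderiv_fn_mul f g m (v m)

lemma derivFn_add_left (v w : Sec E E (Tan E (M := M))) (f : Fn E M) :
    derivFn (v + w) f = derivFn v f + derivFn w f := by
  ext m; exact map_add (mvfderiv 𝓘(ℝ, E) f m) _ _

lemma derivFn_fsmul_left (v : Sec E E (Tan E (M := M))) (g f : Fn E M) :
    derivFn (fsmul g v) f = g * derivFn v f := by
  ext m; exact map_smul (mvfderiv 𝓘(ℝ, E) f m) _ _

/-- The Lie derivative `L_v ξ` is smooth: the formula that defines it is linear over the functions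
in `w`. -/
lemma exists_lieSec (v : Sec E E (Tan E (M := M))) (ξ : DualSec E E (Tan E (M := M))) :
    ∃ η : DualSec E E (Tan E (M := M)),
      ∀ w, pairFn η w = derivFn v (pairFn ξ w) - pairFn ξ (lieB v w) := by
  obtain ⟨η, hη⟩ := exists_dualSec (AddMonoidHom.mk'
      (fun w => derivFn v (pairFn ξ w) - pairFn ξ (lieB v w)) fun w w' => by
        rw [pairFn_add_right, derivFn_add_right, lieB_add_right, pairFn_add_right]; abel)
    fun f w => by
      change derivFn v (pairFn ξ (fsmul f w)) - pairFn ξ (lieB v (fsmul f w)) =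
        f * (derivFn v (pairFn ξ w) - pairFn ξ (lieB v w))
      rw [pairFn_fsmul_right, derivFn_mul, lieB_fsmul_right, pairFn_add_right, pairFn_fsmul_right,
        pairFn_fsmul_right]
      ring
  exact ⟨η, fun w => by ext m; exact hη w m⟩

/-- The Lie derivative of `1`-forms along a vector field, as an operator on smooth sections. -/
def lieSec (v : Sec E E (Tan E (M := M))) :
    DualSec E E (Tan E (M := M)) →ₗ[ℝ] DualSec E E (Tan E (M := M)) where
  toFun ξ := (exists_lieSec v ξ).choose
  map_add' ξ η := dualSec_ext fun w => by
    rw [pairFn_add_left, (exists_lieSec v _).choose_spec, (exists_lieSec v _).choose_spec,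
      (exists_lieSec v _).choose_spec, pairFn_add_left, pairFn_add_left, derivFn_add_right]
    abel
  map_smul' c ξ := dualSec_ext fun w => by
    have h : ∀ (η : DualSec E E (Tan E (M := M))) u, pairFn (c • η) u = c • pairFn η u :=
      fun _ _ => rfl
    rw [RingHom.id_apply, h, (exists_lieSec v _).choose_spec, (exists_lieSec v _).choose_spec, h, h,
      derivFn_smul_right, smul_sub]

lemma pairFn_lieSec (v : Sec E E (Tan E (M := M))) (ξ : DualSec E E (Tan E (M := M)))
    (w : Sec E E (Tan E (M := M))) :
    pairFn (lieSec v ξ) w = derivFn v (pairFn ξ w) - pairFn ξ (lieB v w) :=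
  (exists_lieSec v ξ).choose_spec w

lemma lieSec_apply (v : Sec E E (Tan E (M := M))) (ξ : DualSec E E (Tan E (M := M))) (m : M) :
    lieSec v ξ m = lieDeriv v ξ m := by
  ext u
  obtain ⟨w, rfl⟩ := exists_sec_eq (E := E) (F := E) (V := Tan E (M := M)) m u
  refine (congrArg (fun f : Fn E M => f m) (pairFn_lieSec v ξ w)).trans ?_
  symm
  unfold lieDeriv
  rw [TensorialAt.mkHom_apply _ w.mdifferentiableAt]
  rfl

lemma isDer_lieSec (v : Sec E E (Tan E (M := M))) : IsDer v (lieSec v) := by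
  intro m f ξ
  suffices h : lieSec v (fsmul f ξ) = fsmul f (lieSec v ξ) + fsmul (derivFn v f) ξ from
    congrArg (fun η : DualSec E E (Tan E (M := M)) => η m) h
  refine dualSec_ext fun w => ?_
  rw [pairFn_add_left, pairFn_lieSec, pairFn_fsmul_left, pairFn_fsmul_left, pairFn_fsmul_left,
    pairFn_fsmul_left, pairFn_lieSec, derivFn_mul]
  ring

lemma lieSec_add (v w : Sec E E (Tan E (M := M))) (ξ : DualSec E E (Tan E (M := M))) :
    lieSec (v + w) ξ = lieSec v ξ + lieSec w ξ := dualSec_ext fun u => by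
  rw [pairFn_add_left, pairFn_lieSec, pairFn_lieSec, pairFn_lieSec, derivFn_add_left,
    lieB_add_left, pairFn_add_right]
  abel

lemma lieSec_lieB (v w : Sec E E (Tan E (M := M))) (ξ : DualSec E E (Tan E (M := M))) :
    lieSec (lieB v w) ξ = lieSec v (lieSec w ξ) - lieSec w (lieSec v ξ) := dualSec_ext fun u => by
  have h : ∀ η ζ : DualSec E E (Tan E (M := M)), pairFn (η - ζ) u = pairFn η u - pairFn ζ u :=
    fun _ _ => rfl
  have h1 := lieB_jacobi v w u
  rw [h]
  simp only [pairFn_lieSec, derivFn_sub_right, mvfderiv_lieB]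
  rw [h1, pairFn_add_right]
  ring

/-- `L_{f v} ξ = f L_v ξ + ξ(v) df`. -/
lemma lieSec_fsmul (f : Fn E M) (v : Sec E E (Tan E (M := M)))
    (ξ : DualSec E E (Tan E (M := M))) (m : M) :
    lieSec (fsmul f v) ξ m = f m • lieSec v ξ m +
      pairFn ξ v m • (mvfderiv 𝓘(ℝ, E) f m : Cotan E m) := by
  have hB : ∀ w, lieB (fsmul f v) w = fsmul f (lieB v w) - fsmul (derivFn w f) v := fun w => by
    rw [lieB_swap, lieB_fsmul_right, lieB_swap v w]
    ext m
    change -(f m • lieB w v m + derivFn w f m • v m) = f m • -lieB w v m - derivFn w f m • v m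
    module
  ext u
  obtain ⟨w, rfl⟩ := exists_sec_eq (E := E) (F := E) (V := Tan E (M := M)) m u
  have h : pairFn (lieSec (fsmul f v) ξ) w = f * pairFn (lieSec v ξ) w +
      pairFn ξ v * derivFn w f := by
    rw [pairFn_lieSec, pairFn_lieSec, hB, derivFn_fsmul_left, pairFn_sub_right,
      pairFn_fsmul_right, pairFn_fsmul_right]
    ring
  exact congrArg (fun f : Fn E M => f m) h

end LieDerivative

section ModularRep

variable {E : Type*} [NormedAddCommGroup E] [NormedSpace ℝ E] [FiniteDimensional ℝ E]
  {M : Type*} [TopologicalSpace M] [ChartedSpace E M] [IsManifold 𝓘(ℝ, E) ∞ M] [T2Space M]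
  {F : Type*} [NormedAddCommGroup F] [NormedSpace ℝ F] [FiniteDimensional ℝ F]
  {A : M → Type*}
  [∀ m, AddCommGroup (A m)] [∀ m, Module ℝ (A m)]
  [TopologicalSpace (TotalSpace F A)] [∀ m, TopologicalSpace (A m)] [FiberBundle F A]
  [VectorBundle ℝ F A] [ContMDiffVectorBundle ∞ F A 𝓘(ℝ, E)]

/-- The derivation of `∧^top A` induced by the bracket with `a`. -/
def topBracket (LA : LieAlgebroid E F A) (a : Sec E F A) :
    Sec E ℝ (TopPow F A) →ₗ[ℝ] Sec E ℝ (TopPow F A) := topDer (isDer_bracket LA a)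

/-- The Lie derivative of forms of top degree along the vector field `ρ(a)`. -/
def topLie (LA : LieAlgebroid E F A) (a : Sec E F A) :
    Sec E ℝ (TopPow (E →L[ℝ] ℝ) (Cotan E (M := M))) →ₗ[ℝ]
      Sec E ℝ (TopPow (E →L[ℝ] ℝ) (Cotan E (M := M))) := topDer (isDer_lieSec (LA.anchor.app a))

lemma topBracket_wedgeSec_apply (LA : LieAlgebroid E F A) (a : Sec E F A)
    (s : Fin (finrank ℝ F) → Sec E F A) (m : M) :
    topBracket LA a (wedgeSec s) m = LA.gerstenhaber a s m :=
  topDer_wedgeSec_apply _ _ _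

lemma topLie_wedgeSec_apply (LA : LieAlgebroid E F A) (a : Sec E F A)
    (ξ : Fin (finrank ℝ (E →L[ℝ] ℝ)) → DualSec E E (Tan E (M := M))) (m : M) :
    topLie LA a (wedgeSec ξ) m = lieDerivTop (LA.anchor.app a) ξ m := by
  refine (topDer_wedgeSec_apply _ _ _).trans ?_
  simp only [lieSec_apply]
  rfl

lemma topBracket_add (LA : LieAlgebroid E F A) (a b : Sec E F A)
    (s : Fin (finrank ℝ F) → Sec E F A) :
    topBracket LA (a + b) (wedgeSec s) =
      topBracket LA a (wedgeSec s) + topBracket LA b (wedgeSec s) :=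
  topDer_add _ _ _ (fun t => by rw [map_add]; rfl) s

lemma topLie_add (LA : LieAlgebroid E F A) (a b : Sec E F A)
    (ξ : Fin (finrank ℝ (E →L[ℝ] ℝ)) → DualSec E E (Tan E (M := M))) :
    topLie LA (a + b) (wedgeSec ξ) = topLie LA a (wedgeSec ξ) + topLie LA b (wedgeSec ξ) :=
  topDer_add _ _ _ (fun t => by rw [app_add, lieSec_add]) ξ

lemma topBracket_flat (LA : LieAlgebroid E F A) (a b : Sec E F A)
    (s : Fin (finrank ℝ F) → Sec E F A) :
    topBracket LA a (topBracket LA b (wedgeSec s)) - topBracket LA b (topBracket LA a (wedgeSec s)) =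
      topBracket LA (LA.bracket a b) (wedgeSec s) :=
  (LinearMap.congr_fun (topDer_commutator (isDer_bracket LA a) (isDer_bracket LA b)) _).trans
    (topDer_congr _ _ (fun t => sub_eq_iff_eq_add.2 (LA.jacobi a b t)) s)

lemma topLie_flat (LA : LieAlgebroid E F A) (a b : Sec E F A)
    (ξ : Fin (finrank ℝ (E →L[ℝ] ℝ)) → DualSec E E (Tan E (M := M))) :
    topLie LA a (topLie LA b (wedgeSec ξ)) - topLie LA b (topLie LA a (wedgeSec ξ)) =
      topLie LA (LA.bracket a b) (wedgeSec ξ) :=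
  (LinearMap.congr_fun (topDer_commutator (isDer_lieSec (LA.anchor.app a))
    (isDer_lieSec (LA.anchor.app b))) _).trans
    (topDer_congr _ _ (fun η => by rw [anchor_app_bracket, lieSec_lieB]; rfl) ξ)

/-- The term of `[f a, ·]` that contains `df` is an endomorphism of rank one, of trace
`-ρ(a) f`. -/
lemma topBracket_fsmul (LA : LieAlgebroid E F A) (f : Fn E M) (a : Sec E F A)
    (s : Fin (finrank ℝ F) → Sec E F A) :
    topBracket LA (fsmul f a) (wedgeSec s) = fsmul f (topBracket LA a (wedgeSec s)) -
      fsmul (derivFn (LA.anchor.app a) f) (wedgeSec s) := by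
  ext m
  let φ : A m →ₗ[ℝ] ℝ := -((mvfderiv 𝓘(ℝ, E) f m).comp (LA.anchor m) : A m →ₗ[ℝ] ℝ)
  have h := topDer_rankOne (isDer_bracket LA a) (isDer_bracket LA (fsmul f a)) (m := m) (f m) φ
    (a m) (fun t => by
      rw [bracket_fsmul_left]
      change f m • LA.bracket a t m - derivFn (LA.anchor.app t) f m • a m =
        f m • LA.bracket a t m + (-derivFn (LA.anchor.app t) f m) • a m
      module) s
  refine h.trans ?_
  change _ + (-derivFn (LA.anchor.app a) f m) • wedgeSec s m = f m • topBracket LA a (wedgeSec s) m -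
    derivFn (LA.anchor.app a) f m • wedgeSec s m
  rw [neg_smul, ← sub_eq_add_neg]
  rfl

/-- The term of `L_{f v}` that contains `df` is an endomorphism of rank one, of trace `v f`. -/
lemma topLie_fsmul (LA : LieAlgebroid E F A) (f : Fn E M) (a : Sec E F A)
    (ξ : Fin (finrank ℝ (E →L[ℝ] ℝ)) → DualSec E E (Tan E (M := M))) :
    topLie LA (fsmul f a) (wedgeSec ξ) = fsmul f (topLie LA a (wedgeSec ξ)) +
      fsmul (derivFn (LA.anchor.app a) f) (wedgeSec ξ) := by
  ext m
  let φ : Cotan E m →ₗ[ℝ] ℝ :=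
    { toFun := fun η => η (LA.anchor m (a m))
      map_add' := fun _ _ => rfl
      map_smul' := fun _ _ => rfl }
  exact topDer_rankOne (isDer_lieSec (LA.anchor.app a)) (isDer_lieSec (LA.anchor.app (fsmul f a)))
    (m := m) (f m) φ (mvfderiv 𝓘(ℝ, E) f m : Cotan E m) (fun η => by
      rw [app_fsmul]
      exact lieSec_fsmul f (LA.anchor.app a) η m) ξ

section Pairing

variable {LA : LieAlgebroid E F A}
  {L₁ : M → Type*} [∀ m, AddCommGroup (L₁ m)] [∀ m, Module ℝ (L₁ m)]
  [TopologicalSpace (TotalSpace ℝ L₁)] [∀ m, TopologicalSpace (L₁ m)] [FiberBundle ℝ L₁]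
  [VectorBundle ℝ ℝ L₁] [ContMDiffVectorBundle ∞ ℝ L₁ 𝓘(ℝ, E)]
  {L₂ : M → Type*} [∀ m, AddCommGroup (L₂ m)] [∀ m, Module ℝ (L₂ m)]
  [TopologicalSpace (TotalSpace ℝ L₂)] [∀ m, TopologicalSpace (L₂ m)] [FiberBundle ℝ L₂]
  [VectorBundle ℝ ℝ L₂] [ContMDiffVectorBundle ∞ ℝ L₂ 𝓘(ℝ, E)]
  {L₃ : M → Type*} [∀ m, AddCommGroup (L₃ m)] [∀ m, Module ℝ (L₃ m)]
  [TopologicalSpace (TotalSpace ℝ L₃)] [∀ m, TopologicalSpace (L₃ m)] [FiberBundle ℝ L₃]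
  [VectorBundle ℝ ℝ L₃] [ContMDiffVectorBundle ∞ ℝ L₃ 𝓘(ℝ, E)]

/-- Two families of derivations, which need not be linear over the functions, define a
representation on the product of the line bundles if their failures to be linear cancel. -/
lemma exists_rep_of_pairing (p : LinePairing E L₁ L₂ L₃) {δ₁ :
    Sec E F A → Sec E ℝ L₁ →ₗ[ℝ] Sec E ℝ L₁}
    {δ₂ : Sec E F A → Sec E ℝ L₂ →ₗ[ℝ] Sec E ℝ L₂}
    (h₁ : ∀ a, IsDer (LA.anchor.app a) (δ₁ a)) (h₂ : ∀ a, IsDer (LA.anchor.app a) (δ₂ a))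
    {S₁ : Set (Sec E ℝ L₁)} {S₂ : Set (Sec E ℝ L₂)}
    (hS₁ : ∀ m, ∃ x ∈ S₁, x m ≠ 0) (hS₂ : ∀ m, ∃ x ∈ S₂, x m ≠ 0)
    (hadd₁ : ∀ a b, ∀ x ∈ S₁, δ₁ (a + b) x = δ₁ a x + δ₁ b x)
    (hadd₂ : ∀ a b, ∀ x ∈ S₂, δ₂ (a + b) x = δ₂ a x + δ₂ b x)
    {tr : Fn E M → Sec E F A → Fn E M}
    (hsmul₁ : ∀ f a, ∀ x ∈ S₁, δ₁ (fsmul f a) x = fsmul f (δ₁ a x) - fsmul (tr f a) x)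
    (hsmul₂ : ∀ f a, ∀ x ∈ S₂, δ₂ (fsmul f a) x = fsmul f (δ₂ a x) + fsmul (tr f a) x)
    (hflat₁ : ∀ a b, ∀ x ∈ S₁, δ₁ a (δ₁ b x) - δ₁ b (δ₁ a x) = δ₁ (LA.bracket a b) x)
    (hflat₂ : ∀ a b, ∀ x ∈ S₂, δ₂ a (δ₂ b x) - δ₂ b (δ₂ a x) = δ₂ (LA.bracket a b) x) :
    ∃ R : LA.Rep ℝ L₃, ∀ a x y, R.D a (p.B x y) = p.B (δ₁ a x) y + p.B x (δ₂ a y) := by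
  choose Δ hΔ hΔt using fun a => p.exists_der (h₁ a) (h₂ a)
  obtain ⟨R, hR⟩ := exists_rep_of_generators Δ hΔ {z | ∃ x ∈ S₁, ∃ y ∈ S₂, z = p.B x y}
    (fun m => by
      obtain ⟨x, hx, hxm⟩ := hS₁ m
      obtain ⟨y, hy, hym⟩ := hS₂ m
      exact ⟨_, ⟨x, hx, y, hy, rfl⟩, p.B_ne_zero hxm hym⟩)
    (by
      rintro a b _ ⟨x, hx, y, hy, rfl⟩
      rw [hΔt, hΔt, hΔt, hadd₁ a b x hx, hadd₂ a b y hy, p.B_add_left, p.B_add_right]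
      abel)
    (by
      rintro f a _ ⟨x, hx, y, hy, rfl⟩
      rw [hΔt, hΔt, hsmul₁ f a x hx, hsmul₂ f a y hy, p.B_sub_left, p.B_add_right, fsmul_add]
      simp only [p.B_fsmul_left, p.B_fsmul_right]
      abel)
    (by
      rintro a b _ ⟨x, hx, y, hy, rfl⟩
      rw [hΔt, hΔt, hΔt, ← hflat₁ a b x hx, ← hflat₂ a b y hy, map_add, map_add, hΔt, hΔt, hΔt,
        hΔt, p.B_sub_left, p.B_sub_right]
      abel)
  exact ⟨R, fun a x y => by rw [hR, hΔt]⟩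

end Pairing

/-- The canonical representation on `∧^top A ⊗ ∧^top T^*M` exists. -/
lemma exists_isModularRep (LA : LieAlgebroid E F A) : ∃ D, LA.IsModularRep D := by
  obtain ⟨R, hR⟩ := exists_rep_of_pairing (LA := LA)
    (tensorPairing E (TopPow F A) (TopPow (E →L[ℝ] ℝ) (Cotan E (M := M))))
    (fun a => isDer_topDer (isDer_bracket LA a))
    (fun a => isDer_topDer (isDer_lieSec (LA.anchor.app a)))
    (S₁ := Set.range wedgeSec) (S₂ := Set.range wedgeSec)
    (fun m => by
      obtain ⟨s, -, -, hs⟩ := exists_wedgeSec_ne_zero (E := E) (F := F) (V := A) m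
      exact ⟨_, ⟨s, rfl⟩, hs⟩)
    (fun m => by
      obtain ⟨ξ, -, -, hξ⟩ := exists_wedgeSec_ne_zero (E := E) (F := E →L[ℝ] ℝ)
        (V := Cotan E (M := M)) m
      exact ⟨_, ⟨ξ, rfl⟩, hξ⟩)
    (by rintro a b _ ⟨s, rfl⟩; exact topBracket_add LA a b s)
    (by rintro a b _ ⟨ξ, rfl⟩; exact topLie_add LA a b ξ)
    (tr := fun f a => derivFn (LA.anchor.app a) f)
    (by rintro f a _ ⟨s, rfl⟩; exact topBracket_fsmul LA f a s)
    (by rintro f a _ ⟨ξ, rfl⟩; exact topLie_fsmul LA f a ξ)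
    (by rintro a b _ ⟨s, rfl⟩; exact topBracket_flat LA a b s)
    (by rintro a b _ ⟨ξ, rfl⟩; exact topLie_flat LA a b ξ)
  refine ⟨R, fun a s ξ m => ?_⟩
  refine (congrArg (fun x : Sec E ℝ (ModLine E F A) => x m) (hR a (wedgeSec s) (wedgeSec ξ))).trans ?_
  rw [← topBracket_wedgeSec_apply, ← topLie_wedgeSec_apply]
  rfl

/-- The canonical representation on `∧^top A ⊗ ∧^top T^*M` is unique. -/
lemma LieAlgebroid.IsModularRep.unique {LA : LieAlgebroid E F A} {D D' : LA.Rep ℝ (ModLine E F A)}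
    (h : LA.IsModularRep D) (h' : LA.IsModularRep D') : D = D' :=
  LieAlgebroid.Rep.ext fun a => (D.isDer a).line_ext (D'.isDer a) fun m => by
    obtain ⟨s, -, -, hs⟩ := exists_wedgeSec_ne_zero (E := E) (F := F) (V := A) m
    obtain ⟨ξ, -, -, hξ⟩ := exists_wedgeSec_ne_zero (E := E) (F := E →L[ℝ] ℝ)
      (V := Cotan E (M := M)) m
    exact ⟨tensorSec (wedgeSec s) (wedgeSec ξ), tmul_ne_zero hs hξ, by rw [h, h']⟩

/-- The modular class is well defined. -/
lemma existsUnique_isModClass [SigmaCompactSpace M] (LA : LieAlgebroid E F A) :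
    ∃! c, LA.IsModClass c := by
  obtain ⟨D, hD⟩ := exists_isModularRep LA
  obtain ⟨c, hc, hu⟩ := existsUnique_isCharClass D
  refine ⟨c, ⟨D, hD, hc⟩, ?_⟩
  rintro c' ⟨D', hD', hc'⟩
  obtain rfl := hD'.unique hD
  exact hu c' hc'

lemma isModClass_modClass [SigmaCompactSpace M] (LA : LieAlgebroid E F A) :
    LA.IsModClass LA.modClass :=
  Classical.epsilon_spec (existsUnique_isModClass LA).exists

lemma isCharClass_charClass [SigmaCompactSpace M] {LA : LieAlgebroid E F A}
    {L : M → Type*} [∀ m, AddCommGroup (L m)] [∀ m, Module ℝ (L m)]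
    [TopologicalSpace (TotalSpace ℝ L)] [∀ m, TopologicalSpace (L m)] [FiberBundle ℝ L]
    [VectorBundle ℝ ℝ L] [ContMDiffVectorBundle ∞ ℝ L 𝓘(ℝ, E)] (D : LA.Rep ℝ L) :
    IsCharClass D (charClass D) :=
  Classical.epsilon_spec (existsUnique_isCharClass D).exists

end ModularRep

/-! ### The adjoint representation of an extension -/

section ExactBasis

variable {ι κ C A B : Type*} [AddCommGroup C] [Module ℝ C] [AddCommGroup A] [Module ℝ A]
  [AddCommGroup B] [Module ℝ B]

/-- A basis of the middle term of a short exact sequence, from a basis of the first term and lifts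
of a basis of the last term. -/
lemma exists_basis_of_exact {i : C →ₗ[ℝ] A} {φ : A →ₗ[ℝ] B} (hi : Injective i)
    (h : Exact i φ) (bC : Basis ι ℝ C) (bB : Basis κ ℝ B) {s : κ → A} (hs : ∀ k, φ (s k) = bB k) :
    ∃ bA : Basis (ι ⊕ κ) ℝ A, ∀ j, bA j = Sum.elim (fun j => i (bC j)) s j := by
  let σ : B →ₗ[ℝ] A := bB.constr ℝ s
  have hσ : ∀ b, φ (σ b) = b := fun b => by
    have : φ ∘ₗ σ = LinearMap.id := bB.ext fun k => by simp [σ, hs]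
    exact LinearMap.congr_fun this b
  let e : (C × B) ≃ₗ[ℝ] A := LinearEquiv.ofBijective (i.coprod σ) ⟨by
      rw [injective_iff_map_eq_zero]
      rintro ⟨c, b⟩ hcb
      have h0 : i c + σ b = 0 := hcb
      have hb : b = 0 := by
        have := congrArg φ h0
        rwa [map_add, h.apply_apply_eq_zero, hσ, zero_add, map_zero] at this
      subst hb
      rw [map_zero, add_zero] at h0
      rw [hi (h0.trans (map_zero i).symm)]; rfl, fun a => by
      obtain ⟨c, hc⟩ := (h (a - σ (φ a))).1 (by rw [map_sub, hσ, sub_self])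
      exact ⟨(c, φ a), by
        change i c + σ (φ a) = a
        rw [hc, sub_add_cancel]⟩⟩
  refine ⟨(bC.prod bB).map e, ?_⟩
  rintro (j | k)
  · rw [Basis.map_apply, Basis.prod_apply]
    change i (bC j) + σ 0 = i (bC j)
    rw [map_zero, add_zero]
  · rw [Basis.map_apply, Basis.prod_apply]
    change i 0 + σ (bB k) = s k
    rw [map_zero, zero_add, Basis.constr_basis]

/-- The determinant with respect to a basis as above is multiplicative: the matrix is block
triangular. -/
lemma det_sumElim [Fintype ι] [DecidableEq ι] [Fintype κ] [DecidableEq κ] {i : C →ₗ[ℝ] A}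
    {φ : A →ₗ[ℝ] B} (h : Exact i φ) (bC : Basis ι ℝ C) (bB : Basis κ ℝ B) {s : κ → A}
    (hs : ∀ k, φ (s k) = bB k) (bA : Basis (ι ⊕ κ) ℝ A)
    (hA : ∀ j, bA j = Sum.elim (fun j => i (bC j)) s j) (x : ι → C) (a : κ → A) :
    bA.det (Sum.elim (fun j => i (x j)) a) = bC.det x * bB.det fun k => φ (a k) := by
  have h1 : ∀ l c, bA.repr (i c) (Sum.inl l) = bC.repr c l := fun l c => by
    have : (bA.coord (Sum.inl l)) ∘ₗ i = bC.coord l := bC.ext fun j => by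
      have : i (bC j) = bA (Sum.inl j) := (hA (Sum.inl j)).symm
      simp [this, Finsupp.single_apply]
    exact LinearMap.congr_fun this c
  have h2 : ∀ l c, bA.repr (i c) (Sum.inr l) = 0 := fun l c => by
    have : (bA.coord (Sum.inr l)) ∘ₗ i = 0 := bC.ext fun j => by
      have : i (bC j) = bA (Sum.inl j) := (hA (Sum.inl j)).symm
      simp [this]
    exact LinearMap.congr_fun this c
  have h3 : ∀ l a, bA.repr a (Sum.inr l) = bB.repr (φ a) l := fun l a => by
    have : bA.coord (Sum.inr l) = bB.coord l ∘ₗ φ := bA.ext fun j => by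
      rcases j with j | k
      · have : φ (bA (Sum.inl j)) = 0 := by rw [hA]; exact h.apply_apply_eq_zero _
        simp [this]
      · have : φ (bA (Sum.inr k)) = bB k := by rw [hA]; exact hs k
        simp [this, Finsupp.single_apply]
    exact LinearMap.congr_fun this a
  have h4 : bA.toMatrix (Sum.elim (fun j => i (x j)) a) = Matrix.fromBlocks (bC.toMatrix x)
      (Matrix.of fun l k => bA.repr (a k) (Sum.inl l)) 0 (bB.toMatrix fun k => φ (a k)) := by
    ext (l | l) (k | k)
    · exact h1 l _
    · rfl
    · exact h2 l _
    · exact h3 l _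
  rw [Basis.det_apply, h4, Matrix.det_fromBlocks_zero₂₁, Basis.det_apply, Basis.det_apply]

end ExactBasis

section Extension

variable {E : Type*} [NormedAddCommGroup E] [NormedSpace ℝ E] [FiniteDimensional ℝ E]
  {M : Type*} [TopologicalSpace M] [ChartedSpace E M] [IsManifold 𝓘(ℝ, E) ∞ M] [T2Space M]
  {FA : Type*} [NormedAddCommGroup FA] [NormedSpace ℝ FA] [FiniteDimensional ℝ FA]
  {A : M → Type*} [∀ m, AddCommGroup (A m)] [∀ m, Module ℝ (A m)]
  [TopologicalSpace (TotalSpace FA A)] [∀ m, TopologicalSpace (A m)] [FiberBundle FA A]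
  [VectorBundle ℝ FA A] [ContMDiffVectorBundle ∞ FA A 𝓘(ℝ, E)]
  [∀ m, IsTopologicalAddGroup (A m)] [∀ m, ContinuousSMul ℝ (A m)]
  {FB : Type*} [NormedAddCommGroup FB] [NormedSpace ℝ FB] [FiniteDimensional ℝ FB]
  {B : M → Type*} [∀ m, AddCommGroup (B m)] [∀ m, Module ℝ (B m)]
  [TopologicalSpace (TotalSpace FB B)] [∀ m, TopologicalSpace (B m)] [FiberBundle FB B]
  [VectorBundle ℝ FB B] [ContMDiffVectorBundle ∞ FB B 𝓘(ℝ, E)]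
  [∀ m, IsTopologicalAddGroup (B m)] [∀ m, ContinuousSMul ℝ (B m)]
  {FC : Type*} [NormedAddCommGroup FC] [NormedSpace ℝ FC] [FiniteDimensional ℝ FC]
  {C : M → Type*} [∀ m, AddCommGroup (C m)] [∀ m, Module ℝ (C m)]
  [TopologicalSpace (TotalSpace FC C)] [∀ m, TopologicalSpace (C m)] [FiberBundle FC C]
  [VectorBundle ℝ FC C] [ContMDiffVectorBundle ∞ FC C 𝓘(ℝ, E)]
  {LC : LieAlgebroid E FC C} {LA : LieAlgebroid E FA A} {LB : LieAlgebroid E FB B}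
  {i : BundleMap E FC C FA A} {Φ : BundleMap E FA A FB B}

namespace IsExtension


/-- Frames adapted to the extension: a frame of `C` and sections of `A` that lift a frame of
`B`. -/
lemma exists_frames (h : IsExtension LC LA LB i Φ) (x : M) : ∃ (e : Fin (finrank ℝ FC) → Sec E FC C)
    (s : Fin (finrank ℝ FB) → Sec E FA A) (bC : Basis _ ℝ (C x)) (bB : Basis _ ℝ (B x)),
    (∀ j, e j x = bC j) ∧ ∀ k, Φ x (s k x) = bB k := by
  obtain ⟨e, he⟩ := exists_sec_basis (E := E) (F := FC) (fibreBasis FC C x)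
  choose a ha using fun k => h.surjective x (fibreBasis FB B x k)
  choose s hs using fun k => exists_sec_eq (E := E) (F := FA) x (a k)
  exact ⟨e, s, _, _, he, fun k => by rw [hs, ha]⟩

/-- Every section of `A` in the kernel of `Φ` comes from a smooth section of `C`: in an adapted frame,
its coefficients along the lifts of the frame of `B` vanish, and the others are the coefficients of
the section of `C`. -/
lemma exists_app_eq_of_app_eq_zero (h : IsExtension LC LA LB i Φ) {a : Sec E FA A} (ha :
    Φ.app a = 0) :
    ∃ c : Sec E FC C, i.app c = a := by
  have ha' : ∀ m, Φ m (a m) = 0 := fun m => congrArg (fun b : Sec E FB B => b m) ha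
  choose c hc using fun m => (h.exact m (a m)).1 (ha' m)
  refine ⟨⟨c, fun x => ?_⟩, by ext m; exact hc m⟩
  obtain ⟨e, s, bC, bB, he, hs⟩ := h.exists_frames x
  obtain ⟨bA, hbA⟩ := exists_basis_of_exact (i := (i x : C x →ₗ[ℝ] A x))
    (φ := (Φ x : A x →ₗ[ℝ] B x)) (h.injective x) (h.exact x) bC bB hs
  obtain ⟨U, hU, hxU, κ, -, -, hκ⟩ := exists_coeff (Sum.elim (fun j => i.app (e j)) s) bA
    (by
      rintro (j | k)
      · rw [hbA]; exact congrArg (i x) (he j)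
      · rw [hbA]; rfl)
  obtain ⟨U', hU', hxU', κ', -, -, hκ'⟩ := exists_coeff (fun k => Φ.app (s k)) bB hs
  refine ((∑ j, fsmul (κ (Sum.inl j) a) (e j)).contMDiff x).congr_of_eventuallyEq ?_
  filter_upwards [hU.mem_nhds hxU, hU'.mem_nhds hxU'] with y hy hy'
  refine congrArg (TotalSpace.mk' FC y) (h.injective y ?_)
  have h1 := (hκ y hy).2 a
  rw [Fintype.sum_sum_type] at h1
  simp only [Sum.elim_inl, Sum.elim_inr] at h1
  have h2 : ∀ k, κ (Sum.inr k) a y = 0 := by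
    have h3 := congrArg (Φ y) h1
    rw [ha', map_add, map_sum, map_sum] at h3
    rw [Finset.sum_eq_zero (fun j _ => by
      rw [map_smul, app_apply, (h.exact y).apply_apply_eq_zero, smul_zero]), zero_add] at h3
    simp only [map_smul] at h3
    exact Fintype.linearIndependent_iff.1 (hκ' y hy').1 _ h3.symm
  simp only [h2, zero_smul, Finset.sum_const_zero, add_zero] at h1
  rw [hc, sum_sec_apply, map_sum]
  refine h1.trans (Finset.sum_congr rfl fun j _ => ?_)
  rw [fsmul_apply, map_smul]; rfl

/-- Every section of `B` lifts to a section of `A`: the lifts of a vector form an affine space, so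
local lifts can be glued. -/
lemma exists_app_eq (h : IsExtension LC LA LB i Φ) [SigmaCompactSpace M] (b : Sec E FB B) :
    ∃ a, Φ.app a = b := by
  obtain ⟨a, ha⟩ := exists_contMDiffSection_forall_mem_convex_of_local (I := 𝓘(ℝ, E))
    (n := (⊤ : ℕ∞)) (F_fiber := FA) (V := A) (t := fun m => {v | Φ m v = b m})
    (fun m => by
      rintro v (hv : Φ m v = b m) w (hw : Φ m w = b m) r t _ _ hrt
      change Φ m (r • v + t • w) = b m
      rw [map_add, map_smul, map_smul, hv, hw, ← add_smul, hrt, one_smul])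
    (fun x => by
      obtain ⟨-, s, -, bB, -, hs⟩ := h.exists_frames x
      obtain ⟨U, hU, hxU, κ, -, -, hκ⟩ := exists_coeff (fun k => Φ.app (s k)) bB hs
      let t : Sec E FA A := ∑ k, fsmul (κ k b) (s k)
      refine ⟨U, hU.mem_nhds hxU, t, t.contMDiff.contMDiffOn, fun y hy => ?_⟩
      change Φ y ((∑ k, fsmul (κ k b) (s k) : Sec E FA A) y) = b y
      rw [sum_sec_apply, map_sum, (hκ y hy).2 b]
      refine Finset.sum_congr rfl fun k _ => ?_
      rw [fsmul_apply, map_smul]; rfl)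
  exact ⟨a, by ext m; exact ha m⟩

lemma app_injective (h : IsExtension LC LA LB i Φ) : Injective (i.app :
    Sec E FC C → Sec E FA A) := fun c c' hc => by
  ext m
  exact h.injective m (congrArg (fun a : Sec E FA A => a m) hc)

lemma app_app (h : IsExtension LC LA LB i Φ) (c : Sec E FC C) : Φ.app (i.app c) = 0 := by
  ext m
  exact (h.exact m).apply_apply_eq_zero _

lemma anchor_app_app (h : IsExtension LC LA LB i Φ) (c : Sec E FC C) :
    LA.anchor.app (i.app c) = 0 := by
  ext m
  change LA.anchor m (i m (c m)) = 0
  rw [← h.hom_right.anchor, (h.exact m).apply_apply_eq_zero, map_zero]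

lemma anchor_app_left (h : IsExtension LC LA LB i Φ) (c : Sec E FC C) : LC.anchor.app c = 0 := by
  rw [← h.anchor_app_app c]
  ext m
  exact (h.hom_left.anchor m (c m)).symm

lemma anchor_app_right (h : IsExtension LC LA LB i Φ) (X : Sec E FA A) :
    LB.anchor.app (Φ.app X) = LA.anchor.app X := by
  ext m
  exact h.hom_right.anchor m (X m)

lemma exists_ad (h : IsExtension LC LA LB i Φ) (X : Sec E FA A) (c : Sec E FC C) :
    ∃ c', i.app c' = LA.bracket X (i.app c) :=
  h.exists_app_eq_of_app_eq_zero (by rw [h.hom_right.bracket, h.app_app, map_zero])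

/-- The adjoint action of a section of `A` on the sections of the ideal `C`. -/
def ad (h : IsExtension LC LA LB i Φ) (X : Sec E FA A) : Sec E FC C →ₗ[ℝ] Sec E FC C where
  toFun c := (h.exists_ad X c).choose
  map_add' c c' := h.app_injective <| by
    refine (h.exists_ad X _).choose_spec.trans ?_
    refine Eq.trans ?_ ((app_add i _ _).trans (congrArg₂ (· + ·) (h.exists_ad X c).choose_spec
      (h.exists_ad X c').choose_spec)).symm
    rw [app_add, map_add]
  map_smul' r c := h.app_injective <| by
    have hr : ∀ c, i.app (r • c) = r • i.app c := app_fsmul i (ContMDiffMap.const r)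
    refine (h.exists_ad X _).choose_spec.trans ?_
    refine Eq.trans ?_ ((hr _).trans (congrArg (r • ·) (h.exists_ad X c).choose_spec)).symm
    rw [hr, map_smul]

lemma app_ad (h : IsExtension LC LA LB i Φ) (X : Sec E FA A) (c : Sec E FC C) :
    i.app (h.ad X c) = LA.bracket X (i.app c) :=
  (h.exists_ad X c).choose_spec

lemma app_ad_apply (h : IsExtension LC LA LB i Φ) (X : Sec E FA A) (c : Sec E FC C) (m : M) :
    i m (h.ad X c m) = LA.bracket X (i.app c) m :=
  congrArg (fun a : Sec E FA A => a m) (h.app_ad X c)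

lemma isDer_ad (h : IsExtension LC LA LB i Φ) (X : Sec E FA A) :
    IsDer (LA.anchor.app X) (h.ad X) := fun m f c => by
  refine h.injective m ?_
  refine (h.app_ad_apply X _ m).trans ?_
  rw [app_fsmul, LA.leibniz, map_add, map_smul, map_smul]
  change _ = f m • i m (h.ad X c m) + _
  rw [h.app_ad_apply]
  rfl

lemma ad_add (h : IsExtension LC LA LB i Φ) (X Y : Sec E FA A) (c : Sec E FC C) :
    h.ad (X + Y) c = h.ad X c + h.ad Y c :=
  h.app_injective <| by
    rw [app_add, h.app_ad, h.app_ad, h.app_ad, map_add]; rfl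

lemma ad_fsmul (h : IsExtension LC LA LB i Φ) (f : Fn E M) (X : Sec E FA A) (c : Sec E FC C) :
    h.ad (fsmul f X) c = fsmul f (h.ad X c) :=
  h.app_injective <| by
    rw [app_fsmul, h.app_ad, h.app_ad, bracket_fsmul_left, h.anchor_app_app]
    ext m
    change f m • LA.bracket X (i.app c) m - mvfderiv 𝓘(ℝ, E) f m 0 • X m = _
    rw [map_zero, zero_smul, sub_zero]; rfl

lemma ad_bracket (h : IsExtension LC LA LB i Φ) (X Y : Sec E FA A) (c : Sec E FC C) :
    h.ad X (h.ad Y c) - h.ad Y (h.ad X c) = h.ad (LA.bracket X Y) c :=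
  sub_eq_iff_eq_add.2 <| h.app_injective <| by
    rw [app_add, h.app_ad, h.app_ad, h.app_ad, h.app_ad, h.app_ad, LA.jacobi]

/-- On sections of `C`, the adjoint action is the bracket of `C`. -/
lemma ad_app (h : IsExtension LC LA LB i Φ) (c c' : Sec E FC C) :
    h.ad (i.app c) c' = LC.bracket c c' :=
  h.app_injective <| by rw [h.app_ad, h.hom_left.bracket]

/-- The derivations of `∧^top C` induced by the adjoint action form a representation of `A`. They are
linear over the functions because the anchor vanishes on `C`. -/
lemma exists_adjointRep (h : IsExtension LC LA LB i Φ) : ∃ D :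
    LA.Rep ℝ (TopPow FC C), ∀ X, D.D X = topDer (h.isDer_ad X) :=
  exists_rep_of_generators (fun X => topDer (h.isDer_ad X)) (fun X => isDer_topDer (h.isDer_ad X))
    (Set.range wedgeSec)
    (fun m => by
      obtain ⟨s, -, -, hs⟩ := exists_wedgeSec_ne_zero (E := E) (F := FC) (V := C) m
      exact ⟨_, ⟨s, rfl⟩, hs⟩)
    (by rintro X Y _ ⟨s, rfl⟩; exact topDer_add _ _ _ (h.ad_add X Y) s)
    (by
      rintro f X _ ⟨s, rfl⟩
      ext m
      have := topDer_rankOne (h.isDer_ad X) (h.isDer_ad (fsmul f X)) (m := m) (f m) 0 0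
        (fun c => by rw [h.ad_fsmul, smul_zero, add_zero]; rfl) s
      rwa [LinearMap.zero_apply, zero_smul, add_zero] at this)
    (by
      rintro X Y _ ⟨s, rfl⟩
      exact (LinearMap.congr_fun (topDer_commutator (h.isDer_ad X) (h.isDer_ad Y)) _).trans
        (topDer_congr _ _ (h.ad_bracket X Y) s))

/-- The representation of `A` on `∧^top C` induced by the adjoint action. -/
def adjointRep (h : IsExtension LC LA LB i Φ) : LA.Rep ℝ (TopPow FC C) := h.exists_adjointRep.choose

lemma adjointRep_wedgeSec_apply (h : IsExtension LC LA LB i Φ) (X : Sec E FA A) (k :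
    Fin (finrank ℝ FC) → Sec E FC C) (m : M) :
    h.adjointRep.D X (wedgeSec k) m = ∑ j, wedge (update (fun l => k l m) j (h.ad X (k j) m)) := by
  rw [adjointRep, h.exists_adjointRep.choose_spec, topDer_wedgeSec_apply]

lemma map_wedge (φ : BundleMap E FC C FA A) {m : M} (v : Fin (finrank ℝ FC) → C m) :
    exteriorPower.map (finrank ℝ FC) (φ m : C m →ₗ[ℝ] A m) (wedge v) =
      exteriorPower.ιMulti ℝ (finrank ℝ FC) fun j => φ m (v j) :=
  exteriorPower.map_apply_ιMulti _ _

lemma isAdjointTop_adjointRep (h : IsExtension LC LA LB i Φ) :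
    IsAdjointTop LA i h.adjointRep := fun X k m => by
  rw [h.adjointRep_wedgeSec_apply]
  refine (map_sum (exteriorPower.map (finrank ℝ FC) (i m : C m →ₗ[ℝ] A m)) _ _).trans ?_
  refine Finset.sum_congr rfl fun j _ => ?_
  rw [map_wedge]
  congr 1
  ext l
  by_cases hl : l = j
  · subst hl; simp [h.app_ad_apply]
  · simp [hl, app_apply]

lemma isAdjointTop_unique (h : IsExtension LC LA LB i Φ) {D D' : LA.Rep ℝ (TopPow FC C)} (hD :
    IsAdjointTop LA i D)
    (hD' : IsAdjointTop LA i D') : D = D' :=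
  LieAlgebroid.Rep.ext fun X => (D.isDer X).top_ext (D'.isDer X) fun k => by
    ext m
    exact exteriorPower.map_injective_field (h.injective m) ((hD X k m).trans (hD' X k m).symm)

end IsExtension

end Extension

/-! ### Unimodular kernels -/

section Unimodular

variable {E : Type*} [NormedAddCommGroup E] [NormedSpace ℝ E] [FiniteDimensional ℝ E]
  {M : Type*} [TopologicalSpace M] [ChartedSpace E M] [IsManifold 𝓘(ℝ, E) ∞ M] [T2Space M]
  {F : Type*} [NormedAddCommGroup F] [NormedSpace ℝ F] [FiniteDimensional ℝ F]
  {A : M → Type*}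
  [∀ m, AddCommGroup (A m)] [∀ m, Module ℝ (A m)]
  [TopologicalSpace (TotalSpace F A)] [∀ m, TopologicalSpace (A m)] [FiberBundle F A]
  [VectorBundle ℝ F A] [ContMDiffVectorBundle ∞ F A 𝓘(ℝ, E)]
  {LA : LieAlgebroid E F A}
  {L : M → Type*} [∀ m, AddCommGroup (L m)] [∀ m, Module ℝ (L m)]
  [TopologicalSpace (TotalSpace ℝ L)] [∀ m, TopologicalSpace (L m)] [FiberBundle ℝ L]
  [VectorBundle ℝ ℝ L] [ContMDiffVectorBundle ∞ ℝ L 𝓘(ℝ, E)]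

lemma isDer_zero : IsDer (0 : Sec E E (Tan E (M := M))) (0 : Sec E F A →ₗ[ℝ] Sec E F A) :=
  fun m f s => by
    change (0 : A m) = f m • (0 : A m) + mvfderiv 𝓘(ℝ, E) f m 0 • s m
    rw [map_zero, zero_smul, smul_zero, add_zero]

/-- If the anchor vanishes, there are no nonzero coboundaries, so that a representation on a line
bundle with vanishing characteristic class is zero. -/
lemma LieAlgebroid.IsCharClass.eq_zero (hLA : ∀ a, LA.anchor.app a = 0) {D : LA.Rep ℝ L}
    (h : IsCharClass D 0) (a : Sec E F A) : D.D a = 0 := by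
  obtain ⟨D₂, hD₂, y, hy, β, hβ, h0⟩ := h.exists_square
  have hmk : β ∈ LA.coboundaries := by
    have h1 := congrArg (fun c : LA.H1 => (2 : ℝ) • c) h0.symm
    rw [smul_zero, smul_smul] at h1
    norm_num at h1
    exact h1
  obtain ⟨f, hf⟩ := hmk
  have hβ0 : ∀ m, pair β.1 a m = 0 := fun m => by
    rw [hf, deriv_eq, hLA]
    exact map_zero (mvfderiv 𝓘(ℝ, E) f m)
  -- `D₂ = D ⊗ D` vanishes on a nowhere-vanishing section and is linear over the functions
  have h2 : D₂.D a = 0 := (D₂.isDer a).line_ext (by rw [hLA]; exact isDer_zero) fun m =>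
    ⟨y, hy m, by rw [hβ, hβ0, zero_smul]; rfl⟩
  refine (D.isDer a).line_ext (by rw [hLA]; exact isDer_zero) fun m => ?_
  obtain ⟨τ, hτ⟩ := exists_sec_ne_zero (E := E) L m
  refine ⟨τ, hτ, ?_⟩
  obtain ⟨r, hr⟩ := exists_smul_of_line hτ (D.D a τ m)
  have h3 := congrArg (fun s : Sec E ℝ (LineTensor L L) => s m) (hD₂ a τ τ)
  simp only [h2, ← tensorPairing_B, ContMDiffSection.coe_add, Pi.add_apply, LinePairing.B_apply,
    hr, map_smul, LinearMap.smul_apply] at h3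
  have h4 : (2 * r) • (tensorPairing E L L).J m (τ m) (τ m) = 0 := by
    rw [two_mul, add_smul]; exact h3.symm
  have h5 := (smul_eq_zero.1 h4).resolve_right ((tensorPairing E L L).nondeg m _ _ hτ hτ)
  have h6 : r = 0 := by linarith
  rw [hr, h6, zero_smul]; rfl

/-- A unimodular Lie algebroid with vanishing anchor acts trivially on its top exterior power. -/
lemma gerstenhaber_eq_zero (hLA : ∀ a, LA.anchor.app a = 0) (h : LA.IsModClass 0) (a : Sec E F A)
    (s : Fin (finrank ℝ F) → Sec E F A) (m : M) : LA.gerstenhaber a s m = 0 := by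
  obtain ⟨D, hD, hc⟩ := h
  obtain ⟨ξ, -, -, hξ⟩ := exists_wedgeSec_ne_zero (E := E) (F := E →L[ℝ] ℝ)
    (V := Cotan E (M := M)) m
  have h1 := hD a s ξ m
  have h0 : ∀ η : DualSec E E (Tan E (M := M)), lieSec (0 : Sec E E (Tan E (M := M))) η = 0 :=
    fun η => by
      have := lieSec_add (0 : Sec E E (Tan E (M := M))) 0 η
      rwa [add_zero, left_eq_add] at this
  have h2 : lieDerivTop (LA.anchor.app a) ξ m = 0 := by
    rw [← topLie_wedgeSec_apply, topLie, topDer_wedgeSec_apply]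
    refine Finset.sum_eq_zero fun j _ => ?_
    rw [hLA, h0]
    exact (wedgeAlt _ _ m).map_update_zero _ j
  rw [hc.eq_zero hLA, h2] at h1
  by_contra hne
  refine tmul_ne_zero (L₁ := TopPow F A) hne hξ ?_
  refine Eq.trans ?_ h1.symm
  exact ((congrArg₂ (· + ·) rfl (TensorProduct.tmul_zero _ _)).trans (add_zero _)).symm

end Unimodular

section Extension

variable {E : Type*} [NormedAddCommGroup E] [NormedSpace ℝ E] [FiniteDimensional ℝ E]
  {M : Type*} [TopologicalSpace M] [ChartedSpace E M] [IsManifold 𝓘(ℝ, E) ∞ M] [T2Space M]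
  {FA : Type*} [NormedAddCommGroup FA] [NormedSpace ℝ FA] [FiniteDimensional ℝ FA]
  {A : M → Type*} [∀ m, AddCommGroup (A m)] [∀ m, Module ℝ (A m)]
  [TopologicalSpace (TotalSpace FA A)] [∀ m, TopologicalSpace (A m)] [FiberBundle FA A]
  [VectorBundle ℝ FA A] [ContMDiffVectorBundle ∞ FA A 𝓘(ℝ, E)]
  [∀ m, IsTopologicalAddGroup (A m)] [∀ m, ContinuousSMul ℝ (A m)]
  {FB : Type*} [NormedAddCommGroup FB] [NormedSpace ℝ FB] [FiniteDimensional ℝ FB]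
  {B : M → Type*} [∀ m, AddCommGroup (B m)] [∀ m, Module ℝ (B m)]
  [TopologicalSpace (TotalSpace FB B)] [∀ m, TopologicalSpace (B m)] [FiberBundle FB B]
  [VectorBundle ℝ FB B] [ContMDiffVectorBundle ∞ FB B 𝓘(ℝ, E)]
  [∀ m, IsTopologicalAddGroup (B m)] [∀ m, ContinuousSMul ℝ (B m)]
  {FC : Type*} [NormedAddCommGroup FC] [NormedSpace ℝ FC] [FiniteDimensional ℝ FC]
  {C : M → Type*} [∀ m, AddCommGroup (C m)] [∀ m, Module ℝ (C m)]
  [TopologicalSpace (TotalSpace FC C)] [∀ m, TopologicalSpace (C m)] [FiberBundle FC C]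
  [VectorBundle ℝ FC C] [ContMDiffVectorBundle ∞ FC C 𝓘(ℝ, E)]

namespace IsExtension

variable {LC : LieAlgebroid E FC C} {LA : LieAlgebroid E FA A} {LB : LieAlgebroid E FB B}
  {i : BundleMap E FC C FA A} {Φ : BundleMap E FA A FB B}

/-- If `C` is unimodular, then the sections of `C` act trivially on `∧^top C`. -/
lemma adjointRep_app_eq_zero [SigmaCompactSpace M] (h : IsExtension LC LA LB i Φ)
    (hC : LC.IsUnimodular) (c : Sec E FC C) : h.adjointRep.D (i.app c) = 0 := by
  have hC' : LC.IsModClass 0 := hC ▸ isModClass_modClass LC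
  refine (h.adjointRep.isDer _).top_ext (by rw [h.anchor_app_app]; exact isDer_zero) fun k => ?_
  ext m
  rw [h.adjointRep_wedgeSec_apply]
  simp only [h.ad_app]
  exact gerstenhaber_eq_zero h.anchor_app_left hC' c k m

/-- If `C` is unimodular, then the adjoint representation on `∧^top C` descends to `B`, by choosing
lifts of the sections of `B` to `A`. -/
lemma exists_quotientRep [SigmaCompactSpace M] (h : IsExtension LC LA LB i Φ)
    (hC : LC.IsUnimodular) :
    ∃ D : LB.Rep ℝ (TopPow FC C), ∀ X, D.D (Φ.app X) = h.adjointRep.D X := by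
  have key : ∀ {X Y}, Φ.app X = Φ.app Y → h.adjointRep.D X = h.adjointRep.D Y := fun {X Y} hXY => by
    obtain ⟨c, hc⟩ := h.exists_app_eq_of_app_eq_zero (a := X - Y) (by
      have := app_add Φ (X - Y) Y
      rw [sub_add_cancel, hXY] at this
      exact right_eq_add.1 this)
    have := h.adjointRep_app_eq_zero hC c
    rwa [hc, map_sub, sub_eq_zero] at this
  choose ℓ hℓ using h.exists_app_eq
  obtain ⟨R, hR⟩ := exists_rep_of_generators (LA := LB) (fun b => h.adjointRep.D (ℓ b))
    (fun b => by
      have := h.adjointRep.isDer (ℓ b)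
      rwa [← h.anchor_app_right, hℓ] at this)
    Set.univ
    (fun m => by
      obtain ⟨x, hx⟩ := exists_sec_ne_zero (E := E) (TopPow FC C) m
      exact ⟨x, Set.mem_univ x, hx⟩)
    (fun a b x _ => by
      rw [← LinearMap.add_apply, ← map_add]
      exact LinearMap.congr_fun (key (by rw [app_add, hℓ, hℓ, hℓ])) x)
    (fun f a x _ => by
      rw [← h.adjointRep.smul_left]
      exact LinearMap.congr_fun (key (by rw [app_fsmul, hℓ, hℓ])) x)
    (fun a b x _ => by
      rw [h.adjointRep.flat]
      exact LinearMap.congr_fun (key (by rw [h.hom_right.bracket, hℓ, hℓ, hℓ])) x)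
  exact ⟨R, fun X => by rw [hR]; exact key (hℓ _)⟩

end IsExtension

end Extension

/-! ### The modular class of an extension -/

section TensorRight

variable {E : Type*} [NormedAddCommGroup E] [NormedSpace ℝ E] [FiniteDimensional ℝ E]
  {M : Type*} [TopologicalSpace M] [ChartedSpace E M] [IsManifold 𝓘(ℝ, E) ∞ M] [T2Space M]
  {L₁ : M → Type*} [∀ m, AddCommGroup (L₁ m)] [∀ m, Module ℝ (L₁ m)]
  [TopologicalSpace (TotalSpace ℝ L₁)] [∀ m, TopologicalSpace (L₁ m)] [FiberBundle ℝ L₁]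
  [VectorBundle ℝ ℝ L₁] [ContMDiffVectorBundle ∞ ℝ L₁ 𝓘(ℝ, E)]
  {L₂ : M → Type*} [∀ m, AddCommGroup (L₂ m)] [∀ m, Module ℝ (L₂ m)]
  [TopologicalSpace (TotalSpace ℝ L₂)] [∀ m, TopologicalSpace (L₂ m)] [FiberBundle ℝ L₂]
  [VectorBundle ℝ ℝ L₂] [ContMDiffVectorBundle ∞ ℝ L₂ 𝓘(ℝ, E)]
  {L₃ : M → Type*} [∀ m, AddCommGroup (L₃ m)] [∀ m, Module ℝ (L₃ m)]
  [TopologicalSpace (TotalSpace ℝ L₃)] [∀ m, TopologicalSpace (L₃ m)] [FiberBundle ℝ L₃]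
  [VectorBundle ℝ ℝ L₃] [ContMDiffVectorBundle ∞ ℝ L₃ 𝓘(ℝ, E)]
  (N : M → Type*) [∀ m, AddCommGroup (N m)] [∀ m, Module ℝ (N m)]
  [TopologicalSpace (TotalSpace ℝ N)] [∀ m, TopologicalSpace (N m)] [FiberBundle ℝ N]
  [VectorBundle ℝ ℝ N] [ContMDiffVectorBundle ∞ ℝ N 𝓘(ℝ, E)]

/-- The pairing `(v, w ⊗ n) ↦ J(v, w) ⊗ n`. -/
def tensorRightMap {m : M} (J : L₁ m →ₗ[ℝ] L₂ m →ₗ[ℝ] L₃ m) :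
    L₁ m →ₗ[ℝ] LineTensor L₂ N m →ₗ[ℝ] LineTensor L₃ N m :=
  LinearMap.rTensorHom (N m) ∘ₗ J

/-- A pairing `L₁ × L₂ → L₃` induces a pairing `L₁ × (L₂ ⊗ N) → L₃ ⊗ N`. -/
def LinePairing.tensorRight (p : LinePairing E L₁ L₂ L₃) :
    LinePairing E L₁ (LineTensor L₂ N) (LineTensor L₃ N) :=
  LinePairing.ofFrames (fun m => tensorRightMap N (p.J m))
    (fun m v z hv hz => by
      obtain ⟨τ, hτ⟩ := exists_sec_ne_zero (E := E) L₂ m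
      obtain ⟨ν, hν⟩ := exists_sec_ne_zero (E := E) N m
      obtain ⟨d, rfl⟩ := exists_eq_tmul_smul hτ hν z
      rw [map_smul]
      exact smul_ne_zero (left_ne_zero_of_smul hz) (tmul_ne_zero (p.nondeg m _ _ hv hτ) hν))
    (fun x => by
      obtain ⟨τ₁, hτ₁⟩ := exists_sec_ne_zero (E := E) L₁ x
      obtain ⟨τ₂, hτ₂⟩ := exists_sec_ne_zero (E := E) L₂ x
      obtain ⟨ν, hν⟩ := exists_sec_ne_zero (E := E) N x
      refine ⟨τ₁, tensorSec τ₂ ν, tensorSec (p.B τ₁ τ₂) ν, hτ₁, tmul_ne_zero hτ₂ hν, fun y => ?_⟩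
      change _ = tmul (p.B τ₁ τ₂ y) (ν y)
      rw [p.B_apply]
      rfl)

lemma LinePairing.tensorRight_leibniz (p : LinePairing E L₁ L₂ L₃) {m : M} (v v' : L₁ m)
    (w w' : L₂ m) (n n' : N m) :
    tmul (p.J m v' w + p.J m v w') n + tmul (p.J m v w) n' =
      (p.tensorRight N).J m v' (tmul w n) + (p.tensorRight N).J m v (tmul w' n + tmul w n') := by
  have h : ∀ v w n, (p.tensorRight N).J m v (tmul w n) = tmul (p.J m v w) n := fun _ _ _ => rfl
  rw [map_add, h, h, h, ← add_assoc]
  congr 1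
  exact TensorProduct.add_tmul _ _ _

lemma LinePairing.tensorRight_B (p : LinePairing E L₁ L₂ L₃) (s : Sec E ℝ L₁) (t : Sec E ℝ L₂)
    (ν : Sec E ℝ N) : (p.tensorRight N).B s (tensorSec t ν) = tensorSec (p.B s t) ν := by
  ext m
  rw [(p.tensorRight N).B_apply]
  change _ = tmul (p.B s t m) (ν m)
  rw [p.B_apply]
  rfl

end TensorRight

section Extension

variable {E : Type*} [NormedAddCommGroup E] [NormedSpace ℝ E] [FiniteDimensional ℝ E]
  {M : Type*} [TopologicalSpace M] [ChartedSpace E M] [IsManifold 𝓘(ℝ, E) ∞ M] [T2Space M]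
  {FA : Type*} [NormedAddCommGroup FA] [NormedSpace ℝ FA] [FiniteDimensional ℝ FA]
  {A : M → Type*} [∀ m, AddCommGroup (A m)] [∀ m, Module ℝ (A m)]
  [TopologicalSpace (TotalSpace FA A)] [∀ m, TopologicalSpace (A m)] [FiberBundle FA A]
  [VectorBundle ℝ FA A] [ContMDiffVectorBundle ∞ FA A 𝓘(ℝ, E)]
  [∀ m, IsTopologicalAddGroup (A m)] [∀ m, ContinuousSMul ℝ (A m)]
  {FB : Type*} [NormedAddCommGroup FB] [NormedSpace ℝ FB] [FiniteDimensional ℝ FB]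
  {B : M → Type*} [∀ m, AddCommGroup (B m)] [∀ m, Module ℝ (B m)]
  [TopologicalSpace (TotalSpace FB B)] [∀ m, TopologicalSpace (B m)] [FiberBundle FB B]
  [VectorBundle ℝ FB B] [ContMDiffVectorBundle ∞ FB B 𝓘(ℝ, E)]
  [∀ m, IsTopologicalAddGroup (B m)] [∀ m, ContinuousSMul ℝ (B m)]
  {FC : Type*} [NormedAddCommGroup FC] [NormedSpace ℝ FC] [FiniteDimensional ℝ FC]
  {C : M → Type*} [∀ m, AddCommGroup (C m)] [∀ m, Module ℝ (C m)]
  [TopologicalSpace (TotalSpace FC C)] [∀ m, TopologicalSpace (C m)] [FiberBundle FC C]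
  [VectorBundle ℝ FC C] [ContMDiffVectorBundle ∞ FC C 𝓘(ℝ, E)]

namespace IsExtension

variable {LC : LieAlgebroid E FC C} {LA : LieAlgebroid E FA A} {LB : LieAlgebroid E FB B}
  {i : BundleMap E FC C FA A} {Φ : BundleMap E FA A FB B}

/-- Adapted bases of the fibres of an extension. -/
lemma exists_fibreBasis (h : IsExtension LC LA LB i Φ) (m : M) :
    ∃ (bC : Basis (Fin (finrank ℝ FC)) ℝ (C m)) (bB : Basis (Fin (finrank ℝ FB)) ℝ (B m))
      (s : Fin (finrank ℝ FB) → A m) (bA : Basis (Fin (finrank ℝ FC) ⊕ Fin (finrank ℝ FB)) ℝ (A m)),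
      (∀ k, Φ m (s k) = bB k) ∧ ∀ j, bA j = Sum.elim (fun j => i m (bC j)) s j := by
  choose s hs using fun k => h.surjective m (fibreBasis FB B m k)
  obtain ⟨bA, hbA⟩ := exists_basis_of_exact (i := (i m : C m →ₗ[ℝ] A m))
    (φ := (Φ m : A m →ₗ[ℝ] B m)) (h.injective m) (h.exact m) (fibreBasis FC C m)
    (fibreBasis FB B m) hs
  exact ⟨_, _, s, bA, hs, hbA⟩

/-- An enumeration of an adapted frame of `A`. Over the empty manifold, the dimensions of the model
fibres need not add up. -/
lemma nonempty_equiv [Nonempty M] (h : IsExtension LC LA LB i Φ) :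
    Nonempty (Fin (finrank ℝ FC) ⊕ Fin (finrank ℝ FB) ≃ Fin (finrank ℝ FA)) := by
  obtain ⟨m⟩ := ‹Nonempty M›
  obtain ⟨-, -, -, bA, -⟩ := h.exists_fibreBasis m
  exact ⟨bA.indexEquiv (fibreBasis FA A m)⟩

/-- The fibrewise isomorphism `∧^top C ⊗ ∧^top B ≅ ∧^top A`: the wedge product of elements of `C` and
lifts of elements of `B`. -/
lemma exists_wedgeMap (h : IsExtension LC LA LB i Φ)
    (e : Fin (finrank ℝ FC) ⊕ Fin (finrank ℝ FB) ≃ Fin (finrank ℝ FA)) (m : M) :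
    ∃ J : TopPow FC C m →ₗ[ℝ] TopPow FB B m →ₗ[ℝ] TopPow FA A m,
      ∀ (k : Fin (finrank ℝ FC) → C m) (a : Fin (finrank ℝ FB) → A m),
        J (wedge k) (wedge fun l => Φ m (a l)) = wedge (Sum.elim (fun j => i m (k j)) a ∘ e.symm) := by
  obtain ⟨bC, bB, s, bA, hs, hbA⟩ := h.exists_fibreBasis m
  let f : TopPow FC C m →ₗ[ℝ] ℝ := exteriorPower.alternatingMapLinearEquiv bC.det
  let g : TopPow FB B m →ₗ[ℝ] ℝ := exteriorPower.alternatingMapLinearEquiv bB.det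
  have hf : ∀ v, f (wedge v) = bC.det v := fun v =>
    exteriorPower.alternatingMapLinearEquiv_apply_ιMulti _ _
  have hg : ∀ v, g (wedge v) = bB.det v := fun v =>
    exteriorPower.alternatingMapLinearEquiv_apply_ιMulti _ _
  let w : TopPow FA A m := wedge (bA ∘ e.symm)
  have hw : ∀ v : Fin (finrank ℝ FC) ⊕ Fin (finrank ℝ FB) → A m,
      (wedge (v ∘ e.symm) : TopPow FA A m) = bA.det v • w := by
    let T := (wedgeAlt FA A m).domDomCongr e.symm -
      (LinearMap.toSpanSingleton ℝ _ w).compAlternatingMap bA.det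
    have hT : T = 0 := by
      refine alternating_eq_zero (ev := LinearMap.id) T (fun s j hs => T.map_coord_zero j hs) bA
        (e := bA) (fun _ => rfl) ?_
      change wedge (bA ∘ e.symm) - bA.det bA • w = 0
      rw [bA.det_self, one_smul, sub_self]
    exact fun v => sub_eq_zero.1 (AlternatingMap.congr_fun hT v)
  refine ⟨((LinearMap.mul ℝ ℝ).compl₁₂ f g).compr₂ (LinearMap.toSpanSingleton ℝ _ w),
    fun k a => ?_⟩
  change (f (wedge k) * g (wedge fun l => Φ m (a l))) • w = _
  rw [hw, hf, hg]
  congr 1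
  exact (det_sumElim (i := (i m : C m →ₗ[ℝ] A m)) (φ := (Φ m : A m →ₗ[ℝ] B m)) (h.exact m) bC bB hs
    bA hbA k a).symm

/-- The family of sections of `A` that consists of the images of sections `k` of `C` and of sections
`s` of `A`, enumerated by `e`. -/
def sumSec (i : BundleMap E FC C FA A)
    (e : Fin (finrank ℝ FC) ⊕ Fin (finrank ℝ FB) ≃ Fin (finrank ℝ FA))
    (k : Fin (finrank ℝ FC) → Sec E FC C) (s : Fin (finrank ℝ FB) → Sec E FA A) :
    Fin (finrank ℝ FA) → Sec E FA A :=
  Sum.elim (fun j => i.app (k j)) s ∘ e.symm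

lemma sumSec_apply (i : BundleMap E FC C FA A)
    (e : Fin (finrank ℝ FC) ⊕ Fin (finrank ℝ FB) ≃ Fin (finrank ℝ FA))
    (k : Fin (finrank ℝ FC) → Sec E FC C) (s : Fin (finrank ℝ FB) → Sec E FA A) (m : M) :
    (fun l => sumSec i e k s l m) =
      Sum.elim (fun j => i m (k j m)) (fun l => s l m) ∘ e.symm := by
  ext l
  simp only [sumSec, comp_apply]
  rcases e.symm l with j | j <;> rfl

/-- The isomorphism `∧^top C ⊗ ∧^top B ≅ ∧^top A` of line bundles. -/
lemma exists_wedgePairing (h : IsExtension LC LA LB i Φ)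
    (e : Fin (finrank ℝ FC) ⊕ Fin (finrank ℝ FB) ≃ Fin (finrank ℝ FA)) :
    ∃ p : LinePairing E (TopPow FC C) (TopPow FB B) (TopPow FA A),
      ∀ (m : M) (k : Fin (finrank ℝ FC) → C m) (a : Fin (finrank ℝ FB) → A m),
        p.J m (wedge k) (wedge fun l => Φ m (a l)) =
          wedge (Sum.elim (fun j => i m (k j)) a ∘ e.symm) := by
  choose J hJ using h.exists_wedgeMap e
  refine ⟨LinePairing.ofFrames J (fun m v w hv hw => ?_) (fun x => ?_), hJ⟩
  · obtain ⟨bC, bB, s, bA, hs, hbA⟩ := h.exists_fibreBasis m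
    obtain ⟨c, rfl⟩ := exists_smul_of_line (wedge_basis_ne_zero bC) v
    obtain ⟨d, rfl⟩ := exists_smul_of_line (wedge_basis_ne_zero bB) w
    rw [map_smul, map_smul, LinearMap.smul_apply]
    refine smul_ne_zero (left_ne_zero_of_smul hw) (smul_ne_zero (left_ne_zero_of_smul hv) ?_)
    have h1 := hJ m bC s
    rw [show (fun l => Φ m (s l)) = bB from funext hs] at h1
    rw [h1]
    have h2 : Sum.elim (fun j => i m (bC j)) s ∘ e.symm = bA.reindex e := by
      ext l
      rw [Basis.reindex_apply, hbA]; rfl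
    rw [h2]
    exact wedge_basis_ne_zero _
  · obtain ⟨k, s, bC, bB, hk, hs⟩ := h.exists_frames x
    refine ⟨wedgeSec k, wedgeSec fun l => Φ.app (s l), wedgeSec (sumSec i e k s), ?_, ?_,
      fun y => ?_⟩
    · exact (congrArg wedge (funext hk)).trans_ne (wedge_basis_ne_zero bC)
    · exact (congrArg wedge (funext hs)).trans_ne (wedge_basis_ne_zero bB)
    · exact (hJ y _ _).trans (congrArg wedge (sumSec_apply i e k s y).symm)

/-- The isomorphism `∧^top C ⊗ ∧^top B ≅ ∧^top A` is compatible with the adjoint actions: the bracket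
with `X` differentiates the factors from `C` through the adjoint action, and the lifts through the
bracket of `B` with `Φ(X)`. -/
lemma gerstenhaber_sumSec (h : IsExtension LC LA LB i Φ)
    (e : Fin (finrank ℝ FC) ⊕ Fin (finrank ℝ FB) ≃ Fin (finrank ℝ FA))
    (p : LinePairing E (TopPow FC C) (TopPow FB B) (TopPow FA A))
    (hp : ∀ (m : M) (k : Fin (finrank ℝ FC) → C m) (a : Fin (finrank ℝ FB) → A m),
      p.J m (wedge k) (wedge fun l => Φ m (a l)) =
        wedge (Sum.elim (fun j => i m (k j)) a ∘ e.symm))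
    (X : Sec E FA A) (k : Fin (finrank ℝ FC) → Sec E FC C) (s : Fin (finrank ℝ FB) → Sec E FA A)
    (m : M) : (LA.gerstenhaber X (sumSec i e k s) m : TopPow FA A m) =
      p.J m (h.adjointRep.D X (wedgeSec k) m) (wedgeSec (fun l => Φ.app (s l)) m) +
        p.J m (wedgeSec k m) (LB.gerstenhaber (Φ.app X) (fun l => Φ.app (s l)) m) := by
  have h1 : (LA.gerstenhaber X (sumSec i e k s) m : TopPow FA A m) =
      ∑ q, wedge (update (Sum.elim (fun j => i m (k j m)) fun l => s l m) q
        (LA.bracket X (Sum.elim (fun j => i.app (k j)) s q) m) ∘ e.symm) := by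
    refine (e.sum_comp _).symm.trans (Finset.sum_congr rfl fun q _ => ?_)
    refine congrArg (wedge (F := FA)) ?_
    rw [sumSec_apply, update_comp_equiv, e.symm_symm]
    simp [sumSec]
  rw [h1, Fintype.sum_sum_type, h.adjointRep_wedgeSec_apply]
  congr 1
  · rw [map_sum, LinearMap.sum_apply]
    refine Finset.sum_congr rfl fun j _ => ?_
    refine Eq.trans ?_ (hp m _ fun l => s l m).symm
    refine congrArg (fun v => wedge (F := FA) (v ∘ e.symm)) ?_
    rw [Sum.update_elim_inl]
    congr 1
    ext l
    by_cases hl : l = j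
    · subst hl; simp [h.app_ad_apply]
    · simp [hl]
  · refine Eq.trans ?_ (map_sum (p.J m (wedgeSec k m)) _ _).symm
    refine Finset.sum_congr rfl fun l _ => ?_
    have h2 : update (fun l' => Φ.app (s l') m) l (LB.bracket (Φ.app X) (Φ.app (s l)) m) =
        fun l' => Φ m (update (fun l' => s l' m) l (LA.bracket X (s l) m) l') := by
      ext l'
      by_cases hl : l' = l
      · subst hl
        simp [← h.hom_right.bracket, app_apply]
      · simp [hl, app_apply]
    refine Eq.trans ?_ (congrArg (fun v => p.J m (wedgeSec k m) (wedge v)) h2.symm)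
    refine Eq.trans ?_ (hp m (fun j => k j m) _).symm
    rw [Sum.update_elim_inr]
    rfl

set_option maxHeartbeats 1000000 in
/-- `∧^top C ⊗ L^B ≅ L^A` as representations of `A`, where `L^A = ∧^top A ⊗ ∧^top T^*M`. -/
lemma exists_isProductRep (h : IsExtension LC LA LB i Φ)
    (e : Fin (finrank ℝ FC) ⊕ Fin (finrank ℝ FB) ≃ Fin (finrank ℝ FA))
    {DA : LA.Rep ℝ (ModLine E FA A)} (hDA : LA.IsModularRep DA)
    {DB : LB.Rep ℝ (ModLine E FB B)} (hDB : LB.IsModularRep DB) :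
    ∃ p : LinePairing E (TopPow FC C) (ModLine E FB B) (ModLine E FA A),
      IsProductRep p h.adjointRep (h.hom_right.pullRep DB) DA := by
  obtain ⟨p, hp⟩ := h.exists_wedgePairing e
  refine ⟨p.tensorRight _, isProductRep_of_frames _ fun X m => ?_⟩
  obtain ⟨k, s, bC, bB, hk, hs⟩ := h.exists_frames m
  obtain ⟨ξ, -, -, hξ⟩ := exists_wedgeSec_ne_zero (E := E) (F := E →L[ℝ] ℝ)
    (V := Cotan E (M := M)) m
  have hk' : wedgeSec k m ≠ 0 := (congrArg wedge (funext hk)).trans_ne (wedge_basis_ne_zero bC)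
  have hs' : wedgeSec (fun l => Φ.app (s l)) m ≠ 0 :=
    (congrArg wedge (funext hs)).trans_ne (wedge_basis_ne_zero bB)
  refine ⟨wedgeSec k, tensorSec (wedgeSec fun l => Φ.app (s l)) (wedgeSec ξ), hk',
    tmul_ne_zero hs' hξ, ?_⟩
  have hB : p.B (wedgeSec k) (wedgeSec fun l => Φ.app (s l)) = wedgeSec (sumSec i e k s) := by
    ext y
    rw [p.B_apply]
    exact (hp y _ _).trans (congrArg wedge (sumSec_apply i e k s y).symm)
  have hBm : wedgeSec (sumSec i e k s) m =
      p.J m (wedgeSec k m) (wedgeSec (fun l => Φ.app (s l)) m) := by rw [← p.B_apply, hB]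
  have h2 := hDB (Φ.app X) (fun l => Φ.app (s l)) ξ m
  rw [h.anchor_app_right] at h2
  rw [p.tensorRight_B (TopPow (E →L[ℝ] ℝ) (Cotan E (M := M))), hB, hDA, hBm,
    h.gerstenhaber_sumSec e p hp, h.hom_right.pullRep_D, h2]
  exact p.tensorRight_leibniz _ _ _ _ _ _ _

end IsExtension

/-- The space `H¹` over the empty manifold is zero. -/
lemma subsingleton_H1 [IsEmpty M] (LA : LieAlgebroid E FA A) : Subsingleton LA.H1 := by
  have h1 : Subsingleton LA.cocycles := ⟨fun α β => Subtype.ext <| by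
    ext m
    exact (IsEmpty.false m).elim⟩
  exact (Submodule.mkQ_surjective LA.coboundaries).subsingleton

/-- The modular class of `Φ` is the pullback of the characteristic class of the representation of `B`
on `∧^top C`, because `L^A ≅ ∧^top C ⊗ L^B` as representations of `A`. -/
lemma IsExtension.modClassHom_eq [SigmaCompactSpace M] {LC : LieAlgebroid E FC C}
    {LA : LieAlgebroid E FA A} {LB : LieAlgebroid E FB B}
    {i : BundleMap E FC C FA A} {Φ : BundleMap E FA A FB B} (h : IsExtension LC LA LB i Φ)
    {D : LB.Rep ℝ (TopPow FC C)} (hD : ∀ X, D.D (Φ.app X) = h.adjointRep.D X) :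
    modClassHom h.hom_right = pullback h.hom_right (charClass D) := by
  rcases isEmpty_or_nonempty M with hM | hM
  · have := subsingleton_H1 LA
    exact Subsingleton.elim _ _
  obtain ⟨e⟩ := h.nonempty_equiv
  obtain ⟨DA, hDA, hA⟩ := isModClass_modClass LA
  obtain ⟨DB, hDB, hB⟩ := isModClass_modClass LB
  obtain ⟨p, hp⟩ := h.exists_isProductRep e hDA hDB
  have hrep : h.hom_right.pullRep D = h.adjointRep := LieAlgebroid.Rep.ext hD
  have hc := hp.charClass_eq (hrep ▸ h.hom_right.isCharClass_pullRep (isCharClass_charClass D))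
    (h.hom_right.isCharClass_pullRep hB) hA
  rw [modClassHom, hc, add_sub_cancel_right]

end Extension

end LieAlgd

end

theorem theorem4p5
    {E : Type*} [NormedAddCommGroup E] [NormedSpace ℝ E] [FiniteDimensional ℝ E]
    {M : Type*} [TopologicalSpace M] [ChartedSpace E M] [IsManifold 𝓘(ℝ, E) ∞ M]
    [T2Space M] [SigmaCompactSpace M]
    {FA : Type*} [NormedAddCommGroup FA] [NormedSpace ℝ FA] [FiniteDimensional ℝ FA]
    {A : M → Type*} [∀ m, AddCommGroup (A m)] [∀ m, Module ℝ (A m)]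
    [TopologicalSpace (TotalSpace FA A)] [∀ m, TopologicalSpace (A m)] [FiberBundle FA A]
    [VectorBundle ℝ FA A] [ContMDiffVectorBundle ∞ FA A 𝓘(ℝ, E)]
    [∀ m, IsTopologicalAddGroup (A m)] [∀ m, ContinuousSMul ℝ (A m)]
    {FB : Type*} [NormedAddCommGroup FB] [NormedSpace ℝ FB] [FiniteDimensional ℝ FB]
    {B : M → Type*} [∀ m, AddCommGroup (B m)] [∀ m, Module ℝ (B m)]
    [TopologicalSpace (TotalSpace FB B)] [∀ m, TopologicalSpace (B m)] [FiberBundle FB B]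
    [VectorBundle ℝ FB B] [ContMDiffVectorBundle ∞ FB B 𝓘(ℝ, E)]
    [∀ m, IsTopologicalAddGroup (B m)] [∀ m, ContinuousSMul ℝ (B m)]
    {FC : Type*} [NormedAddCommGroup FC] [NormedSpace ℝ FC] [FiniteDimensional ℝ FC]
    {C : M → Type*} [∀ m, AddCommGroup (C m)] [∀ m, Module ℝ (C m)]
    [TopologicalSpace (TotalSpace FC C)] [∀ m, TopologicalSpace (C m)] [FiberBundle FC C]
    [VectorBundle ℝ FC C] [ContMDiffVectorBundle ∞ FC C 𝓘(ℝ, E)]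
    (LC : LieAlgebroid E FC C) (LA : LieAlgebroid E FA A) (LB : LieAlgebroid E FB B)
    (i : BundleMap E FC C FA A) (Φ : BundleMap E FA A FB B)
    (hext : IsExtension LC LA LB i Φ) (hB : LB.IsTransitive) (hC : LC.IsUnimodular) :
    (∃! c, LA.IsModClass c) ∧ (∃! c, LB.IsModClass c) ∧ (∃! c, LC.IsModClass c) ∧
    ∃ DAK : LA.Rep ℝ (TopPow FC C),
      (IsAdjointTop LA i DAK ∧ ∀ D', IsAdjointTop LA i D' → D' = DAK) ∧
      ∃ DBK : LB.Rep ℝ (TopPow FC C),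
        ((∀ X k, DBK.D (Φ.app X) k = DAK.D X k) ∧
          ∀ D' : LB.Rep ℝ (TopPow FC C), (∀ X k, D'.D (Φ.app X) k = DAK.D X k) → D' = DBK) ∧
        (∃! c, IsCharClass DBK c) ∧
        modClassHom hext.hom_right = pullback hext.hom_right (charClass DBK) := by
  obtain ⟨DBK, hDBK⟩ := hext.exists_quotientRep hC
  refine ⟨existsUnique_isModClass LA, existsUnique_isModClass LB, existsUnique_isModClass LC,
    hext.adjointRep, ⟨hext.isAdjointTop_adjointRep,
      fun D' hD' => hext.isAdjointTop_unique hD' hext.isAdjointTop_adjointRep⟩, DBK,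
    ⟨fun X k => by rw [hDBK], fun D' hD' => LieAlgebroid.Rep.ext fun b => ?_⟩,
    existsUnique_isCharClass DBK, hext.modClassHom_eq hDBK⟩
  obtain ⟨X, rfl⟩ := hext.exists_app_eq b
  rw [hDBK]
  exact LinearMap.ext (hD' X)
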